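/- **Setting.** Let $d\in\{2,3\}$ and let $\Omega\subset\mathbb R^d$ be a bounded polytopal domain, partitioned into a finite mesh $\mathcal T_h$ of disjoint open polytopal elements, with a finite set $\mathcal F_h$ of flat $(d-1)$-dimensional (relatively open, disjoint) faces; each face inside $\Omega$ is shared by exactly two elements, each face on $\partial\Omega$ belongs to exactly one. $\mathcal F_h(K)$ is the set of faces on $\partial K$, $\boldsymbol n$ the outward unit normal of $K$, $(\cdot,\cdot)_D$ the $L^2(D)$ inner product, and $\mathbb P_k$ the polynomials of degree at most $k$. Let $f\in L^2(\Omega)$ and let $u\in H^1_0(\Omega)$ satisfy $(\nabla u,\nabla v)_\Omega=(f,v)_\Omega$ for all $v\in H^1_0(\Omega)$. Assume that on each element the normal trace $\nabla u\cdot\boldsymbol n$ (defined weakly through Green's formula) is an integrable function on the faces, so that the pairings below make sense as integrals. Put $V_h(K)=\{v\in H^1(K):\Delta v=0\text{ in }K,\ \nabla v\cdot\boldsymbol n|_F\in\mathbb P_0(F)\ \forall F\in\mathcal F_h(K)\}$ and $$V_h=\Bigl\{v\in L^2(\Omega): v|_K\in V_h(K)\ \forall K\in\mathcal T_h,\ \int_F[\![v]\!]\,dS=0\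 \forall F\in\mathcal F_h\Bigr\},$$ where $[\![v]\!]$ is the jump of the traces across an interior face, and $[\![v]\!]=v|_F$ on a boundary face. Let $\chi_F(v)=Q_Fv=|F|^{-1}\int_F v\,dS$. The interpolant $u_I\in V_h$ of $u$ satisfies $\chi_F(u_I)=\chi_F(u)$ for all $F\in\mathcal F_h$. For each $K\in\mathcal T_h$ let $\omega_K$ be a union of elements of $\mathcal T_h$ that contains $K$ (possibly $\omega_K=K$). For $v\in V_h$ let $\Pi_Kv,\Pi_{\omega_K}v\in\mathbb P_1$ be given by $$(\nabla\Pi_Kv,\nabla q)_K=(\nabla v,\nabla q)_K,\qquad(\nabla\Pi_{\omega_K}v,\nabla q)_{\omega_K}=\sum_{K'\subset\omega_K}(\nabla v,\nabla q)_{K'}\qquad\forall q\in\mathbb P_1,$$ $$\int_{\partial\omega_K}\Pi_Kv\,dS=\int_{\partial\omega_K}\Pi_{\omega_K}v\,dS=\int_{\partial\omega_K}v\,dS .$$ For each $K$ let $S_K$ be an arbitrary bilinear form on $V_h(K)$, and put $$a_h(v,w)=\sum_{K\in\mathcal T_h}\Bigl\{(\nabla\Pi_Kv,\nabla\Pi_Kw)_K+S_K\bigl(v-\Pi_{\omega_K}v,\,w-\Pi_{\omega_K}w\bigr)\Bigr\}.$$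 Let $u_h\in V_h$ satisfy $a_h(u_h,v_h)=\sum_{K\in\mathcal T_h}(f,\Pi_Kv_h)_K$ for all $v_h\in V_h$. **Lemma (an error equation).** For every piecewise linear polynomial $u_\pi$ on $\mathcal T_h$ (that is, $u_\pi|_K\in\mathbb P_1$ for each $K$, without continuity) and every $v_h\in V_h$, $$a_h(u_h-u_I,v_h)=\sum_{K\in\mathcal T_h}\sum_{F\in\mathcal F_h(K)}\bigl\langle\nabla(u-u_\pi)\cdot\boldsymbol n,\;Q_Fv_h-\Pi_Kv_h\bigr\rangle_F-\sum_{K\in\mathcal T_h}S_K\bigl(u_I-\Pi_{\omega_K}u_I,\;v_h-\Pi_{\omega_K}v_h\bigr).$$ -/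

import Mathlib

open MeasureTheory Filter Topology
open scoped ContDiff RealInnerProductSpace Gradient

namespace NCVEM

noncomputable section

open scoped Classical

/-- The Euclidean space `ℝ^d`. -/
abbrev E (d : ℕ) : Type := EuclideanSpace ℝ (Fin d)

/-- Polynomials of degree at most one on `ℝ^d`. A polynomial on a set with nonempty interior is
identified with its unique extension to the whole space. -/
abbrev P1 (d : ℕ) : Type := E d →ᵃ[ℝ] ℝ

variable {d : ℕ}

/-- Surface measure on a face: the `(d-1)`-dimensional Hausdorff measure, normalized so that it is
Lebesgue measure on hyperplanes. -/
def surf (F : Set (E d)) : Measure (E d) := (μHE[d - 1] : Measure (E d)).restrict F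

/-! ### Polytopes and meshes -/

/-- A flat face: a nonempty, connected, relatively open subset of a hyperplane, whose relative
boundary lies in finitely many affine subspaces of codimension at least two. -/
structure IsFlatFace (F : Set (E d)) : Prop where
  connected : IsConnected F
  flat : ∃ (n : E d) (b : ℝ) (U : Set (E d)), ‖n‖ = 1 ∧ IsOpen U ∧ F = U ∩ {x | ⟪n, x⟫ = b}
  boundary : ∃ L : Finset (AffineSubspace ℝ (E d)),
    (∀ A ∈ L, Module.finrank ℝ A.direction + 2 ≤ d) ∧
      closure F \ F ⊆ ⋃ A ∈ L, (A : Set (E d))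

/-- `n` is the outward unit normal of `K` along `F`: near each point of `F`, the set `K` is the
open half-space lying on the side of `-n`. -/
def IsOutwardNormal (K F : Set (E d)) (n : E d) : Prop :=
  ‖n‖ = 1 ∧ ∀ x ∈ F, ∃ r > 0, K ∩ Metric.ball x r = {y | ⟪n, y - x⟫ < 0} ∩ Metric.ball x r

/-- `K` is a bounded polytopal domain, whose boundary consists of the flat faces in `Fs`
(relatively open) and of their relative boundaries. -/
structure IsPolytope (K : Set (E d)) (Fs : Finset (Set (E d))) : Prop where
  isOpen : IsOpen K
  connected : IsConnected K
  bounded : Bornology.IsBounded K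
  face : ∀ F ∈ Fs, IsFlatFace F
  normal : ∀ F ∈ Fs, ∃ n, IsOutwardNormal K F n
  frontier_eq : frontier K = ⋃ F ∈ Fs, closure F

/-- The members of `Fs` that lie on the boundary of `D`. -/
def facesOn (Fs : Finset (Set (E d))) (D : Set (E d)) : Finset (Set (E d)) :=
  Fs.filter fun F => F ⊆ frontier D

/-- A polytopal mesh of the polytopal domain `Ω`, with (open) elements `elems` and (relatively
open) faces `faces`. Hanging nodes are allowed: several faces may lie in one hyperplane. -/
structure Mesh (Ω : Set (E d)) where
  elems : Finset (Set (E d))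
  faces : Finset (Set (E d))
  domain : IsPolytope Ω (facesOn faces Ω)
  element : ∀ K ∈ elems, IsPolytope K (facesOn faces K)
  elems_disjoint : (elems : Set (Set (E d))).PairwiseDisjoint id
  faces_disjoint : (faces : Set (Set (E d))).PairwiseDisjoint id
  elems_subset : ∀ K ∈ elems, K ⊆ Ω
  cover : closure Ω = ⋃ K ∈ elems, closure K
  face_cases : ∀ F ∈ faces, F ⊆ Ω ∨ F ⊆ frontier Ω
  interior_face : ∀ F ∈ faces, F ⊆ Ω → (elems.filter fun K => F ⊆ frontier K).card = 2
  boundary_face : ∀ F ∈ faces, F ⊆ frontier Ω → (elems.filter fun K => F ⊆ frontier K).card = 1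

/-- The faces of the element `K`. -/
abbrev Mesh.facesOf {Ω : Set (E d)} (T : Mesh Ω) (K : Set (E d)) : Finset (Set (E d)) :=
  facesOn T.faces K

/-- A choice, for every element `K`, of an extended element patch: a set of elements
containing `K`. -/
structure Patches {Ω : Set (E d)} (T : Mesh Ω) where
  elems : Set (E d) → Finset (Set (E d))
  subset : ∀ K ∈ T.elems, elems K ⊆ T.elems
  self_mem : ∀ K ∈ T.elems, K ∈ elems K

/-- The region `ω_K` covered by the patch of `K`. -/
def Patches.region {Ω : Set (E d)} {T : Mesh Ω} (W : Patches T) (K : Set (E d)) : Set (E d) :=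
  ⋃ K' ∈ W.elems K, closure K'

/-! ### Sobolev functions, traces and normal derivatives -/

/-- Convergence in `L²(μ)`. -/
def TendstoL2 {V : Type*} [NormedAddCommGroup V] (μ : Measure (E d)) (φ : ℕ → E d → V)
    (v : E d → V) : Prop :=
  Tendsto (fun k => eLpNorm (φ k - v) 2 μ) atTop (𝓝 0)

/-- `φ ∈ C_c^∞(D)`. -/
def IsTest (D : Set (E d)) (φ : E d → ℝ) : Prop :=
  ContDiff ℝ ∞ φ ∧ HasCompactSupport φ ∧ tsupport φ ⊆ D

/-- `G ∈ L²(D)` is the weak gradient of `v` on the open set `D`. -/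
def IsWeakGrad (D : Set (E d)) (v : E d → ℝ) (G : E d → E d) : Prop :=
  MemLp G 2 (volume.restrict D) ∧
    ∀ φ, IsTest D φ → ∫ x in D, v x • ∇ φ x = -∫ x in D, φ x • G x

/-- `v ∈ H¹(D)`. -/
def MemH1 (D : Set (E d)) (v : E d → ℝ) : Prop :=
  MemLp v 2 (volume.restrict D) ∧ ∃ G, IsWeakGrad D v G

/-- The weak gradient on `D` (determined almost everywhere on `D`). -/
def grad (D : Set (E d)) (v : E d → ℝ) : E d → E d := Classical.epsilon (IsWeakGrad D v)

/-- `v ∈ H¹₀(D)`: the function `v` is a limit in `H¹(D)` of functions in `C_c^∞(D)`. -/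
def MemH10 (D : Set (E d)) (v : E d → ℝ) : Prop :=
  MemH1 D v ∧ ∃ φ : ℕ → E d → ℝ, (∀ k, IsTest D (φ k)) ∧
    TendstoL2 (volume.restrict D) φ v ∧
    TendstoL2 (volume.restrict D) (fun k => ∇ (φ k)) (grad D v)

/-- `g` is the trace of `v ∈ H¹(K)` on the faces `Fs` of `K`: there are functions, smooth up to
the boundary, that converge to `v` in `H¹(K)` and whose restrictions to the faces converge to `g`
in `L²`. -/
def IsTrace (K : Set (E d)) (Fs : Finset (Set (E d))) (v g : E d → ℝ) : Prop :=
  ∃ φ : ℕ → E d → ℝ, (∀ k, ContDiff ℝ ∞ (φ k)) ∧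
    TendstoL2 (volume.restrict K) φ v ∧
    TendstoL2 (volume.restrict K) (fun k => ∇ (φ k)) (grad K v) ∧
    ∀ F ∈ Fs, MemLp g 2 (surf F) ∧ TendstoL2 (surf F) φ g

/-- The trace of `v` on the faces `Fs` of `K` (determined almost everywhere on the faces). -/
def trace (K : Set (E d)) (Fs : Finset (Set (E d))) (v : E d → ℝ) : E d → ℝ :=
  Classical.epsilon (IsTrace K Fs v)

/-- `l = Δ v` weakly in `K`, and `g = ∇ v ⬝ n` on the faces `Fs` of `K` with respect to the outward
normal, in the usual weak sense: `(∇ v, ∇ φ)_K + (Δ v, φ)_K = ⟨∇ v ⬝ n, φ⟩_{∂ K}` for all `φ` that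
are smooth up to the boundary. -/
def IsNormalDeriv (K : Set (E d)) (Fs : Finset (Set (E d))) (v l g : E d → ℝ) : Prop :=
  MemLp l 2 (volume.restrict K) ∧ (∀ F ∈ Fs, Integrable g (surf F)) ∧
    ∀ φ : E d → ℝ, ContDiff ℝ ∞ φ →
      (∫ x in K, ⟪grad K v x, ∇ φ x⟫) + ∫ x in K, l x * φ x = ∑ F ∈ Fs, ∫ x, g x * φ x ∂(surf F)

/-- The normal derivative of `v` on the faces of `K` is an integrable function. -/
def HasNormalDeriv (K : Set (E d)) (Fs : Finset (Set (E d))) (v : E d → ℝ) : Prop :=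
  ∃ g l, IsNormalDeriv K Fs v l g

/-- The outward normal derivative `∇ v ⬝ n` on the faces `Fs` of `K` (determined almost everywhere
on the faces). -/
def normalDeriv (K : Set (E d)) (Fs : Finset (Set (E d))) (v : E d → ℝ) : E d → ℝ :=
  Classical.epsilon fun g => ∃ l, IsNormalDeriv K Fs v l g

/-- `u ∈ H¹₀(Ω)` and `(∇ u, ∇ v) = (f, v)` for all `v ∈ H¹₀(Ω)`. -/
def IsWeakSolution (Ω : Set (E d)) (f u : E d → ℝ) : Prop :=
  MemH10 Ω u ∧ ∀ v, MemH10 Ω v → ∫ x in Ω, ⟪grad Ω u x, grad Ω v x⟫ = ∫ x in Ω, f x * v x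

/-! ### The nonconforming virtual element method -/

/-- `V_h(K)`: functions in `H¹(K)` (together with their trace on the faces of `K`) that are
harmonic in `K` and whose normal derivative is constant on each face. -/
def localSpace (K : Set (E d)) (Fs : Finset (Set (E d))) : Set (E d → ℝ) :=
  {v | MemH1 K v ∧ (∃ g, IsTrace K Fs v g) ∧
    ∃ g, IsNormalDeriv K Fs v 0 g ∧ ∀ F ∈ Fs, ∃ c : ℝ, ∀ x ∈ F, g x = c}

variable {Ω : Set (E d)}

/-- The mean `χ_F` over the face `F` of the trace from `K`. -/
def Mesh.chi (T : Mesh Ω) (K F : Set (E d)) (v : E d → ℝ) : ℝ :=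
  ((surf F).real Set.univ)⁻¹ * ∫ x, trace K (T.facesOf K) v x ∂(surf F)

/-- The global space `V_h`: piecewise in `V_h(K)`, with jumps of mean zero on all faces; on a
boundary face the jump is the trace itself. -/
def Mesh.space (T : Mesh Ω) : Set (E d → ℝ) :=
  {v | MemLp v 2 (volume.restrict Ω) ∧
    (∀ K ∈ T.elems, v ∈ localSpace K (T.facesOf K)) ∧
    (∀ K ∈ T.elems, ∀ K' ∈ T.elems, ∀ F ∈ T.faces, F ⊆ Ω → F ⊆ frontier K → F ⊆ frontier K' →
      ∫ x, trace K (T.facesOf K) v x ∂(surf F) = ∫ x, trace K' (T.facesOf K') v x ∂(surf F)) ∧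
    ∀ K ∈ T.elems, ∀ F ∈ T.faces, F ⊆ frontier Ω → F ⊆ frontier K →
      ∫ x, trace K (T.facesOf K) v x ∂(surf F) = 0}

/-- `w ∈ V_h` is the canonical interpolant of `u`. -/
def Mesh.IsInterpolant (T : Mesh Ω) (u w : E d → ℝ) : Prop :=
  w ∈ T.space ∧ ∀ K ∈ T.elems, ∀ F ∈ T.facesOf K, T.chi K F u = T.chi K F w

namespace Patches

variable {T : Mesh Ω} (W : Patches T)

/-- The faces on the boundary of the patch `ω_K`. -/
def bdryFaces (K : Set (E d)) : Finset (Set (E d)) := facesOn T.faces (W.region K)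

/-- `∫_{∂ ω_K} v dS`, with traces taken from inside the patch (each boundary face of the patch
belongs to exactly one of its elements). -/
def bdryIntegral (K : Set (E d)) (v : E d → ℝ) : ℝ :=
  ∑ F ∈ W.bdryFaces K, ∑ K' ∈ (W.elems K).filter (fun K' => F ⊆ frontier K'),
    ∫ x, trace K' (T.facesOf K') v x ∂(surf F)

/-- `∫_{∂ ω_K} p dS` for a polynomial. -/
def bdryIntegralP1 (K : Set (E d)) (p : P1 d) : ℝ :=
  ∑ F ∈ W.bdryFaces K, ∫ x, p x ∂(surf F)

/-- The defining conditions of `Π_K v`. The additive constant is fixed on `∂ ω_K`, which is `∂ K`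
when the patch of `K` is `K` itself. -/
def IsProjK (K : Set (E d)) (v : E d → ℝ) (p : P1 d) : Prop :=
  (∀ q : P1 d, ∫ x in K, ⟪∇ p x, ∇ q x⟫ = ∫ x in K, ⟪grad K v x, ∇ q x⟫) ∧
    W.bdryIntegralP1 K p = W.bdryIntegral K v

/-- The elliptic projection `Π_K v`. -/
def projK (K : Set (E d)) (v : E d → ℝ) : P1 d := Classical.epsilon (W.IsProjK K v)

/-- The defining conditions of `Π_{ω_K} v`. -/
def IsProjPatch (K : Set (E d)) (v : E d → ℝ) (p : P1 d) : Prop :=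
  (∀ q : P1 d, ∫ x in W.region K, ⟪∇ p x, ∇ q x⟫ =
      ∑ K' ∈ W.elems K, ∫ x in K', ⟪grad K' v x, ∇ q x⟫) ∧
    W.bdryIntegralP1 K p = W.bdryIntegral K v

/-- The discrete `H¹`-type projection `Π_{ω_K} v` on the patch. -/
def projPatch (K : Set (E d)) (v : E d → ℝ) : P1 d := Classical.epsilon (W.IsProjPatch K v)

/-- The discrete bilinear form `a_h` with stabilization `S`. -/
def ah (S : Set (E d) → (E d → ℝ) → (E d → ℝ) → ℝ) (v w : E d → ℝ) : ℝ :=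
  ∑ K ∈ T.elems, ((∫ x in K, ⟪∇ (W.projK K v) x, ∇ (W.projK K w) x⟫) +
    S K (v - ⇑(W.projPatch K v)) (w - ⇑(W.projPatch K w)))

/-- `u_h ∈ V_h` solves the virtual element discretization with data `f`. -/
def IsVEMSolution (S : Set (E d) → (E d → ℝ) → (E d → ℝ) → ℝ) (f uh : E d → ℝ) : Prop :=
  uh ∈ T.space ∧ ∀ v ∈ T.space, W.ah S uh v = ∑ K ∈ T.elems, ∫ x in K, f x * W.projK K v x

end Patches

/-- `B` is bilinear on the space of functions `V`. -/
def IsBilinearOn (V : Set (E d → ℝ)) (B : (E d → ℝ) → (E d → ℝ) → ℝ) : Prop :=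
  (∀ a : ℝ, ∀ w₁ ∈ V, ∀ w₂ ∈ V, ∀ z ∈ V, B (a • w₁ + w₂) z = a * B w₁ z + B w₂ z) ∧
    ∀ a : ℝ, ∀ w₁ ∈ V, ∀ w₂ ∈ V, ∀ z ∈ V, B z (a • w₁ + w₂) = a * B z w₁ + B z w₂

end

end NCVEM

/-!
Green's formula holds on a polytope for functions smooth up to the boundary: near a point of a face
it is the formula for a half-space, and the remaining skeleton of codimension two is removable,
because a cutoff at distance `ε` has gradient of size `1/ε` on a set of volume `O(ε²)`. It fixes the
means of traces in terms of gradients, so that `Π_K` only sees the face means, and therefore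
`∇ Π_K u_I` and `∇ u` have the same pairing with gradients of affine functions on `K`.

Testing the equation with a bump function supported near a face shows that the fluxes `∇ u ⬝ n` of
the two neighbouring elements cancel; as the face means of `v_h` are single-valued and vanish on
`∂Ω`, the terms `χ_F(v_h) ∫_F ∇ u ⬝ n` add up to zero. Green's formula on each element then turns
`(f, Π_K v_h)_K - (∇ u, ∇ Π_K v_h)_K` into the flux paired with `-Π_K v_h`. The flux of an affine
function is constant on each face, and by the definition of `Π_K` it is orthogonal to
`Q_F v_h - Π_K v_h` over `∂K`, so `u` may be replaced by `u - u_π`.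
-/

namespace NCVEM

variable {d : ℕ}

/-! ### Green's formula on a half-space -/

section HalfSpace

/-- Cartesian coordinates of `ℝ^d` adapted to the hyperplane through `x₀` with unit normal `n`: the
first coordinate is the signed distance to the hyperplane. -/
noncomputable def hyperplaneCoords (n x₀ : E d) (p : ℝ × (ℝ ∙ n)ᗮ) : E d := x₀ + p.1 • n + p.2

variable {n : E d}

theorem hyperplaneCoords_eq_comp (hn : ‖n‖ = 1) (x₀ : E d) :
    hyperplaneCoords n x₀ = ((ℝ ∙ n).measurableEquivProd x₀).symm ∘
      Prod.map (LinearIsometryEquiv.toSpanUnitSingleton (𝕜 := ℝ) n hn) id := by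
  funext p
  simp only [hyperplaneCoords, Function.comp_apply, Submodule.measurableEquivProd_symm_apply,
    Prod.map_fst, LinearIsometryEquiv.toSpanUnitSingleton_apply, Prod.map_snd, id_eq, vadd_eq_add]
  abel

theorem measurePreserving_hyperplaneCoords (hn : ‖n‖ = 1) (x₀ : E d) :
    MeasurePreserving (hyperplaneCoords n x₀) (volume.prod volume) volume := by
  have h := (ℝ ∙ n).measurePreserving_measurableEquivProd x₀
  rw [InnerProductSpace.euclideanHausdorffMeasure_eq_volume] at h
  rw [hyperplaneCoords_eq_comp hn]
  exact h.symm.comp ((LinearIsometryEquiv.measurePreserving _).prod (MeasurePreserving.id _))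

theorem measurableEmbedding_hyperplaneCoords (hn : ‖n‖ = 1) (x₀ : E d) :
    MeasurableEmbedding (hyperplaneCoords n x₀) := by
  rw [hyperplaneCoords_eq_comp hn]
  exact (MeasurableEquiv.measurableEmbedding _).comp ((LinearIsometryEquiv.toSpanUnitSingleton
    (𝕜 := ℝ) n hn).toHomeomorph.toMeasurableEquiv.prodCongr
      (MeasurableEquiv.refl _)).measurableEmbedding

theorem inner_hyperplaneCoords_sub (hn : ‖n‖ = 1) (x₀ : E d) (p : ℝ × (ℝ ∙ n)ᗮ) :
    ⟪n, hyperplaneCoords n x₀ p - x₀⟫ = p.1 := by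
  have hp : ⟪n, (p.2 : E d)⟫ = 0 := Submodule.mem_orthogonal_singleton_iff_inner_right.1 p.2.2
  rw [hyperplaneCoords, add_assoc, add_sub_cancel_left, inner_add_right, hp, inner_smul_right,
    real_inner_self_eq_norm_sq, hn]
  ring

theorem contDiff_hyperplaneCoords (n x₀ : E d) {k : WithTop ℕ∞} :
    ContDiff ℝ k (hyperplaneCoords n x₀) :=
  (contDiff_const.add (contDiff_fst.smul contDiff_const)).add
    ((ℝ ∙ n)ᗮ.subtypeL.contDiff.comp contDiff_snd)

theorem isometry_hyperplaneCoords_left (hn : ‖n‖ = 1) (x₀ : E d) (y : (ℝ ∙ n)ᗮ) :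
    Isometry fun t : ℝ => hyperplaneCoords n x₀ (t, y) :=
  Isometry.of_dist_eq fun s t => by
    simp only [hyperplaneCoords, dist_add_left, dist_add_right]
    rw [dist_eq_norm, ← sub_smul, norm_smul, hn, mul_one, dist_eq_norm]

theorem isometry_hyperplaneCoords_right (n x₀ : E d) (t : ℝ) :
    Isometry fun y : (ℝ ∙ n)ᗮ => hyperplaneCoords n x₀ (t, y) :=
  (isometry_add_left (x₀ + t • n)).comp isometry_subtype_coe

theorem finrank_orthogonal_span_singleton (hn : ‖n‖ = 1) :
    Module.finrank ℝ (ℝ ∙ n)ᗮ = d - 1 := by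
  have h := Submodule.finrank_add_finrank_orthogonal (ℝ ∙ n)
  rw [finrank_span_singleton (norm_ne_zero_iff.1 (hn ▸ one_ne_zero)),
    finrank_euclideanSpace_fin] at h
  omega

theorem surf_hyperplane (hn : ‖n‖ = 1) (x₀ : E d) :
    surf {x : E d | ⟪n, x - x₀⟫ = 0} =
      (volume : Measure (ℝ ∙ n)ᗮ).map (fun y : (ℝ ∙ n)ᗮ => x₀ + (y : E d)) := by
  have hiso : Isometry (fun y : (ℝ ∙ n)ᗮ => x₀ + (y : E d)) :=
    (isometry_add_left x₀).comp isometry_subtype_coe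
  rw [← InnerProductSpace.euclideanHausdorffMeasure_eq_volume,
    finrank_orthogonal_span_singleton hn, hiso.map_euclideanHausdorffMeasure, surf]
  congr 1
  ext x
  simp only [Set.mem_ofPred_eq, Set.mem_range]
  constructor
  · intro h
    exact ⟨⟨x - x₀, Submodule.mem_orthogonal_singleton_iff_inner_right.2 h⟩, by simp⟩
  · rintro ⟨y, rfl⟩
    simpa using Submodule.mem_orthogonal_singleton_iff_inner_right.1 y.2

theorem isClosed_hyperplane (n x₀ : E d) : IsClosed {x : E d | ⟪n, x - x₀⟫ = 0} :=
  isClosed_eq (by fun_prop) continuous_const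

theorem integral_halfspace (hn : ‖n‖ = 1) (x₀ : E d) (g : E d → ℝ) :
    ∫ x in {x | ⟪n, x - x₀⟫ < 0}, g x =
      ∫ p in Set.Iio (0 : ℝ) ×ˢ (Set.univ : Set (ℝ ∙ n)ᗮ), g (hyperplaneCoords n x₀ p)
        ∂(volume.prod volume) := by
  rw [← (measurePreserving_hyperplaneCoords hn x₀).setIntegral_preimage_emb
    (measurableEmbedding_hyperplaneCoords hn x₀)]
  congr 2
  ext p
  simp [inner_hyperplaneCoords_sub hn]

theorem integrable_fderiv_apply {V : Type*} [NormedAddCommGroup V] [NormedSpace ℝ V]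
    [MeasurableSpace V] [OpensMeasurableSpace V] {μ : Measure V} [IsFiniteMeasureOnCompacts μ]
    {ψ : V → ℝ} (hψ : ContDiff ℝ 1 ψ) (hc : HasCompactSupport ψ) (a : V) :
    Integrable (fun x => fderiv ℝ ψ x a) μ :=
  ((hψ.continuous_fderiv one_ne_zero).clm_apply continuous_const).integrable_of_hasCompactSupport
    (hc.fderiv_apply ℝ a)

theorem integral_fderiv_apply_eq_zero {V : Type*} [NormedAddCommGroup V] [NormedSpace ℝ V]
    [MeasurableSpace V] [BorelSpace V] [FiniteDimensional ℝ V] {μ : Measure V}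
    [μ.IsAddHaarMeasure] {ψ : V → ℝ} (hψ : ContDiff ℝ 1 ψ) (hc : HasCompactSupport ψ) (a : V) :
    ∫ x, fderiv ℝ ψ x a ∂μ = 0 := by
  have := integral_mul_fderiv_eq_neg_fderiv_mul_of_integrable (μ := μ) (v := a)
    (f := fun _ : V => (1 : ℝ)) (g := ψ) (by simp)
    (by simpa using integrable_fderiv_apply hψ hc a)
    (by simpa using hψ.continuous.integrable_of_hasCompactSupport hc)
    (fun _ _ => differentiableAt_const _) (fun x _ => hψ.differentiable one_ne_zero x)
  simpa using this

variable {ψ : E d → ℝ}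

theorem integrable_fderiv_comp_hyperplaneCoords (hn : ‖n‖ = 1) (x₀ : E d)
    (hψ : ContDiff ℝ 1 ψ) (hc : HasCompactSupport ψ) (a : E d) :
    Integrable (fun p => fderiv ℝ ψ (hyperplaneCoords n x₀ p) a) (volume.prod volume) :=
  ((measurePreserving_hyperplaneCoords hn x₀).integrable_comp_emb
    (measurableEmbedding_hyperplaneCoords hn x₀)).2 (integrable_fderiv_apply hψ hc a)

theorem integral_Iio_fderiv_hyperplaneCoords (hn : ‖n‖ = 1) (x₀ : E d) (hψ : ContDiff ℝ 1 ψ)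
    (hc : HasCompactSupport ψ) (y : (ℝ ∙ n)ᗮ) :
    ∫ t in Set.Iio (0 : ℝ), fderiv ℝ ψ (hyperplaneCoords n x₀ (t, y)) n = ψ (x₀ + y) := by
  have hline (t : ℝ) : HasDerivAt (fun t : ℝ => hyperplaneCoords n x₀ (t, y)) n t := by
    simpa [hyperplaneCoords] using
      (((hasDerivAt_id t).smul_const n).const_add x₀).add_const (y : E d)
  have hcomp : ContDiff ℝ 1 fun t : ℝ => ψ (hyperplaneCoords n x₀ (t, y)) :=
    hψ.comp ((contDiff_hyperplaneCoords n x₀).comp (contDiff_prodMk_left y))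
  have hderiv (t : ℝ) : deriv (fun t : ℝ => ψ (hyperplaneCoords n x₀ (t, y))) t =
      fderiv ℝ ψ (hyperplaneCoords n x₀ (t, y)) n :=
    ((hψ.differentiable one_ne_zero _).hasFDerivAt.comp_hasDerivAt t (hline t)).deriv
  have hftc := HasCompactSupport.integral_Iic_deriv_eq hcomp
    (hc.comp_isClosedEmbedding (isometry_hyperplaneCoords_left hn x₀ y).isClosedEmbedding) 0
  simp only [hderiv] at hftc
  rw [← integral_Iic_eq_integral_Iio, hftc]
  simp [hyperplaneCoords]

theorem integral_halfspace_fderiv_normal (hn : ‖n‖ = 1) (x₀ : E d) (hψ : ContDiff ℝ 1 ψ)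
    (hc : HasCompactSupport ψ) :
    ∫ x in {x | ⟪n, x - x₀⟫ < 0}, fderiv ℝ ψ x n =
      ∫ x, ψ x ∂(surf {x | ⟪n, x - x₀⟫ = 0}) := by
  have hI := (integrable_fderiv_comp_hyperplaneCoords hn x₀ hψ hc n).integrableOn
    (s := Set.Iio (0 : ℝ) ×ˢ (Set.univ : Set (ℝ ∙ n)ᗮ))
  rw [IntegrableOn, ← Measure.prod_restrict, Measure.restrict_univ] at hI
  rw [integral_halfspace hn, surf_hyperplane hn, integral_map (by fun_prop)
    hψ.continuous.aestronglyMeasurable, ← Measure.prod_restrict, Measure.restrict_univ,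
    integral_prod_symm _ hI]
  simp only [integral_Iio_fderiv_hyperplaneCoords hn x₀ hψ hc]

theorem integral_fderiv_hyperplaneCoords_tangential (x₀ : E d) (hψ : ContDiff ℝ 1 ψ)
    (hc : HasCompactSupport ψ) {a : E d} (ha : ⟪n, a⟫ = 0) (t : ℝ) :
    ∫ y : (ℝ ∙ n)ᗮ, fderiv ℝ ψ (hyperplaneCoords n x₀ (t, y)) a = 0 := by
  let a' : (ℝ ∙ n)ᗮ := ⟨a, Submodule.mem_orthogonal_singleton_iff_inner_right.2 ha⟩
  have hcomp : ContDiff ℝ 1 fun y : (ℝ ∙ n)ᗮ => ψ (hyperplaneCoords n x₀ (t, y)) :=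
    hψ.comp ((contDiff_hyperplaneCoords n x₀).comp (contDiff_prodMk_right t))
  have hderiv (y : (ℝ ∙ n)ᗮ) :
      fderiv ℝ (fun y : (ℝ ∙ n)ᗮ => ψ (hyperplaneCoords n x₀ (t, y))) y a' =
        fderiv ℝ ψ (hyperplaneCoords n x₀ (t, y)) a := by
    have hplane : HasFDerivAt (fun y : (ℝ ∙ n)ᗮ => hyperplaneCoords n x₀ (t, y))
        (ℝ ∙ n)ᗮ.subtypeL y := (ℝ ∙ n)ᗮ.subtypeL.hasFDerivAt.const_add (x₀ + t • n)
    exact DFunLike.congr_fun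
      ((hψ.differentiable one_ne_zero _).hasFDerivAt.comp y hplane).fderiv a'
  simp only [← hderiv]
  exact integral_fderiv_apply_eq_zero hcomp
    (hc.comp_isClosedEmbedding (isometry_hyperplaneCoords_right n x₀ t).isClosedEmbedding) a'

theorem integral_halfspace_fderiv_tangential (hn : ‖n‖ = 1) (x₀ : E d) (hψ : ContDiff ℝ 1 ψ)
    (hc : HasCompactSupport ψ) {a : E d} (ha : ⟪n, a⟫ = 0) :
    ∫ x in {x | ⟪n, x - x₀⟫ < 0}, fderiv ℝ ψ x a = 0 := by
  rw [integral_halfspace hn,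
    setIntegral_prod _ (integrable_fderiv_comp_hyperplaneCoords hn x₀ hψ hc a).integrableOn]
  simp only [Measure.restrict_univ, integral_fderiv_hyperplaneCoords_tangential x₀ hψ hc ha,
    integral_zero]

theorem integral_halfspace_fderiv (hn : ‖n‖ = 1) (x₀ : E d) (hψ : ContDiff ℝ 1 ψ)
    (hc : HasCompactSupport ψ) (a : E d) :
    ∫ x in {x | ⟪n, x - x₀⟫ < 0}, fderiv ℝ ψ x a =
      ⟪n, a⟫ * ∫ x, ψ x ∂(surf {x | ⟪n, x - x₀⟫ = 0}) := by
  have horth : ⟪n, a - ⟪n, a⟫ • n⟫ = 0 := by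
    rw [inner_sub_right, inner_smul_right, real_inner_self_eq_norm_sq, hn]
    ring
  have hi (b : E d) : IntegrableOn (fun x => fderiv ℝ ψ x b) {x | ⟪n, x - x₀⟫ < 0} :=
    (integrable_fderiv_apply hψ hc b).integrableOn
  have htan := integral_halfspace_fderiv_tangential hn x₀ hψ hc horth
  simp only [map_sub, map_smul, smul_eq_mul] at htan
  rwa [integral_sub (hi a) ((hi n).const_mul _), integral_const_mul, sub_eq_zero,
    integral_halfspace_fderiv_normal hn x₀ hψ hc] at htan

end HalfSpace

/-! ### Local structure and measures of faces -/

section LocalStructure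

variable {V : Type*} [NormedAddCommGroup V] [InnerProductSpace ℝ V]

theorem frontier_inter_ball_subset {K : Set V} {n x : V} {r : ℝ}
    (h : K ∩ Metric.ball x r = {y | ⟪n, y - x⟫ < 0} ∩ Metric.ball x r) :
    frontier K ∩ Metric.ball x r ⊆ {y | ⟪n, y - x⟫ = 0} := by
  rintro y ⟨hy, hyr⟩
  have hc : Continuous fun y : V => ⟪n, y - x⟫ := by fun_prop
  rcases lt_trichotomy ⟪n, y - x⟫ 0 with hlt | heq | hgt
  · have hopen : IsOpen ({y | ⟪n, y - x⟫ < 0} ∩ Metric.ball x r) :=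
      (isOpen_lt hc continuous_const).inter Metric.isOpen_ball
    exact absurd (interior_maximal (h ▸ Set.inter_subset_left) hopen ⟨hlt, hyr⟩) hy.2
  · exact heq
  · have hopen : IsOpen ({y | 0 < ⟪n, y - x⟫} ∩ Metric.ball x r) :=
      (isOpen_lt continuous_const hc).inter Metric.isOpen_ball
    obtain ⟨z, ⟨hz, hzr⟩, hzK⟩ := mem_closure_iff.1 hy.1 _ hopen ⟨hgt, hyr⟩
    have hz' : z ∈ {y | ⟪n, y - x⟫ < 0} ∩ Metric.ball x r := h ▸ ⟨hzK, hzr⟩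
    exact (lt_asymm (a := ⟪n, z - x⟫) hz'.1 hz).elim

theorem eq_inner_smul_of_hyperplane_inter_ball_subset {m n x : V} {r : ℝ} (hm : ‖m‖ = 1)
    (hr : 0 < r)
    (h : {y | ⟪m, y - x⟫ = 0} ∩ Metric.ball x r ⊆ {y | ⟪n, y - x⟫ = 0}) :
    n = ⟪m, n⟫ • m := by
  set v : V := n - ⟪m, n⟫ • m with hv
  have hmv : ⟪m, v⟫ = 0 := by
    rw [hv, inner_sub_right, inner_smul_right, real_inner_self_eq_norm_sq, hm]
    ring
  have hnv : ⟪n, v⟫ = 0 := by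
    obtain ⟨t, ht, htv⟩ : ∃ t : ℝ, 0 < t ∧ ‖t • v‖ < r := by
      refine ⟨r / (2 * (‖v‖ + 1)), by positivity, ?_⟩
      rw [norm_smul, Real.norm_of_nonneg (by positivity), div_mul_eq_mul_div,
        div_lt_iff₀ (by positivity)]
      nlinarith [norm_nonneg v]
    have h0 : ⟪n, x + t • v - x⟫ = 0 :=
      h ⟨by simp [inner_smul_right, hmv], by simpa [Metric.mem_ball] using htv⟩
    rw [add_sub_cancel_left, inner_smul_right] at h0
    exact (mul_eq_zero.1 h0).resolve_left ht.ne'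
  have hvv : ⟪v, v⟫ = 0 := by
    nth_rewrite 1 [hv]
    rw [inner_sub_left, hnv, inner_smul_left, hmv, mul_zero, sub_zero]
  exact sub_eq_zero.1 (inner_self_eq_zero.1 hvv)

theorem IsFlatFace.exists_ball {K F : Set (E d)} {n x : E d} (hF : IsFlatFace F)
    (hFK : F ⊆ frontier K) (hn : IsOutwardNormal K F n) (hx : x ∈ F) :
    ∃ r > 0, K ∩ Metric.ball x r = {y | ⟪n, y - x⟫ < 0} ∩ Metric.ball x r ∧
      frontier K ∩ Metric.ball x r ⊆ {y | ⟪n, y - x⟫ = 0} ∧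
      {y | ⟪n, y - x⟫ = 0} ∩ Metric.ball x r ⊆ F := by
  obtain ⟨m, b, U, hm, hU, rfl⟩ := hF.flat
  obtain ⟨r₀, hr₀, h₀⟩ := hn.2 x hx
  obtain ⟨r₁, hr₁, h₁⟩ := Metric.isOpen_iff.1 hU x hx.1
  have hr : 0 < min r₀ r₁ := lt_min hr₀ hr₁
  have hb : Metric.ball x (min r₀ r₁) ⊆ Metric.ball x r₀ :=
    Metric.ball_subset_ball (min_le_left _ _)
  have hhalf : K ∩ Metric.ball x (min r₀ r₁) =
      {y | ⟪n, y - x⟫ < 0} ∩ Metric.ball x (min r₀ r₁) := by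
    rw [← Set.inter_eq_self_of_subset_right hb, ← Set.inter_assoc, h₀, Set.inter_assoc]
  have hplane {y : E d} (hy : ⟪m, y - x⟫ = 0) (hyr : y ∈ Metric.ball x (min r₀ r₁)) :
      y ∈ U ∩ {x | ⟪m, x⟫ = b} := by
    refine ⟨h₁ (Metric.ball_subset_ball (min_le_right _ _) hyr), ?_⟩
    rwa [inner_sub_right, sub_eq_zero, hx.2] at hy
  have hnm : n = ⟪m, n⟫ • m := eq_inner_smul_of_hyperplane_inter_ball_subset hm hr
    fun y hy => frontier_inter_ball_subset hhalf ⟨hFK (hplane hy.1 hy.2), hy.2⟩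
  have hmn : ⟪m, n⟫ ≠ 0 := fun h0 => by
    simpa [hn.1, h0] using congrArg norm hnm
  refine ⟨_, hr, hhalf, frontier_inter_ball_subset hhalf, fun y hy => hplane ?_ hy.2⟩
  have hny : ⟪⟪m, n⟫ • m, y - x⟫ = 0 := hnm ▸ hy.1
  rw [inner_smul_left] at hny
  exact (mul_eq_zero.1 hny).resolve_left (by simpa using hmn)

end LocalStructure

theorem memLp_of_continuous_of_isBounded {X V : Type*} [PseudoMetricSpace X] [ProperSpace X]
    [MeasurableSpace X] [BorelSpace X] [NormedAddCommGroup V] {μ : Measure X} [IsFiniteMeasure μ]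
    {B : Set X} (hB : Bornology.IsBounded B) (hμ : ∀ᵐ x ∂μ, x ∈ B) {g : X → V}
    (hg : Continuous g) (p : ENNReal) : MemLp g p μ := by
  obtain ⟨C, hC⟩ := (hB.isCompact_closure.image hg).isBounded.exists_norm_le
  refine MemLp.of_bound hg.aestronglyMeasurable C ?_
  filter_upwards [hμ] with x hx
  exact hC _ ⟨x, subset_closure hx, rfl⟩

theorem surf_eq_restrict {F H : Set (E d)} (h : F ⊆ H) : surf F = (surf H).restrict F := by
  rw [surf, surf, Measure.restrict_restrict_of_subset h]

theorem surf_hyperplane_lt_top {n : E d} (hn : ‖n‖ = 1) (x₀ : E d) {B : Set (E d)}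
    (hB : Bornology.IsBounded B) : surf {x : E d | ⟪n, x - x₀⟫ = 0} B < ⊤ := by
  obtain ⟨R, hR⟩ := hB.subset_closedBall x₀
  have hball : (fun y : (ℝ ∙ n)ᗮ => x₀ + (y : E d)) ⁻¹' Metric.closedBall x₀ R =
      Metric.closedBall 0 R := by
    ext y
    simp
  refine (measure_mono hR).trans_lt ?_
  rw [surf_hyperplane hn, Measure.map_apply (by fun_prop)
    Metric.isClosed_closedBall.measurableSet, hball]
  exact measure_closedBall_lt_top

theorem volume_hyperplane {n : E d} (hn : ‖n‖ = 1) (x₀ : E d) :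
    volume {x : E d | ⟪n, x - x₀⟫ = 0} = 0 := by
  have hpre : hyperplaneCoords n x₀ ⁻¹' {x : E d | ⟪n, x - x₀⟫ = 0} = {0} ×ˢ Set.univ := by
    ext p
    simp [inner_hyperplaneCoords_sub hn]
  rw [← (measurePreserving_hyperplaneCoords hn x₀).measure_preimage
    (isClosed_hyperplane n x₀).measurableSet.nullMeasurableSet, hpre, Measure.prod_prod,
    Real.volume_singleton, zero_mul]

namespace IsFlatFace

variable {F : Set (E d)}

theorem measurableSet (hF : IsFlatFace F) : MeasurableSet F := by
  obtain ⟨n, b, U, -, hU, rfl⟩ := hF.flat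
  exact hU.measurableSet.inter
    (isClosed_eq (by fun_prop : Continuous fun x : E d => ⟪n, x⟫) continuous_const).measurableSet

theorem exists_hyperplane (hF : IsFlatFace F) :
    ∃ n x₀ : E d, ‖n‖ = 1 ∧ F ⊆ {x | ⟪n, x - x₀⟫ = 0} := by
  obtain ⟨n, b, U, hn, -, rfl⟩ := hF.flat
  refine ⟨n, b • n, hn, fun x hx => ?_⟩
  have hxb : ⟪n, x⟫ = b := hx.2
  simp [inner_sub_right, inner_smul_right, hxb, hn]

theorem isFiniteMeasure_surf (hF : IsFlatFace F) (hb : Bornology.IsBounded F) :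
    IsFiniteMeasure (surf F) := by
  obtain ⟨n, x₀, hn, h⟩ := hF.exists_hyperplane
  rw [surf_eq_restrict h, isFiniteMeasure_restrict]
  exact (surf_hyperplane_lt_top hn x₀ hb).ne

end IsFlatFace

/-- The complement of the closures of the members of `Fs` other than `F`. -/
def awayFrom (Fs : Finset (Set (E d))) (F : Set (E d)) : Set (E d) :=
  ⋂ F' ∈ Fs, ⋂ _ : F' ≠ F, (closure F')ᶜ

section AwayFrom

variable {Fs : Finset (Set (E d))} {F : Set (E d)}

theorem mem_awayFrom {x : E d} : x ∈ awayFrom Fs F ↔ ∀ F' ∈ Fs, F' ≠ F → x ∉ closure F' := by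
  simp only [awayFrom, Set.mem_iInter, Set.mem_compl_iff]

theorem isOpen_awayFrom : IsOpen (awayFrom Fs F) :=
  isOpen_biInter_finset fun _ _ => isOpen_iInter_of_finite fun _ => isClosed_closure.isOpen_compl

theorem disjoint_awayFrom {F' : Set (E d)} (hF' : F' ∈ Fs) (hne : F' ≠ F) :
    Disjoint F' (awayFrom Fs F) :=
  Set.disjoint_left.2 fun _ hx h => mem_awayFrom.1 h F' hF' hne (subset_closure hx)

end AwayFrom

namespace IsPolytope

variable {K : Set (E d)} {Fs : Finset (Set (E d))} {F : Set (E d)}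

theorem face_subset (hK : IsPolytope K Fs) (hF : F ∈ Fs) : F ⊆ frontier K := by
  rw [hK.frontier_eq]
  exact subset_closure.trans (Set.subset_biUnion_of_mem (u := fun F => closure F) hF)

theorem disjoint_closure (hK : IsPolytope K Fs) (hd : (Fs : Set (Set (E d))).PairwiseDisjoint id)
    {F' : Set (E d)} (hF : F ∈ Fs) (hF' : F' ∈ Fs) (hne : F ≠ F') : Disjoint F (closure F') := by
  refine Set.disjoint_left.2 fun x hx hx' => ?_
  obtain ⟨n, hn⟩ := hK.normal F hF
  obtain ⟨r, hr, -, hfr, hball⟩ := (hK.face F hF).exists_ball (hK.face_subset hF) hn hx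
  obtain ⟨y, hyr, hyF'⟩ := mem_closure_iff.1 hx' _ Metric.isOpen_ball (Metric.mem_ball_self hr)
  have hyF : y ∈ F := hball ⟨hfr ⟨hK.face_subset hF' hyF', hyr⟩, hyr⟩
  exact Set.disjoint_left.1 (hd hF hF' hne) hyF hyF'

theorem subset_awayFrom (hK : IsPolytope K Fs) (hd : (Fs : Set (Set (E d))).PairwiseDisjoint id)
    (hF : F ∈ Fs) : F ⊆ awayFrom Fs F := fun _ hx =>
  mem_awayFrom.2 fun _ hF' hne => Set.disjoint_left.1 (hK.disjoint_closure hd hF hF' hne.symm) hx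

theorem volume_frontier (hK : IsPolytope K Fs) : volume (frontier K) = 0 := by
  rw [hK.frontier_eq]
  refine (measure_biUnion_null_iff Fs.countable_toSet).2 fun F hF => ?_
  obtain ⟨n, x₀, hn, h⟩ := (hK.face F hF).exists_hyperplane
  exact measure_mono_null (closure_minimal h (isClosed_hyperplane n x₀)) (volume_hyperplane hn x₀)

theorem isBounded_face (hK : IsPolytope K Fs) (hF : F ∈ Fs) : Bornology.IsBounded F :=
  hK.bounded.closure.subset ((hK.face_subset hF).trans frontier_subset_closure)

theorem isFiniteMeasure_surf (hK : IsPolytope K Fs) (hF : F ∈ Fs) : IsFiniteMeasure (surf F) :=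
  (hK.face F hF).isFiniteMeasure_surf (hK.isBounded_face hF)

theorem isFiniteMeasure_restrict (hK : IsPolytope K Fs) : IsFiniteMeasure (volume.restrict K) :=
  MeasureTheory.isFiniteMeasure_restrict.2 hK.bounded.measure_lt_top.ne

theorem ae_surf_mem (hK : IsPolytope K Fs) (hF : F ∈ Fs) : ∀ᵐ x ∂(surf F), x ∈ F :=
  ae_restrict_mem (hK.face F hF).measurableSet

theorem memLp_surf {V : Type*} [NormedAddCommGroup V] (hK : IsPolytope K Fs) (hF : F ∈ Fs)
    {g : E d → V} (hg : Continuous g) (p : ENNReal) : MemLp g p (surf F) :=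
  haveI := hK.isFiniteMeasure_surf hF
  memLp_of_continuous_of_isBounded (hK.isBounded_face hF) (hK.ae_surf_mem hF) hg p

theorem memLp_volume {V : Type*} [NormedAddCommGroup V] (hK : IsPolytope K Fs) {g : E d → V}
    (hg : Continuous g) (p : ENNReal) : MemLp g p (volume.restrict K) :=
  haveI := hK.isFiniteMeasure_restrict
  memLp_of_continuous_of_isBounded hK.bounded (ae_restrict_mem hK.isOpen.measurableSet) hg p

theorem integrable_surf (hK : IsPolytope K Fs) (hF : F ∈ Fs) {g : E d → ℝ} (hg : Continuous g) :
    Integrable g (surf F) :=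
  memLp_one_iff_integrable.1 (hK.memLp_surf hF hg 1)

theorem integrable_volume (hK : IsPolytope K Fs) {g : E d → ℝ} (hg : Continuous g) :
    Integrable g (volume.restrict K) :=
  memLp_one_iff_integrable.1 (hK.memLp_volume hg 1)

end IsPolytope

/-! ### Green's formula away from the skeleton of codimension two -/

/-- The outward unit normal of `K` along `F`. -/
noncomputable def faceNormal (K F : Set (E d)) : E d := Classical.epsilon (IsOutwardNormal K F)

/-- The difference of the two sides of Green's formula on `K` for the vector field `ψ a`. -/
noncomputable def greenDefect (K : Set (E d)) (Fs : Finset (Set (E d))) (a : E d)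
    (ψ : E d → ℝ) : ℝ :=
  (∫ x in K, fderiv ℝ ψ x a) - ∑ F ∈ Fs, ⟪faceNormal K F, a⟫ * ∫ x, ψ x ∂(surf F)

theorem setIntegral_eq_of_inter_eq {X V : Type*} [MeasurableSpace X] [NormedAddCommGroup V]
    [NormedSpace ℝ V] {μ : Measure X} {s t B : Set X} {f : X → V} (hs : MeasurableSet s)
    (ht : MeasurableSet t) (h : s ∩ B = t ∩ B) (hf : ∀ x ∉ B, f x = 0) :
    ∫ x in s, f x ∂μ = ∫ x in t, f x ∂μ := by
  have hinter {u : Set X} (hu : MeasurableSet u) : ∫ x in u, f x ∂μ = ∫ x in u ∩ B, f x ∂μ :=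
    setIntegral_eq_of_subset_of_forall_sdiff_eq_zero hu Set.inter_subset_left
      fun x hx => hf x fun hB => hx.2 ⟨hx.1, hB⟩
  rw [hinter hs, hinter ht, h]

theorem integral_surf_eq_zero {F : Set (E d)} {ψ : E d → ℝ} (h : Disjoint F (tsupport ψ)) :
    ∫ x, ψ x ∂(surf F) = 0 :=
  setIntegral_eq_zero_of_forall_eq_zero fun _ hx =>
    image_eq_zero_of_notMem_tsupport (Set.disjoint_left.1 h hx)

theorem greenDefect_eq_integral {K : Set (E d)} {Fs : Finset (Set (E d))} (a : E d) {ψ : E d → ℝ}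
    (h : ∀ F ∈ Fs, Disjoint F (tsupport ψ)) : greenDefect K Fs a ψ = ∫ x in K, fderiv ℝ ψ x a := by
  rw [greenDefect, Finset.sum_eq_zero fun F hF => ?_, sub_zero]
  rw [integral_surf_eq_zero (h F hF), mul_zero]

namespace IsPolytope

variable {K : Set (E d)} {Fs : Finset (Set (E d))} {ψ : E d → ℝ}

theorem isOutwardNormal_faceNormal (hK : IsPolytope K Fs) {F : Set (E d)} (hF : F ∈ Fs) :
    IsOutwardNormal K F (faceNormal K F) :=
  Classical.epsilon_spec (hK.normal F hF)

theorem greenDefect_add (hK : IsPolytope K Fs) (a : E d) {η : E d → ℝ} (hψ : ContDiff ℝ 1 ψ)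
    (hη : ContDiff ℝ 1 η) :
    greenDefect K Fs a (ψ + η) = greenDefect K Fs a ψ + greenDefect K Fs a η := by
  have hI {φ : E d → ℝ} (hφ : ContDiff ℝ 1 φ) :
      Integrable (fun x => fderiv ℝ φ x a) (volume.restrict K) :=
    hK.integrable_volume ((hφ.continuous_fderiv one_ne_zero).clm_apply continuous_const)
  have hvol : ∫ x in K, fderiv ℝ (ψ + η) x a =
      (∫ x in K, fderiv ℝ ψ x a) + ∫ x in K, fderiv ℝ η x a := by
    rw [← integral_add (hI hψ) (hI hη)]
    refine integral_congr_ae (ae_of_all _ fun x => ?_)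
    simp only
    rw [fderiv_add (hψ.differentiable one_ne_zero x) (hη.differentiable one_ne_zero x),
      add_apply]
  have hsurf : ∑ F ∈ Fs, ⟪faceNormal K F, a⟫ * ∫ x, (ψ + η) x ∂(surf F) =
      ∑ F ∈ Fs, ⟪faceNormal K F, a⟫ * (∫ x, ψ x ∂(surf F)) +
      ∑ F ∈ Fs, ⟪faceNormal K F, a⟫ * ∫ x, η x ∂(surf F) := by
    rw [← Finset.sum_add_distrib]
    refine Finset.sum_congr rfl fun F hF => ?_
    rw [← mul_add, ← integral_add (hK.integrable_surf hF hψ.continuous)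
      (hK.integrable_surf hF hη.continuous)]
    rfl
  rw [greenDefect, greenDefect, greenDefect, hvol, hsurf]
  ring

theorem greenDefect_of_tsupport_subset (hK : IsPolytope K Fs) (a : E d) (hψ : ContDiff ℝ 1 ψ)
    (hc : HasCompactSupport ψ) (h : tsupport ψ ⊆ K) : greenDefect K Fs a ψ = 0 := by
  rw [greenDefect_eq_integral, setIntegral_eq_integral_of_forall_compl_eq_zero]
  · exact integral_fderiv_apply_eq_zero hψ hc a
  · intro x hx
    simp [fderiv_of_notMem_tsupport (𝕜 := ℝ) fun hx' => hx (h hx')]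
  · intro F hF
    refine Set.disjoint_left.2 fun x hx hx' => ?_
    exact (hK.isOpen.frontier_eq ▸ hK.face_subset hF hx).2 (h hx')

theorem greenDefect_of_tsupport_subset_compl (hK : IsPolytope K Fs) (a : E d)
    (h : tsupport ψ ⊆ (closure K)ᶜ) : greenDefect K Fs a ψ = 0 := by
  rw [greenDefect_eq_integral]
  · refine setIntegral_eq_zero_of_forall_eq_zero fun x hx => ?_
    simp [fderiv_of_notMem_tsupport (𝕜 := ℝ) fun hx' => h hx' (subset_closure hx)]
  · exact fun F hF => Set.disjoint_left.2 fun x hx hx' =>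
      h hx' (frontier_subset_closure (hK.face_subset hF hx))

theorem exists_greenDefect_eq_zero_of_mem_face (hK : IsPolytope K Fs)
    (hdis : (Fs : Set (Set (E d))).PairwiseDisjoint id) (a : E d) {F : Set (E d)} (hF : F ∈ Fs)
    {x : E d} (hx : x ∈ F) : ∃ r > 0, ∀ ψ : E d → ℝ, ContDiff ℝ 1 ψ → HasCompactSupport ψ →
      tsupport ψ ⊆ Metric.ball x r → greenDefect K Fs a ψ = 0 := by
  have hn := hK.isOutwardNormal_faceNormal hF
  obtain ⟨r, hr, hhalf, hfr, hplane⟩ := (hK.face F hF).exists_ball (hK.face_subset hF) hn hx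
  refine ⟨r, hr, fun ψ hψ hc hs => ?_⟩
  have hother : ∀ F' ∈ Fs, F' ≠ F → ⟪faceNormal K F', a⟫ * ∫ x, ψ x ∂(surf F') = 0 := by
    intro F' hF' hne
    rw [integral_surf_eq_zero (Set.disjoint_left.2 fun y hy hy' => ?_), mul_zero]
    have hyF : y ∈ F := hplane ⟨hfr ⟨hK.face_subset hF' hy, hs hy'⟩, hs hy'⟩
    exact Set.disjoint_left.1 (hdis hF' hF hne) hy hyF
  have hvol : ∫ y in K, fderiv ℝ ψ y a =
      ∫ y in {y | ⟪faceNormal K F, y - x⟫ < 0}, fderiv ℝ ψ y a :=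
    setIntegral_eq_of_inter_eq hK.isOpen.measurableSet
      (isOpen_lt (by fun_prop) continuous_const).measurableSet hhalf
      fun y hy => by simp [fderiv_of_notMem_tsupport (𝕜 := ℝ) fun h => hy (hs h)]
  have hface : F ∩ Metric.ball x r = {y | ⟪faceNormal K F, y - x⟫ = 0} ∩ Metric.ball x r :=
    Set.Subset.antisymm (fun y hy => ⟨hfr ⟨hK.face_subset hF hy.1, hy.2⟩, hy.2⟩)
      fun y hy => ⟨hplane hy, hy.2⟩
  have hsurf : ∫ y, ψ y ∂(surf F) = ∫ y, ψ y ∂(surf {y | ⟪faceNormal K F, y - x⟫ = 0}) :=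
    setIntegral_eq_of_inter_eq (hK.face F hF).measurableSet
      (isClosed_hyperplane _ x).measurableSet hface
      fun y hy => image_eq_zero_of_notMem_tsupport fun h => hy (hs h)
  rw [greenDefect, Finset.sum_eq_single F hother (fun h => absurd hF h), hvol, hsurf,
    integral_halfspace_fderiv hn.1 x hψ hc, sub_self]

end IsPolytope

section Localization

variable {V : Type*} [NormedAddCommGroup V] [NormedSpace ℝ V] [FiniteDimensional ℝ V]
  {k : WithTop ℕ∞} {ψ : V → ℝ}

theorem exists_sum_eq_of_isOpen_cover (hk : k ≤ ∞) (hψ : ContDiff ℝ k ψ)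
    (hc : HasCompactSupport ψ) {U : V → Set V} (hU : ∀ x ∈ tsupport ψ, IsOpen (U x) ∧ x ∈ U x) :
    ∃ (I : Finset (tsupport ψ)) (η : tsupport ψ → V → ℝ), ψ = ∑ i ∈ I, η i ∧
      ∀ i, ContDiff ℝ k (η i) ∧ HasCompactSupport (η i) ∧ tsupport (η i) ⊆ U i := by
  obtain ⟨f, hf⟩ := SmoothPartitionOfUnity.exists_isSubordinate (modelWithCornersSelf ℝ V)
    (isClosed_tsupport ψ) (fun x : tsupport ψ => U x) (fun x => (hU x x.2).1)
    (fun x hx => Set.mem_iUnion.2 ⟨⟨x, hx⟩, (hU x hx).2⟩)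
  have hfin := f.locallyFinite.finite_nonempty_inter_compact hc
  refine ⟨hfin.toFinset, fun i x => f i x * ψ x, ?_, fun i =>
    ⟨((f i).contMDiff.contDiff.of_le hk).mul hψ, hc.mul_left,
      tsupport_mul_subset_left.trans (hf i)⟩⟩
  funext x
  rw [Finset.sum_apply, ← Finset.sum_mul]
  by_cases hx : x ∈ tsupport ψ
  · have hsum := f.sum_eq_one hx
    rw [finsum_eq_sum_of_support_subset (s := hfin.toFinset) _
      fun i hi => hfin.coe_toFinset.symm ▸ ⟨x, hi, hx⟩] at hsum
    rw [hsum, one_mul]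
  · rw [image_eq_zero_of_notMem_tsupport hx, mul_zero]

theorem eq_zero_of_locally_eq_zero (hk : k ≤ ∞) {L : (V → ℝ) → ℝ}
    (hadd : ∀ ψ η : V → ℝ, ContDiff ℝ k ψ → ContDiff ℝ k η → L (ψ + η) = L ψ + L η)
    (hψ : ContDiff ℝ k ψ) (hc : HasCompactSupport ψ)
    (hloc : ∀ x ∈ tsupport ψ, ∃ U : Set V, (IsOpen U ∧ x ∈ U) ∧ ∀ η : V → ℝ,
      ContDiff ℝ k η → HasCompactSupport η → tsupport η ⊆ U → L η = 0) :
    L ψ = 0 := by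
  choose! U hU hL using hloc
  obtain ⟨I, η, hsum, hη⟩ := exists_sum_eq_of_isOpen_cover hk hψ hc hU
  have hzero : L 0 = 0 := by
    have := hadd 0 0 contDiff_const contDiff_const
    rw [add_zero] at this
    linarith
  have hpartial (J : Finset (tsupport ψ)) :
      ContDiff ℝ k (∑ i ∈ J, η i) ∧ L (∑ i ∈ J, η i) = 0 := by
    classical
    induction J using Finset.induction_on with
    | empty => exact ⟨contDiff_const, hzero⟩
    | insert i J hi ih =>
      obtain ⟨hηk, hηc, hηU⟩ := hη i
      rw [Finset.sum_insert hi]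
      refine ⟨hηk.add ih.1, ?_⟩
      rw [hadd _ _ hηk ih.1, ih.2, hL i i.2 _ hηk hηc hηU, add_zero]
  rw [hsum]
  exact (hpartial I).2

end Localization

/-! ### Removability of sets of codimension two -/

theorem surf_affineSubspace_eq_zero {A : AffineSubspace ℝ (E d)}
    (hA : Module.finrank ℝ A.direction + 2 ≤ d) (F : Set (E d)) : surf F (A : Set (E d)) = 0 := by
  refine Measure.restrict_le_self.absolutelyContinuous ?_
  suffices h : μH[((d - 1 : ℕ) : ℝ)] (A : Set (E d)) = 0 by
    rw [Measure.euclideanHausdorffMeasure_def, Measure.smul_apply, h, smul_zero]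
  rcases (A : Set (E d)).eq_empty_or_nonempty with h | ⟨x₀, hx₀⟩
  · rw [h, measure_empty]
  have hiso : Isometry (fun y : A.direction => (y : E d) + x₀) :=
    (isometry_add_right x₀).comp isometry_subtype_coe
  have himg : (A : Set (E d)) = (fun y : A.direction => (y : E d) + x₀) '' Set.univ := by
    ext x
    rw [Set.image_univ, Set.mem_range]
    refine ⟨fun hx => ⟨⟨x - x₀, AffineSubspace.vsub_mem_direction hx hx₀⟩, by simp⟩, ?_⟩
    rintro ⟨y, rfl⟩
    exact AffineSubspace.vadd_mem_of_mem_direction y.2 hx₀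
  have hdim : dimH (A : Set (E d)) < ((d - 1 : ℕ) : NNReal) := by
    rw [himg, hiso.dimH_image, Real.dimH_univ_eq_finrank]
    exact_mod_cast (by omega : Module.finrank ℝ A.direction < d - 1)
  simpa only [NNReal.coe_natCast] using hausdorffMeasure_of_dimH_lt hdim

/-- The orthogonal projection onto the orthogonal complement of `V`. -/
noncomputable def perp (V : Submodule ℝ (E d)) : E d →L[ℝ] Vᗮ := Vᗮ.orthogonalProjectionOnto

/-- The part in the ball of radius `R` around `x₀` of the closed `ε`-neighbourhood of the affine
subspace `x₀ + V`. -/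
def tube (V : Submodule ℝ (E d)) (x₀ : E d) (ε R : ℝ) : Set (E d) :=
  {x | ‖perp V (x - x₀)‖ ≤ ε} ∩ Metric.closedBall x₀ R

/-- A smooth function on `Vᗮ` that is `1` in the unit ball and `0` outside the ball of
radius `2`. -/
noncomputable def unitBump (V : Submodule ℝ (E d)) : ContDiffBump (0 : Vᗮ) :=
  ⟨1, 2, by norm_num, by norm_num⟩

/-- A smooth function that is `1` in the `1 / (k + 1)`-neighbourhood of the affine subspace
`x₀ + V` and vanishes outside the `2 / (k + 1)`-neighbourhood. -/
noncomputable def tubeCutoff (V : Submodule ℝ (E d)) (x₀ : E d) (k : ℕ) (x : E d) : ℝ :=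
  unitBump V (((k : ℝ) + 1) • perp V (x - x₀))

section Tube

variable {V : Submodule ℝ (E d)} {x₀ : E d}

theorem perp_eq_zero_iff {x : E d} : perp V x = 0 ↔ x ∈ V := by
  rw [perp, Submodule.orthogonalProjectionOnto_eq_zero_iff, Submodule.orthogonal_orthogonal]

theorem perp_direction_sub_eq_zero_iff {A : AffineSubspace ℝ (E d)} (hx₀ : x₀ ∈ A) {x : E d} :
    perp A.direction (x - x₀) = 0 ↔ x ∈ A := by
  rw [perp_eq_zero_iff, ← vsub_eq_sub, A.vsub_right_mem_direction_iff_mem hx₀]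

theorem isClosed_tube (ε R : ℝ) : IsClosed (tube V x₀ ε R) :=
  (isClosed_le (by fun_prop) continuous_const).inter Metric.isClosed_closedBall

theorem volume_tube_le (ε R : ℝ) :
    volume (tube V x₀ ε R) ≤
      volume (Metric.closedBall (0 : V) R) * volume (Metric.closedBall (0 : Vᗮ) ε) := by
  have h := V.measurePreserving_measurableEquivProd x₀
  rw [InnerProductSpace.euclideanHausdorffMeasure_eq_volume] at h
  rw [← Measure.prod_prod]
  refine le_trans (measure_mono ?_) (h.measure_preimage
    (Metric.isClosed_closedBall.measurableSet.prod
      Metric.isClosed_closedBall.measurableSet).nullMeasurableSet).le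
  rintro x ⟨hε, hR⟩
  simp only [Set.mem_preimage, Submodule.measurableEquivProd_apply, Set.mem_prod,
    mem_closedBall_zero_iff, vsub_eq_sub]
  exact ⟨(V.norm_orthogonalProjectionOnto_apply_le _).trans (mem_closedBall_iff_norm.1 hR), hε⟩

theorem exists_volume_real_tube_le (hV : Module.finrank ℝ V + 2 ≤ d) (x₀ : E d) (R δ : ℝ) :
    ∃ C : ℝ, ∀ ε : ℝ, 0 ≤ ε → ε ≤ δ → volume.real (tube V x₀ ε R) ≤ C * ε ^ 2 := by
  obtain ⟨j, hj⟩ : ∃ j, Module.finrank ℝ Vᗮ = j + 2 := by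
    have h := Submodule.finrank_add_finrank_orthogonal V
    rw [finrank_euclideanSpace_fin] at h
    exact ⟨Module.finrank ℝ Vᗮ - 2, by omega⟩
  refine ⟨volume.real (Metric.closedBall (0 : V) R) *
    (δ ^ j * volume.real (Metric.ball (0 : Vᗮ) 1)), fun ε hε hεδ => ?_⟩
  calc volume.real (tube V x₀ ε R)
      ≤ volume.real (Metric.closedBall (0 : V) R) *
          volume.real (Metric.closedBall (0 : Vᗮ) ε) := by
        rw [measureReal_def, measureReal_def, measureReal_def, ← ENNReal.toReal_mul]
        exact ENNReal.toReal_mono (ENNReal.mul_ne_top measure_closedBall_lt_top.ne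
          measure_closedBall_lt_top.ne) (volume_tube_le ε R)
    _ = volume.real (Metric.closedBall (0 : V) R) *
          (ε ^ j * volume.real (Metric.ball (0 : Vᗮ) 1)) * ε ^ 2 := by
        rw [Measure.addHaar_real_closedBall _ _ hε, hj]
        ring
    _ ≤ _ := by gcongr

theorem contDiff_tubeCutoff (k : ℕ) {m : ℕ∞} : ContDiff ℝ m (tubeCutoff V x₀ k) :=
  (unitBump V).contDiff.comp
    (((perp V).contDiff.comp (contDiff_id.sub contDiff_const)).const_smul _)

theorem tubeCutoff_nonneg (k : ℕ) (x : E d) : 0 ≤ tubeCutoff V x₀ k x := (unitBump V).nonneg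

theorem tubeCutoff_le_one (k : ℕ) (x : E d) : tubeCutoff V x₀ k x ≤ 1 := (unitBump V).le_one

theorem tubeCutoff_eq_one {k : ℕ} {x : E d} (h : ((k : ℝ) + 1) * ‖perp V (x - x₀)‖ ≤ 1) :
    tubeCutoff V x₀ k x = 1 := by
  refine ContDiffBump.one_of_mem_closedBall _ ?_
  rwa [mem_closedBall_zero_iff, norm_smul, Real.norm_of_nonneg (by positivity)]

theorem tubeCutoff_eq_zero {k : ℕ} {x : E d} (h : 2 ≤ ((k : ℝ) + 1) * ‖perp V (x - x₀)‖) :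
    tubeCutoff V x₀ k x = 0 := by
  refine ContDiffBump.zero_of_le_dist _ ?_
  rwa [dist_zero_right, norm_smul, Real.norm_of_nonneg (by positivity)]

theorem tsupport_mul_tubeCutoff_subset {ψ : E d → ℝ} {R : ℝ}
    (hψ : tsupport ψ ⊆ Metric.closedBall x₀ R) (k : ℕ) :
    tsupport (ψ * tubeCutoff V x₀ k) ⊆ tube V x₀ (2 / (k + 1)) R := by
  refine closure_minimal (fun x hx => ?_) (isClosed_tube _ R)
  have hx' : ψ x * tubeCutoff V x₀ k x ≠ 0 := hx
  refine ⟨?_, hψ (subset_tsupport ψ (left_ne_zero_of_mul hx'))⟩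
  by_contra hlt
  rw [Set.mem_ofPred_eq, not_le, div_lt_iff₀ (by positivity), mul_comm] at hlt
  exact right_ne_zero_of_mul hx' (tubeCutoff_eq_zero hlt.le)

theorem disjoint_tsupport_one_sub_tubeCutoff {A : AffineSubspace ℝ (E d)} (hx₀ : x₀ ∈ A) (k : ℕ) :
    Disjoint (tsupport (1 - tubeCutoff A.direction x₀ k)) A := by
  have hsub : tsupport (1 - tubeCutoff A.direction x₀ k) ⊆
      {x | 1 ≤ ((k : ℝ) + 1) * ‖perp A.direction (x - x₀)‖} := by
    refine closure_minimal (fun x hx => ?_) (isClosed_le continuous_const (by fun_prop))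
    by_contra hlt
    rw [Set.mem_ofPred_eq, not_le] at hlt
    exact hx (by simp [tubeCutoff_eq_one hlt.le])
  refine Set.disjoint_left.2 fun x hx hxA => ?_
  have h : (1 : ℝ) ≤ ((k : ℝ) + 1) * ‖perp A.direction (x - x₀)‖ := hsub hx
  rw [(perp_direction_sub_eq_zero_iff hx₀).2 hxA, norm_zero, mul_zero] at h
  linarith

theorem fderiv_tubeCutoff_apply (k : ℕ) (x a : E d) :
    fderiv ℝ (tubeCutoff V x₀ k) x a = ((k : ℝ) + 1) *
      fderiv ℝ (unitBump V) (((k : ℝ) + 1) • perp V (x - x₀)) (perp V a) := by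
  have hinner : HasFDerivAt (fun x : E d => ((k : ℝ) + 1) • perp V (x - x₀))
      (((k : ℝ) + 1) • perp V) x := by
    simp only [map_sub]
    exact ((perp V).hasFDerivAt.sub_const _).const_smul ((k : ℝ) + 1)
  have hbump : ContDiff ℝ 1 (unitBump V) := (unitBump V).contDiff
  have hcomp : fderiv ℝ (tubeCutoff V x₀ k) x = _ :=
    ((hbump.differentiable one_ne_zero _).hasFDerivAt.comp x hinner).fderiv
  rw [hcomp]
  simp

theorem exists_abs_fderiv_tubeCutoff_le (V : Submodule ℝ (E d)) (x₀ a : E d) :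
    ∃ C : ℝ, ∀ k x, |fderiv ℝ (tubeCutoff V x₀ k) x a| ≤ C * ((k : ℝ) + 1) := by
  have hbump : ContDiff ℝ 1 (unitBump V) := (unitBump V).contDiff
  obtain ⟨C, hC⟩ := ((unitBump V).hasCompactSupport.fderiv_apply ℝ
    (perp V a)).exists_bound_of_continuous
      ((hbump.continuous_fderiv one_ne_zero).clm_apply continuous_const)
  refine ⟨C, fun k x => ?_⟩
  rw [fderiv_tubeCutoff_apply, abs_mul, abs_of_nonneg (by positivity : (0 : ℝ) ≤ (k : ℝ) + 1),
    mul_comm]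
  exact mul_le_mul_of_nonneg_right (hC _) (by positivity)

theorem exists_abs_fderiv_mul_tubeCutoff_le (V : Submodule ℝ (E d)) (x₀ a : E d) {ψ : E d → ℝ}
    (hψ : ContDiff ℝ 1 ψ) (hc : HasCompactSupport ψ) :
    ∃ C : ℝ, 0 ≤ C ∧ ∀ k x, |fderiv ℝ (ψ * tubeCutoff V x₀ k) x a| ≤ C * ((k : ℝ) + 1) := by
  obtain ⟨C₀, h₀⟩ := hc.exists_bound_of_continuous hψ.continuous
  obtain ⟨C₁, h₁⟩ := (hc.fderiv_apply ℝ a).exists_bound_of_continuous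
    ((hψ.continuous_fderiv one_ne_zero).clm_apply continuous_const)
  obtain ⟨C₂, h₂⟩ := exists_abs_fderiv_tubeCutoff_le V x₀ a
  have hC₀ : 0 ≤ C₀ := (norm_nonneg _).trans (h₀ 0)
  have hC₁ : 0 ≤ C₁ := (norm_nonneg _).trans (h₁ 0)
  have hC₂ : 0 ≤ C₂ := by simpa using (abs_nonneg _).trans (h₂ 0 0)
  refine ⟨C₀ * C₂ + C₁, by positivity, fun k x => ?_⟩
  have hcut : ContDiff ℝ 1 (tubeCutoff V x₀ k) := contDiff_tubeCutoff k
  rw [fderiv_mul (hψ.differentiable one_ne_zero x) (hcut.differentiable one_ne_zero x)]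
  simp only [add_apply, smul_apply, smul_eq_mul]
  calc |ψ x * fderiv ℝ (tubeCutoff V x₀ k) x a + tubeCutoff V x₀ k x * fderiv ℝ ψ x a|
      ≤ |ψ x| * |fderiv ℝ (tubeCutoff V x₀ k) x a| +
          tubeCutoff V x₀ k x * |fderiv ℝ ψ x a| := by
        refine (abs_add_le _ _).trans_eq ?_
        rw [abs_mul, abs_mul, abs_of_nonneg (tubeCutoff_nonneg k x)]
    _ ≤ C₀ * (C₂ * (k + 1)) + 1 * C₁ := by
        gcongr
        exacts [h₀ x, h₂ k x, tubeCutoff_le_one k x, h₁ x]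
    _ ≤ (C₀ * C₂ + C₁) * (k + 1) := by
        have : 0 ≤ C₁ * k := by positivity
        linarith

-- The derivative of the cutoff is of order `k`, the volume of the tube of order `1 / k²`.
theorem tendsto_integral_fderiv_mul_tubeCutoff (hV : Module.finrank ℝ V + 2 ≤ d) (x₀ a : E d)
    {K : Set (E d)} (hK : MeasurableSet K) {ψ : E d → ℝ} (hψ : ContDiff ℝ 1 ψ)
    (hc : HasCompactSupport ψ) :
    Tendsto (fun k => ∫ x in K, fderiv ℝ (ψ * tubeCutoff V x₀ k) x a) atTop (𝓝 0) := by
  obtain ⟨R, hR⟩ := hc.isCompact.isBounded.subset_closedBall x₀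
  obtain ⟨C, hC, hder⟩ := exists_abs_fderiv_mul_tubeCutoff_le V x₀ a hψ hc
  obtain ⟨C', hvol⟩ := exists_volume_real_tube_le hV x₀ R 2
  have hbound (k : ℕ) : ‖∫ x in K, fderiv ℝ (ψ * tubeCutoff V x₀ k) x a‖ ≤
      C * C' * 4 * (1 / ((k : ℝ) + 1)) := by
    have htube : volume (tube V x₀ (2 / (k + 1)) R) < ⊤ :=
      (measure_mono Set.inter_subset_right).trans_lt measure_closedBall_lt_top
    have hε : 2 / ((k : ℝ) + 1) ≤ 2 := div_le_self (by norm_num) (by simp)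
    calc ‖∫ x in K, fderiv ℝ (ψ * tubeCutoff V x₀ k) x a‖
        = ‖∫ x in K ∩ tube V x₀ (2 / (k + 1)) R, fderiv ℝ (ψ * tubeCutoff V x₀ k) x a‖ := by
          rw [setIntegral_eq_of_subset_of_forall_sdiff_eq_zero hK Set.inter_subset_left]
          intro x hx
          simp [fderiv_of_notMem_tsupport (𝕜 := ℝ) fun h =>
            hx.2 ⟨hx.1, tsupport_mul_tubeCutoff_subset hR k h⟩]
      _ ≤ C * (k + 1) * volume.real (K ∩ tube V x₀ (2 / (k + 1)) R) :=
          norm_setIntegral_le_of_norm_le_const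
            ((measure_mono Set.inter_subset_right).trans_lt htube) fun x _ => hder k x
      _ ≤ C * (k + 1) * (C' * (2 / (k + 1)) ^ 2) := by
          gcongr
          exact (measureReal_mono Set.inter_subset_right htube.ne).trans
            (hvol _ (by positivity) hε)
      _ = C * C' * 4 * (1 / ((k : ℝ) + 1)) := by
          field_simp
          ring
  refine squeeze_zero_norm hbound ?_
  simpa using (tendsto_one_div_add_atTop_nhds_zero_nat (𝕜 := ℝ)).const_mul (C * C' * 4)

theorem tendsto_tubeCutoff_of_notMem {A : AffineSubspace ℝ (E d)} (hx₀ : x₀ ∈ A) {x : E d}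
    (hx : x ∉ A) : Tendsto (fun k => tubeCutoff A.direction x₀ k x) atTop (𝓝 0) := by
  have hpos : 0 < ‖perp A.direction (x - x₀)‖ :=
    norm_pos_iff.2 (mt (perp_direction_sub_eq_zero_iff hx₀).1 hx)
  obtain ⟨N, hN⟩ := exists_nat_gt (2 / ‖perp A.direction (x - x₀)‖)
  rw [div_lt_iff₀ hpos] at hN
  refine tendsto_const_nhds.congr' ?_
  filter_upwards [eventually_ge_atTop N] with k hk
  have hNk : (N : ℝ) ≤ (k : ℝ) + 1 := by exact_mod_cast hk.trans (Nat.le_succ k)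
  exact (tubeCutoff_eq_zero (hN.le.trans (mul_le_mul_of_nonneg_right hNk hpos.le))).symm

theorem tendsto_integral_surf_mul_tubeCutoff {A : AffineSubspace ℝ (E d)}
    (hA : Module.finrank ℝ A.direction + 2 ≤ d) (hx₀ : x₀ ∈ A) {F : Set (E d)} {ψ : E d → ℝ}
    (hψ : Integrable ψ (surf F)) :
    Tendsto (fun k => ∫ x, (ψ * tubeCutoff A.direction x₀ k) x ∂(surf F)) atTop (𝓝 0) := by
  rw [← integral_zero (E d) ℝ (μ := surf F)]
  have hcut (k : ℕ) : ContDiff ℝ 1 (tubeCutoff A.direction x₀ k) := contDiff_tubeCutoff k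
  refine tendsto_integral_of_dominated_convergence (fun x => ‖ψ x‖) (fun k =>
    hψ.1.mul (hcut k).continuous.aestronglyMeasurable) hψ.norm (fun k => ae_of_all _ fun x => ?_) ?_
  · rw [Pi.mul_apply, norm_mul, Real.norm_of_nonneg (tubeCutoff_nonneg k x)]
    exact mul_le_of_le_one_right (norm_nonneg _) (tubeCutoff_le_one k x)
  · filter_upwards [measure_eq_zero_iff_ae_notMem.1 (surf_affineSubspace_eq_zero hA F)] with x hx
    simpa using (tendsto_tubeCutoff_of_notMem hx₀ hx).const_mul (ψ x)

end Tube

namespace IsPolytope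

variable {K : Set (E d)} {Fs : Finset (Set (E d))} {ψ : E d → ℝ}

theorem tendsto_greenDefect_mul_tubeCutoff (hK : IsPolytope K Fs) (a : E d)
    {A : AffineSubspace ℝ (E d)} (hA : Module.finrank ℝ A.direction + 2 ≤ d) {x₀ : E d}
    (hx₀ : x₀ ∈ A) (hψ : ContDiff ℝ 1 ψ) (hc : HasCompactSupport ψ) :
    Tendsto (fun k => greenDefect K Fs a (ψ * tubeCutoff A.direction x₀ k)) atTop (𝓝 0) := by
  have hsurf : Tendsto (fun k => ∑ F ∈ Fs, ⟪faceNormal K F, a⟫ *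
      ∫ x, (ψ * tubeCutoff A.direction x₀ k) x ∂(surf F)) atTop
      (𝓝 (∑ F ∈ Fs, ⟪faceNormal K F, a⟫ * 0)) :=
    tendsto_finsetSum _ fun F hF => (tendsto_integral_surf_mul_tubeCutoff hA hx₀
      (hK.integrable_surf hF hψ.continuous)).const_mul _
  simpa [greenDefect] using
    (tendsto_integral_fderiv_mul_tubeCutoff hA x₀ a hK.isOpen.measurableSet hψ hc).sub hsurf

theorem greenDefect_eq_zero_of_mul_one_sub_tubeCutoff (hK : IsPolytope K Fs) (a : E d)
    {A : AffineSubspace ℝ (E d)} (hA : Module.finrank ℝ A.direction + 2 ≤ d) {x₀ : E d}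
    (hx₀ : x₀ ∈ A) (hψ : ContDiff ℝ 1 ψ) (hc : HasCompactSupport ψ)
    (h : ∀ k, greenDefect K Fs a (ψ * (1 - tubeCutoff A.direction x₀ k)) = 0) :
    greenDefect K Fs a ψ = 0 := by
  have hcut (k : ℕ) : ContDiff ℝ 1 (tubeCutoff A.direction x₀ k) := contDiff_tubeCutoff k
  have hsplit (k : ℕ) :
      greenDefect K Fs a (ψ * tubeCutoff A.direction x₀ k) = greenDefect K Fs a ψ := by
    have hadd := hK.greenDefect_add a (ψ := ψ * (1 - tubeCutoff A.direction x₀ k))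
      (η := ψ * tubeCutoff A.direction x₀ k) (hψ.mul (contDiff_const.sub (hcut k)))
      (hψ.mul (hcut k))
    rw [← mul_add, sub_add_cancel, mul_one, h k, zero_add] at hadd
    exact hadd.symm
  have htend := hK.tendsto_greenDefect_mul_tubeCutoff a hA hx₀ hψ hc
  simp only [hsplit] at htend
  exact tendsto_nhds_unique tendsto_const_nhds htend

theorem greenDefect_eq_zero_of_disjoint_affineSubspaces (hK : IsPolytope K Fs) (a : E d)
    {L : Finset (AffineSubspace ℝ (E d))} (hL : ∀ A ∈ L, Module.finrank ℝ A.direction + 2 ≤ d)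
    (h : ∀ ψ : E d → ℝ, ContDiff ℝ 1 ψ → HasCompactSupport ψ →
      (∀ A ∈ L, Disjoint (tsupport ψ) (A : Set (E d))) → greenDefect K Fs a ψ = 0)
    (hψ : ContDiff ℝ 1 ψ) (hc : HasCompactSupport ψ) : greenDefect K Fs a ψ = 0 := by
  classical
  induction L using Finset.induction_on generalizing ψ with
  | empty => exact h ψ hψ hc (by simp)
  | insert A L _ ih =>
    simp only [Finset.forall_mem_insert] at hL h
    refine ih hL.2 (fun η hη hηc hηL => ?_) hψ hc
    rcases (A : Set (E d)).eq_empty_or_nonempty with hemp | ⟨x₀, hx₀⟩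
    · exact h η hη hηc ⟨hemp ▸ Set.disjoint_empty _, hηL⟩
    · refine hK.greenDefect_eq_zero_of_mul_one_sub_tubeCutoff a hL.1 hx₀ hη hηc fun k => ?_
      have hcut : ContDiff ℝ 1 (tubeCutoff A.direction x₀ k) := contDiff_tubeCutoff k
      exact h _ (hη.mul (contDiff_const.sub hcut)) hηc.mul_right
        ⟨(disjoint_tsupport_one_sub_tubeCutoff hx₀ k).mono_left tsupport_mul_subset_right,
          fun B hB => (hηL B hB).mono_left tsupport_mul_subset_left⟩

theorem exists_skeleton (hK : IsPolytope K Fs) : ∃ L : Finset (AffineSubspace ℝ (E d)),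
    (∀ A ∈ L, Module.finrank ℝ A.direction + 2 ≤ d) ∧
      ∀ F ∈ Fs, closure F \ F ⊆ ⋃ A ∈ L, (A : Set (E d)) := by
  classical
  choose! L hL using fun F hF => (hK.face F hF).boundary
  refine ⟨Fs.biUnion L, fun A hA => ?_, fun F hF => (hL F hF).2.trans ?_⟩
  · obtain ⟨F, hF, hAF⟩ := Finset.mem_biUnion.1 hA
    exact (hL F hF).1 A hAF
  · exact Set.biUnion_subset_biUnion_left (Finset.subset_biUnion_of_mem L hF)

theorem greenDefect_eq_zero (hK : IsPolytope K Fs)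
    (hdis : (Fs : Set (Set (E d))).PairwiseDisjoint id) (a : E d) (hψ : ContDiff ℝ 1 ψ)
    (hc : HasCompactSupport ψ) : greenDefect K Fs a ψ = 0 := by
  obtain ⟨L, hcodim, hL⟩ := hK.exists_skeleton
  refine hK.greenDefect_eq_zero_of_disjoint_affineSubspaces a hcodim (fun η hη hηc hηL => ?_) hψ hc
  refine eq_zero_of_locally_eq_zero (by simp) (fun _ _ => hK.greenDefect_add a) hη hηc
    fun x hx => ?_
  by_cases hxK : x ∈ K
  · exact ⟨K, ⟨hK.isOpen, hxK⟩, fun ζ => hK.greenDefect_of_tsupport_subset a⟩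
  by_cases hxc : x ∈ closure K
  · have hfr : x ∈ ⋃ F ∈ Fs, closure F := by
      rw [← hK.frontier_eq, hK.isOpen.frontier_eq]
      exact ⟨hxc, hxK⟩
    obtain ⟨F, hF, hxF⟩ := Set.mem_iUnion₂.1 hfr
    have hxF' : x ∈ F := by
      by_contra hn
      obtain ⟨A, hA, hxA⟩ := Set.mem_iUnion₂.1 (hL F hF ⟨hxF, hn⟩)
      exact Set.disjoint_left.1 (hηL A hA) hx hxA
    obtain ⟨r, hr, h⟩ := hK.exists_greenDefect_eq_zero_of_mem_face hdis a hF hxF'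
    exact ⟨Metric.ball x r, ⟨Metric.isOpen_ball, Metric.mem_ball_self hr⟩, h⟩
  · exact ⟨(closure K)ᶜ, ⟨isClosed_closure.isOpen_compl, hxc⟩,
      fun ζ _ _ => hK.greenDefect_of_tsupport_subset_compl a⟩

theorem integral_fderiv (hK : IsPolytope K Fs)
    (hdis : (Fs : Set (Set (E d))).PairwiseDisjoint id) (a : E d) {φ : E d → ℝ}
    (hφ : ContDiff ℝ 1 φ) :
    ∫ x in K, fderiv ℝ φ x a = ∑ F ∈ Fs, ⟪faceNormal K F, a⟫ * ∫ x, φ x ∂(surf F) := by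
  obtain ⟨R, hR₀, hR⟩ := hK.bounded.closure.subset_ball_lt 0 (0 : E d)
  let χ : ContDiffBump (0 : E d) := ⟨R, R + 1, hR₀, by linarith⟩
  have heq {x : E d} (hx : x ∈ closure K) : (φ * ⇑χ) =ᶠ[𝓝 x] φ := by
    filter_upwards [χ.eventuallyEq_one_of_mem_ball (hR hx)] with y hy
    simp [hy]
  have hvol : ∫ x in K, fderiv ℝ (φ * ⇑χ) x a = ∫ x in K, fderiv ℝ φ x a :=
    setIntegral_congr_fun hK.isOpen.measurableSet fun x hx => by
      simp only [(heq (subset_closure hx)).fderiv_eq]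
  have hsurf {F : Set (E d)} (hF : F ∈ Fs) :
      ∫ x, (φ * ⇑χ) x ∂(surf F) = ∫ x, φ x ∂(surf F) :=
    setIntegral_congr_fun (hK.face F hF).measurableSet fun x hx =>
      (heq (frontier_subset_closure (hK.face_subset hF hx))).eq_of_nhds
  have hzero := hK.greenDefect_eq_zero hdis a (ψ := φ * ⇑χ) (hφ.mul χ.contDiff)
    χ.hasCompactSupport.mul_left
  rw [← hvol, sub_eq_zero.1 hzero]
  exact Finset.sum_congr rfl fun F hF => congrArg _ (hsurf hF)

end IsPolytope

/-! ### Gradients -/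

section Gradient

variable {H : Type*} [NormedAddCommGroup H] [InnerProductSpace ℝ H] [CompleteSpace H] {φ η : H → ℝ}

theorem continuous_gradient (hφ : ContDiff ℝ 1 φ) : Continuous (∇ φ) :=
  (InnerProductSpace.toDual ℝ H).symm.continuous.comp (hφ.continuous_fderiv one_ne_zero)

theorem gradient_eq_zero_of_notMem_tsupport {x : H} (hx : x ∉ tsupport φ) : ∇ φ x = 0 := by
  simp [gradient, fderiv_of_notMem_tsupport (𝕜 := ℝ) hx]

theorem hasCompactSupport_gradient (hφ : HasCompactSupport φ) : HasCompactSupport (∇ φ) :=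
  HasCompactSupport.of_support_subset_isCompact hφ fun _ =>
    not_imp_comm.1 gradient_eq_zero_of_notMem_tsupport

theorem gradient_mul {x : H} (hφ : DifferentiableAt ℝ φ x) (hη : DifferentiableAt ℝ η x) :
    ∇ (φ * η) x = φ x • ∇ η x + η x • ∇ φ x := by
  simp [gradient, fderiv_mul hφ hη]

theorem gradient_sub {x : H} (hφ : DifferentiableAt ℝ φ x) (hη : DifferentiableAt ℝ η x) :
    ∇ (φ - η) x = ∇ φ x - ∇ η x := by
  simp [gradient, fderiv_sub hφ hη]

end Gradient

/-! ### Affine functions -/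

/-- The gradient of an affine function. -/
noncomputable def slope (p : P1 d) : E d :=
  (InnerProductSpace.toDual ℝ (E d)).symm p.linear.toContinuousLinearMap

theorem inner_slope (p : P1 d) (v : E d) : ⟪slope p, v⟫ = p.linear v := by
  simp [slope, InnerProductSpace.toDual_symm_apply]

theorem affine_apply (p : P1 d) (x : E d) : p x = ⟪slope p, x⟫ + p 0 := by
  rw [inner_slope]
  exact congrFun p.decomp x

theorem affine_ext {p q : P1 d} (h : slope p = slope q) (h₀ : p 0 = q 0) : p = q := by
  ext x
  rw [affine_apply p, affine_apply q, h, h₀]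

theorem contDiff_affine (p : P1 d) {k : WithTop ℕ∞} : ContDiff ℝ k p := by
  rw [funext (affine_apply p)]
  exact (contDiff_const.inner ℝ contDiff_id).add contDiff_const

theorem gradient_affine (p : P1 d) (x : E d) : ∇ p x = slope p := by
  rw [funext (affine_apply p)]
  exact HasGradientAt.gradient
    ((InnerProductSpace.toDual ℝ (E d) (slope p)).hasFDerivAt.add_const (p 0))

theorem slope_sub (p q : P1 d) : slope (p - q) = slope p - slope q :=
  ext_inner_right ℝ fun v => by
    simp only [inner_sub_left, inner_slope, AffineMap.sub_linear, LinearMap.sub_apply]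

/-- The affine function with gradient `g` and value `c` at the origin. -/
noncomputable def affineOf (g : E d) (c : ℝ) : P1 d :=
  (innerₛₗ ℝ g).toAffineMap + AffineMap.const ℝ (E d) c

theorem affineOf_apply (g : E d) (c : ℝ) (x : E d) : affineOf g c x = ⟪g, x⟫ + c := by
  simp [affineOf]

theorem slope_affineOf (g : E d) (c : ℝ) : slope (affineOf g c) = g :=
  ext_inner_right ℝ fun v => by simp [inner_slope, affineOf]

/-! ### Convergence in `L²` -/

section L2

variable {V : Type*} [NormedAddCommGroup V] {μ : Measure (E d)}

theorem TendstoL2.congr {φ : ℕ → E d → V} {v w : E d → V} (h : TendstoL2 μ φ v) (hvw : v =ᵐ[μ] w) :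
    TendstoL2 μ φ w :=
  Tendsto.congr (fun k => eLpNorm_congr_ae (hvw.mono fun x hx => by simp [hx])) h

theorem TendstoL2.mono_measure {ν : Measure (E d)} {φ : ℕ → E d → V} {v : E d → V}
    (h : TendstoL2 μ φ v) (hν : ν ≤ μ) : TendstoL2 ν φ v :=
  tendsto_of_tendsto_of_tendsto_of_le_of_le tendsto_const_nhds h (fun _ => bot_le)
    fun _ => eLpNorm_mono_measure _ hν

theorem TendstoL2.sub {φ ψ : ℕ → E d → V} {v w : E d → V} (hv : TendstoL2 μ φ v)
    (hw : TendstoL2 μ ψ w) (hφ : ∀ k, AEStronglyMeasurable (φ k - v) μ)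
    (hψ : ∀ k, AEStronglyMeasurable (ψ k - w) μ) :
    TendstoL2 μ (fun k => φ k - ψ k) (v - w) := by
  have h : Tendsto (fun k => eLpNorm (φ k - v) 2 μ + eLpNorm (ψ k - w) 2 μ) atTop (𝓝 0) := by
    simpa only [add_zero] using Tendsto.add hv hw
  refine tendsto_of_tendsto_of_tendsto_of_le_of_le tendsto_const_nhds h (fun _ => bot_le)
    fun k => ?_
  simp only [sub_sub_sub_comm (φ k) (ψ k) v w]
  exact eLpNorm_sub_le (hφ k) (hψ k) one_le_two

theorem tendstoL2_const (v : E d → V) : TendstoL2 μ (fun _ => v) v := by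
  simp [TendstoL2]

variable [InnerProductSpace ℝ V]

theorem integrable_inner_of_memLp {v w : E d → V} (hv : MemLp v 2 μ) (hw : MemLp w 2 μ) :
    Integrable (fun x => ⟪v x, w x⟫) μ := by
  refine (L2.integrable_inner (𝕜 := ℝ) (hv.toLp v) (hw.toLp w)).congr ?_
  filter_upwards [hv.coeFn_toLp, hw.coeFn_toLp] with x hvx hwx
  rw [hvx, hwx]

theorem inner_toLp {v w : E d → V} (hv : MemLp v 2 μ) (hw : MemLp w 2 μ) :
    ⟪hv.toLp v, hw.toLp w⟫ = ∫ x, ⟪v x, w x⟫ ∂μ := by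
  rw [L2.inner_def]
  refine integral_congr_ae ?_
  filter_upwards [hv.coeFn_toLp, hw.coeFn_toLp] with x hvx hwx
  rw [hvx, hwx]

theorem TendstoL2.tendsto_integral_inner {φ : ℕ → E d → V} {v w : E d → V}
    (h : TendstoL2 μ φ v) (hφ : ∀ k, MemLp (φ k) 2 μ) (hv : MemLp v 2 μ) (hw : MemLp w 2 μ) :
    Tendsto (fun k => ∫ x, ⟪φ k x, w x⟫ ∂μ) atTop (𝓝 (∫ x, ⟪v x, w x⟫ ∂μ)) := by
  have hLp := (Lp.tendsto_Lp_iff_tendsto_eLpNorm'' φ hφ v hv).2 h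
  simpa only [inner_toLp] using hLp.inner (𝕜 := ℝ) (tendsto_const_nhds (x := hw.toLp w))

theorem TendstoL2.tendsto_integral_mul {φ : ℕ → E d → ℝ} {v w : E d → ℝ}
    (h : TendstoL2 μ φ v) (hφ : ∀ k, MemLp (φ k) 2 μ) (hv : MemLp v 2 μ) (hw : MemLp w 2 μ) :
    Tendsto (fun k => ∫ x, w x * φ k x ∂μ) atTop (𝓝 (∫ x, w x * v x ∂μ)) := by
  simpa using h.tendsto_integral_inner hφ hv hw

end L2

/-! ### Weak gradients -/

theorem IsTest.mono {D D' : Set (E d)} {φ : E d → ℝ} (h : IsTest D φ) (hD : D ⊆ D') :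
    IsTest D' φ := ⟨h.1, h.2.1, h.2.2.trans hD⟩

theorem ae_eq_of_forall_isTest {V : Type*} [NormedAddCommGroup V] [NormedSpace ℝ V]
    [CompleteSpace V] {μ : Measure (E d)} {D : Set (E d)} (hD : IsOpen D)
    (hμ : ∀ᵐ x ∂μ, x ∈ D) {G H : E d → V} (hG : LocallyIntegrable G μ)
    (hH : LocallyIntegrable H μ)
    (h : ∀ φ, IsTest D φ → ∫ x, φ x • G x ∂μ = ∫ x, φ x • H x ∂μ) : G =ᵐ[μ] H := by
  have hzero : ∀ᵐ x ∂μ, x ∈ D → (G - H) x = 0 := by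
    refine hD.ae_eq_zero_of_integral_contDiff_smul_eq_zero ((hG.sub hH).locallyIntegrableOn D)
      fun φ hφ hc hsub => ?_
    simp only [Pi.sub_apply, smul_sub]
    rw [integral_sub (hG.integrable_smul_left_of_hasCompactSupport hφ.continuous hc)
      (hH.integrable_smul_left_of_hasCompactSupport hφ.continuous hc), h φ ⟨hφ, hc, hsub⟩, sub_self]
  filter_upwards [hzero, hμ] with x hx hxD
  exact sub_eq_zero.1 (hx hxD)

section WeakGrad

variable {D D' : Set (E d)} {v w : E d → ℝ} {G H : E d → E d}

theorem IsWeakGrad.ae_eq (hD : IsOpen D) (hG : IsWeakGrad D v G) (hH : IsWeakGrad D v H) :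
    G =ᵐ[volume.restrict D] H :=
  ae_eq_of_forall_isTest hD (ae_restrict_mem hD.measurableSet)
    (hG.1.locallyIntegrable one_le_two) (hH.1.locallyIntegrable one_le_two)
    fun φ hφ => neg_injective ((hG.2 φ hφ).symm.trans (hH.2 φ hφ))

theorem IsWeakGrad.grad_ae_eq (hD : IsOpen D) (h : IsWeakGrad D v G) :
    grad D v =ᵐ[volume.restrict D] G :=
  IsWeakGrad.ae_eq hD (Classical.epsilon_spec ⟨G, h⟩) h

theorem MemH1.isWeakGrad_grad (h : MemH1 D v) : IsWeakGrad D v (grad D v) :=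
  Classical.epsilon_spec h.2

theorem MemH1.memLp_grad (h : MemH1 D v) : MemLp (grad D v) 2 (volume.restrict D) :=
  h.isWeakGrad_grad.1

theorem IsWeakGrad.sub (hv : MemLp v 2 (volume.restrict D)) (hw : MemLp w 2 (volume.restrict D))
    (hG : IsWeakGrad D v G) (hH : IsWeakGrad D w H) : IsWeakGrad D (v - w) (G - H) := by
  refine ⟨hG.1.sub hH.1, fun φ hφ => ?_⟩
  have hleft {V : E d → E d} (hV : MemLp V 2 (volume.restrict D)) :
      Integrable (fun x => φ x • V x) (volume.restrict D) :=
    (hV.locallyIntegrable one_le_two).integrable_smul_left_of_hasCompactSupport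
      hφ.1.continuous hφ.2.1
  have hright {z : E d → ℝ} (hz : MemLp z 2 (volume.restrict D)) :
      Integrable (fun x => z x • ∇ φ x) (volume.restrict D) :=
    (hz.locallyIntegrable one_le_two).integrable_smul_right_of_hasCompactSupport
      (continuous_gradient (hφ.1.of_le (by simp))) (hasCompactSupport_gradient hφ.2.1)
  simp only [Pi.sub_apply, sub_smul, smul_sub]
  rw [integral_sub (hright hv) (hright hw), integral_sub (hleft hG.1) (hleft hH.1),
    hG.2 φ hφ, hH.2 φ hφ]
  abel

theorem MemH1.sub (hv : MemH1 D v) (hw : MemH1 D w) : MemH1 D (v - w) :=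
  ⟨hv.1.sub hw.1, _, hv.isWeakGrad_grad.sub hv.1 hw.1 hw.isWeakGrad_grad⟩

theorem grad_sub_ae_eq (hD : IsOpen D) (hv : MemH1 D v) (hw : MemH1 D w) :
    grad D (v - w) =ᵐ[volume.restrict D] grad D v - grad D w :=
  (hv.isWeakGrad_grad.sub hv.1 hw.1 hw.isWeakGrad_grad).grad_ae_eq hD

theorem IsWeakGrad.mono (hD' : MeasurableSet D') (h : D ⊆ D') (hG : IsWeakGrad D' v G) :
    IsWeakGrad D v G := by
  refine ⟨hG.1.mono_measure (Measure.restrict_mono h le_rfl), fun φ hφ => ?_⟩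
  have hI := hG.2 φ (hφ.mono h)
  rwa [setIntegral_eq_of_subset_of_forall_sdiff_eq_zero hD' h,
    setIntegral_eq_of_subset_of_forall_sdiff_eq_zero hD' h] at hI
  · rintro x ⟨-, hx⟩
    rw [image_eq_zero_of_notMem_tsupport fun hx' => hx (hφ.2.2 hx'), zero_smul]
  · rintro x ⟨-, hx⟩
    rw [gradient_eq_zero_of_notMem_tsupport fun hx' => hx (hφ.2.2 hx'), smul_zero]

theorem isWeakGrad_gradient {φ : E d → ℝ} (hφ : ContDiff ℝ 1 φ)
    (hL : MemLp (∇ φ) 2 (volume.restrict D)) : IsWeakGrad D φ (∇ φ) := by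
  refine ⟨hL, fun η hη => ?_⟩
  have hη₁ : ContDiff ℝ 1 η := hη.1.of_le (by simp)
  have hI₁ : Integrable (fun x => φ x • ∇ η x) (volume.restrict D) :=
    (hφ.continuous.smul (continuous_gradient hη₁)).integrable_of_hasCompactSupport
      (hasCompactSupport_gradient hη.2.1).smul_left
  have hI₂ : Integrable (fun x => η x • ∇ φ x) (volume.restrict D) :=
    (hη₁.continuous.smul (continuous_gradient hφ)).integrable_of_hasCompactSupport
      hη.2.1.smul_right
  rw [eq_neg_iff_add_eq_zero, ← integral_add hI₁ hI₂]
  refine ext_inner_left ℝ fun a => ?_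
  have hI : Integrable (fun x => φ x • ∇ η x + η x • ∇ φ x) (volume.restrict D) :=
    hI₁.add hI₂
  rw [← integral_inner hI, inner_zero_right]
  have hderiv (x : E d) : ⟪a, φ x • ∇ η x + η x • ∇ φ x⟫ = fderiv ℝ (φ * η) x a := by
    rw [← gradient_mul (hφ.differentiable one_ne_zero x) (hη₁.differentiable one_ne_zero x),
      real_inner_comm, inner_gradient_left]
  simp only [hderiv]
  rw [setIntegral_eq_integral_of_forall_compl_eq_zero fun x hx => ?_]
  · exact integral_fderiv_apply_eq_zero (hφ.mul hη₁) hη.2.1.mul_left a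
  · simp [fderiv_of_notMem_tsupport (𝕜 := ℝ)
      fun h : x ∈ tsupport (φ * η) => hx (hη.2.2 (tsupport_mul_subset_right h))]

end WeakGrad

namespace IsPolytope

variable {K : Set (E d)} {Fs : Finset (Set (E d))} {φ : E d → ℝ}

theorem isWeakGrad_gradient (hK : IsPolytope K Fs) (hφ : ContDiff ℝ 1 φ) : IsWeakGrad K φ (∇ φ) :=
  NCVEM.isWeakGrad_gradient hφ (hK.memLp_volume (continuous_gradient hφ) 2)

theorem memH1 (hK : IsPolytope K Fs) (hφ : ContDiff ℝ 1 φ) : MemH1 K φ :=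
  ⟨hK.memLp_volume hφ.continuous 2, _, hK.isWeakGrad_gradient hφ⟩

theorem grad_ae_eq (hK : IsPolytope K Fs) (hφ : ContDiff ℝ 1 φ) :
    grad K φ =ᵐ[volume.restrict K] ∇ φ :=
  (hK.isWeakGrad_gradient hφ).grad_ae_eq hK.isOpen

theorem isTrace_self (hK : IsPolytope K Fs) (hφ : ContDiff ℝ ∞ φ) : IsTrace K Fs φ φ :=
  ⟨fun _ => φ, fun _ => hφ, tendstoL2_const _,
    (tendstoL2_const _).congr (hK.grad_ae_eq (hφ.of_le (by simp))).symm,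
    fun _ hF => ⟨hK.memLp_surf hF hφ.continuous 2, tendstoL2_const _⟩⟩

end IsPolytope

/-! ### Traces -/

section Trace

variable {K : Set (E d)} {Fs : Finset (Set (E d))} {v w g h : E d → ℝ} {F : Set (E d)}

theorem isTrace_trace (h : ∃ g, IsTrace K Fs v g) : IsTrace K Fs v (trace K Fs v) :=
  Classical.epsilon_spec h

theorem IsTrace.memLp (h : IsTrace K Fs v g) (hF : F ∈ Fs) : MemLp g 2 (surf F) := by
  obtain ⟨_, -, -, -, h⟩ := h
  exact (h F hF).1

namespace IsPolytope

theorem integrable_of_isTrace (hK : IsPolytope K Fs) (h : IsTrace K Fs v g) (hF : F ∈ Fs) :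
    Integrable g (surf F) := by
  have := hK.isFiniteMeasure_surf hF
  exact (h.memLp hF).integrable one_le_two

theorem sum_inner_faceNormal_mul_integral_mul (hK : IsPolytope K Fs)
    (hdis : (Fs : Set (Set (E d))).PairwiseDisjoint id) {η φ : E d → ℝ} (hη : ContDiff ℝ 1 η)
    (hφ : ContDiff ℝ 1 φ) (a : E d) :
    ∑ F ∈ Fs, ⟪faceNormal K F, a⟫ * ∫ x, η x * φ x ∂(surf F) =
      (∫ x in K, ⟪∇ φ x, η x • a⟫) + ∫ x in K, ⟪∇ η x, a⟫ * φ x := by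
  have hI₁ : Integrable (fun x => ⟪∇ φ x, η x • a⟫) (volume.restrict K) :=
    hK.integrable_volume ((continuous_gradient hφ).inner (hη.continuous.smul continuous_const))
  have hI₂ : Integrable (fun x => ⟪∇ η x, a⟫ * φ x) (volume.restrict K) :=
    hK.integrable_volume (((continuous_gradient hη).inner continuous_const).mul hφ.continuous)
  rw [← integral_add hI₁ hI₂]
  refine (hK.integral_fderiv hdis a (hη.mul hφ)).symm.trans (integral_congr_ae ?_)
  refine ae_of_all _ fun x => (inner_gradient_left (𝕜 := ℝ)).symm.trans ?_
  have hgrad : ∇ (fun x => η x * φ x) x = η x • ∇ φ x + φ x • ∇ η x :=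
    gradient_mul (hη.differentiable one_ne_zero x) (hφ.differentiable one_ne_zero x)
  simp only [hgrad, inner_add_left, real_inner_smul_left, real_inner_smul_right]
  ring

theorem sum_inner_faceNormal_mul_integral_mul_trace (hK : IsPolytope K Fs)
    (hdis : (Fs : Set (Set (E d))).PairwiseDisjoint id) (hv : MemH1 K v) (h : IsTrace K Fs v g)
    {η : E d → ℝ} (hη : ContDiff ℝ 1 η) (a : E d) :
    ∑ F ∈ Fs, ⟪faceNormal K F, a⟫ * ∫ x, η x * g x ∂(surf F) =
      (∫ x in K, ⟪grad K v x, η x • a⟫) + ∫ x in K, ⟪∇ η x, a⟫ * v x := by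
  obtain ⟨φ, hφ, hφv, hφgrad, hφg⟩ := h
  have hφ₁ (k : ℕ) : ContDiff ℝ 1 (φ k) := (hφ k).of_le (by simp)
  have hsurf : Tendsto (fun k => ∑ F ∈ Fs, ⟪faceNormal K F, a⟫ * ∫ x, η x * φ k x ∂(surf F)) atTop
      (𝓝 (∑ F ∈ Fs, ⟪faceNormal K F, a⟫ * ∫ x, η x * g x ∂(surf F))) :=
    tendsto_finsetSum _ fun F hF =>
      ((hφg F hF).2.tendsto_integral_mul (fun k => hK.memLp_surf hF (hφ k).continuous 2)
        (hφg F hF).1 (hK.memLp_surf hF hη.continuous 2)).const_mul _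
  have hvol := (hφgrad.tendsto_integral_inner
    (fun k => hK.memLp_volume (continuous_gradient (hφ₁ k)) 2) hv.memLp_grad
    (hK.memLp_volume (hη.continuous.smul (continuous_const (y := a))) 2)).add
    (hφv.tendsto_integral_mul (fun k => hK.memLp_volume (hφ k).continuous 2) hv.1
      (hK.memLp_volume ((continuous_gradient hη).inner (continuous_const (y := a))) 2))
  exact tendsto_nhds_unique hsurf
    (hvol.congr fun k => (hK.sum_inner_faceNormal_mul_integral_mul hdis hη (hφ₁ k) a).symm)

theorem isTrace_sub (hK : IsPolytope K Fs) (hv : MemH1 K v) (hw : MemH1 K w)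
    (hg : IsTrace K Fs v g) (hh : IsTrace K Fs w h) : IsTrace K Fs (v - w) (g - h) := by
  obtain ⟨φ, hφ, hφv, hφgrad, hφg⟩ := hg
  obtain ⟨ψ, hψ, hψw, hψgrad, hψh⟩ := hh
  have hmeas {f z : E d → ℝ} {μ : Measure (E d)} (hf : ContDiff ℝ ∞ f) (hz : MemLp z 2 μ) :
      AEStronglyMeasurable (f - z) μ :=
    hf.continuous.aestronglyMeasurable.sub hz.aestronglyMeasurable
  have hmeas_grad {f z : E d → ℝ} (hf : ContDiff ℝ ∞ f) (hz : MemH1 K z) :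
      AEStronglyMeasurable (∇ f - grad K z) (volume.restrict K) :=
    (continuous_gradient (hf.of_le (by simp))).aestronglyMeasurable.sub
      hz.memLp_grad.aestronglyMeasurable
  have hgrad (k : ℕ) : ∇ (φ k - ψ k) = ∇ (φ k) - ∇ (ψ k) :=
    funext fun x => gradient_sub ((hφ k).differentiable (by simp) x)
      ((hψ k).differentiable (by simp) x)
  refine ⟨fun k => φ k - ψ k, fun k => (hφ k).sub (hψ k), ?_, ?_, fun F hF => ⟨?_, ?_⟩⟩
  · exact hφv.sub hψw (fun k => hmeas (hφ k) hv.1) fun k => hmeas (hψ k) hw.1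
  · simp only [hgrad]
    exact (hφgrad.sub hψgrad (fun k => hmeas_grad (hφ k) hv) fun k => hmeas_grad (hψ k) hw).congr
      (grad_sub_ae_eq hK.isOpen hv hw).symm
  · exact (hφg F hF).1.sub (hψh F hF).1
  · exact (hφg F hF).2.sub (hψh F hF).2 (fun k => hmeas (hφ k) (hφg F hF).1)
      fun k => hmeas (hψ k) (hψh F hF).1

theorem ae_eq_of_sum_integral_mul_eq (hK : IsPolytope K Fs)
    (hdis : (Fs : Set (Set (E d))).PairwiseDisjoint id) (hF : F ∈ Fs) (hg : Integrable g (surf F))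
    (hh : Integrable h (surf F)) {c : Set (E d) → ℝ} (hc : c F ≠ 0)
    (hs : ∀ φ : E d → ℝ, ContDiff ℝ ∞ φ → ∑ F ∈ Fs, c F * ∫ x, φ x * g x ∂(surf F) =
      ∑ F ∈ Fs, c F * ∫ x, φ x * h x ∂(surf F)) : g =ᵐ[surf F] h := by
  refine ae_eq_of_forall_isTest isOpen_awayFrom
    ((hK.ae_surf_mem hF).mono fun x hx => hK.subset_awayFrom hdis hF hx)
    hg.locallyIntegrable hh.locallyIntegrable fun φ hφ => ?_
  have hsingle (k : E d → ℝ) : ∑ F ∈ Fs, c F * ∫ x, φ x * k x ∂(surf F) =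
      c F * ∫ x, φ x * k x ∂(surf F) := by
    refine Finset.sum_eq_single F (fun F' hF' hne => ?_) (fun h => absurd hF h)
    have hsupp : Disjoint F' (tsupport fun x => φ x * k x) :=
      (disjoint_awayFrom hF' hne).mono_right (tsupport_mul_subset_left.trans hφ.2.2)
    rw [integral_surf_eq_zero hsupp, mul_zero]
  have hsF := hs φ hφ.1
  rw [hsingle, hsingle] at hsF
  exact mul_left_cancel₀ hc hsF

-- With the field `faceNormal K F`, the Green formula determines the trace on `F`.
theorem isTrace_unique (hK : IsPolytope K Fs) (hdis : (Fs : Set (Set (E d))).PairwiseDisjoint id)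
    (hv : MemH1 K v) (hg : IsTrace K Fs v g) (hh : IsTrace K Fs v h) (hF : F ∈ Fs) :
    g =ᵐ[surf F] h := by
  refine hK.ae_eq_of_sum_integral_mul_eq hdis hF (hK.integrable_of_isTrace hg hF)
    (hK.integrable_of_isTrace hh hF) (c := fun F' => ⟪faceNormal K F', faceNormal K F⟫) ?_
    fun φ hφ => ?_
  · rw [real_inner_self_eq_norm_sq, (hK.isOutwardNormal_faceNormal hF).1]
    norm_num
  · have hφ₁ : ContDiff ℝ 1 φ := hφ.of_le (by simp)
    rw [hK.sum_inner_faceNormal_mul_integral_mul_trace hdis hv hg hφ₁,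
      hK.sum_inner_faceNormal_mul_integral_mul_trace hdis hv hh hφ₁]

theorem integral_trace_eq (hK : IsPolytope K Fs)
    (hdis : (Fs : Set (Set (E d))).PairwiseDisjoint id) (hv : MemH1 K v) (hg : IsTrace K Fs v g)
    (hF : F ∈ Fs) : ∫ x, trace K Fs v x ∂(surf F) = ∫ x, g x ∂(surf F) :=
  integral_congr_ae (hK.isTrace_unique hdis hv (isTrace_trace ⟨g, hg⟩) hg hF)

theorem integral_trace_sub (hK : IsPolytope K Fs)
    (hdis : (Fs : Set (Set (E d))).PairwiseDisjoint id) (hv : MemH1 K v) (hw : MemH1 K w)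
    (hg : ∃ g, IsTrace K Fs v g) (hh : ∃ g, IsTrace K Fs w g) (hF : F ∈ Fs) :
    ∫ x, trace K Fs (v - w) x ∂(surf F) =
      (∫ x, trace K Fs v x ∂(surf F)) - ∫ x, trace K Fs w x ∂(surf F) := by
  rw [hK.integral_trace_eq hdis (hv.sub hw)
    (hK.isTrace_sub hv hw (isTrace_trace hg) (isTrace_trace hh)) hF]
  exact integral_sub (hK.integrable_of_isTrace (isTrace_trace hg) hF)
    (hK.integrable_of_isTrace (isTrace_trace hh) hF)

theorem integral_inner_grad_const (hK : IsPolytope K Fs)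
    (hdis : (Fs : Set (Set (E d))).PairwiseDisjoint id) (hv : MemH1 K v)
    (h : ∃ g, IsTrace K Fs v g) (a : E d) :
    ∫ x in K, ⟪grad K v x, a⟫ =
      ∑ F ∈ Fs, ⟪faceNormal K F, a⟫ * ∫ x, trace K Fs v x ∂(surf F) := by
  simpa using (hK.sum_inner_faceNormal_mul_integral_mul_trace hdis hv (isTrace_trace h)
    (contDiff_const (c := (1 : ℝ))) a).symm

end IsPolytope

end Trace

/-! ### Normal derivatives -/

section NormalDeriv

variable {K : Set (E d)} {Fs : Finset (Set (E d))} {v w l m g h : E d → ℝ} {F : Set (E d)}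

open scoped Classical in
/-- The function on the union of the faces that agrees with `g F` on each face `F`; it is extended
by zero. The faces are assumed pairwise disjoint whenever this is used. -/
noncomputable def glueFaces {V : Type*} [Zero V] (Fs : Finset (Set (E d)))
    (g : Set (E d) → E d → V) (x : E d) : V :=
  if h : ∃ F ∈ Fs, x ∈ F then g h.choose x else 0

theorem glueFaces_apply {V : Type*} [Zero V] (hdis : (Fs : Set (Set (E d))).PairwiseDisjoint id)
    (g : Set (E d) → E d → V) (hF : F ∈ Fs) {x : E d} (hx : x ∈ F) :
    glueFaces Fs g x = g F x := by
  have hex : ∃ F ∈ Fs, x ∈ F := ⟨F, hF, hx⟩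
  rw [glueFaces, dif_pos hex, hdis.elim_set hex.choose_spec.1 hF x hex.choose_spec.2 hx]

theorem IsPolytope.glueFaces_ae_eq {V : Type*} [Zero V] (hK : IsPolytope K Fs)
    (hdis : (Fs : Set (Set (E d))).PairwiseDisjoint id) (g : Set (E d) → E d → V) (hF : F ∈ Fs) :
    glueFaces Fs g =ᵐ[surf F] g F :=
  (hK.ae_surf_mem hF).mono fun _ hx => glueFaces_apply hdis g hF hx

/-- The outward unit normal as a function on the union of the faces, extended by zero. -/
noncomputable def normalField (K : Set (E d)) (Fs : Finset (Set (E d))) : E d → E d :=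
  glueFaces Fs fun F _ => faceNormal K F

theorem isNormalDeriv_normalDeriv (h : HasNormalDeriv K Fs v) :
    ∃ l, IsNormalDeriv K Fs v l (normalDeriv K Fs v) :=
  Classical.epsilon_spec (p := fun g => ∃ l, IsNormalDeriv K Fs v l g) h

namespace IsPolytope

theorem normalField_ae_eq (hK : IsPolytope K Fs)
    (hdis : (Fs : Set (Set (E d))).PairwiseDisjoint id) (hF : F ∈ Fs) :
    normalField K Fs =ᵐ[surf F] fun _ => faceNormal K F :=
  hK.glueFaces_ae_eq hdis _ hF

theorem isNormalDeriv_affine (hK : IsPolytope K Fs)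
    (hdis : (Fs : Set (Set (E d))).PairwiseDisjoint id) (p : P1 d) :
    IsNormalDeriv K Fs p 0 (fun x => ⟪normalField K Fs x, slope p⟫) := by
  refine ⟨MemLp.zero, fun F hF => ?_, fun φ hφ => ?_⟩
  · have := hK.isFiniteMeasure_surf hF
    exact (integrable_const ⟪faceNormal K F, slope p⟫).congr
      ((hK.normalField_ae_eq hdis hF).mono fun x hx => by simp only [hx])
  have hvol : ∫ x in K, ⟪grad K p x, ∇ φ x⟫ = ∫ x in K, fderiv ℝ φ x (slope p) := by
    refine integral_congr_ae ((hK.grad_ae_eq (contDiff_affine p)).mono fun x hx => ?_)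
    simp only
    rw [hx, gradient_affine, real_inner_comm, inner_gradient_left]
  simp only [Pi.zero_apply, zero_mul, integral_zero, add_zero]
  rw [hvol, hK.integral_fderiv hdis (slope p) (hφ.of_le (by simp))]
  refine Finset.sum_congr rfl fun F hF => ?_
  rw [← integral_const_mul]
  exact integral_congr_ae ((hK.normalField_ae_eq hdis hF).mono fun x hx => by simp only [hx])

theorem integrable_mul_surf (hK : IsPolytope K Fs) {φ : E d → ℝ} (hF : F ∈ Fs)
    (hg : Integrable g (surf F)) (hφ : Continuous φ) :
    Integrable (fun x => g x * φ x) (surf F) := by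
  obtain ⟨C, hC⟩ := ((hK.isBounded_face hF).isCompact_closure.image hφ).isBounded.exists_norm_le
  exact hg.mul_bdd hφ.aestronglyMeasurable
    ((hK.ae_surf_mem hF).mono fun x hx => hC _ ⟨x, subset_closure hx, rfl⟩)

theorem integral_inner_grad_sub (hK : IsPolytope K Fs) (hv : MemH1 K v) (hw : MemH1 K w)
    {G : E d → E d} (hG : MemLp G 2 (volume.restrict K)) :
    ∫ x in K, ⟪grad K (v - w) x, G x⟫ =
      (∫ x in K, ⟪grad K v x, G x⟫) - ∫ x in K, ⟪grad K w x, G x⟫ := by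
  rw [← integral_sub (integrable_inner_of_memLp hv.memLp_grad hG)
    (integrable_inner_of_memLp hw.memLp_grad hG)]
  refine integral_congr_ae ((grad_sub_ae_eq hK.isOpen hv hw).mono fun x hx => ?_)
  simp only [hx, Pi.sub_apply, inner_sub_left]

theorem isNormalDeriv_sub (hK : IsPolytope K Fs) (hv : MemH1 K v) (hw : MemH1 K w)
    (hg : IsNormalDeriv K Fs v l g) (hh : IsNormalDeriv K Fs w m h) :
    IsNormalDeriv K Fs (v - w) (l - m) (g - h) := by
  refine ⟨hg.1.sub hh.1, fun F hF => (hg.2.1 F hF).sub (hh.2.1 F hF), fun φ hφ => ?_⟩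
  have hgrad := hK.integral_inner_grad_sub hv hw
    (hK.memLp_volume (continuous_gradient (hφ.of_le (by simp))) 2)
  have hφL := hK.memLp_volume hφ.continuous 2
  have hvol : ∫ x in K, (l - m) x * φ x = (∫ x in K, l x * φ x) - ∫ x in K, m x * φ x := by
    simp only [Pi.sub_apply, sub_mul]
    exact integral_sub (hg.1.integrable_mul hφL) (hh.1.integrable_mul hφL)
  have hsurf : ∑ F ∈ Fs, ∫ x, (g - h) x * φ x ∂(surf F) =
      ∑ F ∈ Fs, (∫ x, g x * φ x ∂(surf F)) - ∑ F ∈ Fs, ∫ x, h x * φ x ∂(surf F) := by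
    rw [← Finset.sum_sub_distrib]
    refine Finset.sum_congr rfl fun F hF => ?_
    simp only [Pi.sub_apply, sub_mul]
    exact integral_sub (hK.integrable_mul_surf hF (hg.2.1 F hF) hφ.continuous)
      (hK.integrable_mul_surf hF (hh.2.1 F hF) hφ.continuous)
  rw [hgrad, hvol, hsurf, ← hg.2.2 φ hφ, ← hh.2.2 φ hφ]
  ring

theorem sum_integral_mul_of_isTest (hK : IsPolytope K Fs) {φ : E d → ℝ} (hφ : IsTest K φ)
    (g : E d → ℝ) : ∑ F ∈ Fs, ∫ x, g x * φ x ∂(surf F) = 0 := by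
  refine Finset.sum_eq_zero fun F hF => integral_surf_eq_zero ?_
  exact (disjoint_frontier_iff_isOpen.2 hK.isOpen).mono (hK.face_subset hF)
    (tsupport_mul_subset_right.trans hφ.2.2)

theorem laplacian_unique (hK : IsPolytope K Fs) (hg : IsNormalDeriv K Fs v l g)
    (hh : IsNormalDeriv K Fs v m h) : l =ᵐ[volume.restrict K] m := by
  refine ae_eq_of_forall_isTest hK.isOpen (ae_restrict_mem hK.isOpen.measurableSet)
    (hg.1.locallyIntegrable one_le_two) (hh.1.locallyIntegrable one_le_two) fun φ hφ => ?_
  have hgreen := (hg.2.2 φ hφ.1).trans (hK.sum_integral_mul_of_isTest hφ g)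
  rw [← (hh.2.2 φ hφ.1).trans (hK.sum_integral_mul_of_isTest hφ h)] at hgreen
  simpa only [smul_eq_mul, mul_comm (φ _)] using add_left_cancel hgreen

theorem isNormalDeriv_unique (hK : IsPolytope K Fs)
    (hdis : (Fs : Set (Set (E d))).PairwiseDisjoint id) (hg : IsNormalDeriv K Fs v l g)
    (hh : IsNormalDeriv K Fs v m h) (hF : F ∈ Fs) : g =ᵐ[surf F] h := by
  refine hK.ae_eq_of_sum_integral_mul_eq hdis hF (hg.2.1 F hF) (hh.2.1 F hF) (c := fun _ => 1)
    one_ne_zero fun φ hφ => ?_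
  have hlap : ∫ x in K, l x * φ x = ∫ x in K, m x * φ x :=
    integral_congr_ae ((hK.laplacian_unique hg hh).mono fun x hx => by simp only [hx])
  simp only [one_mul, mul_comm (φ _)]
  rw [← hg.2.2 φ hφ, ← hh.2.2 φ hφ, hlap]

theorem normalDeriv_sub_affine (hK : IsPolytope K Fs)
    (hdis : (Fs : Set (Set (E d))).PairwiseDisjoint id) (hv : MemH1 K v)
    (h : HasNormalDeriv K Fs v) (p : P1 d) (hF : F ∈ Fs) :
    normalDeriv K Fs (v - ⇑p) =ᵐ[surf F]
      fun x => normalDeriv K Fs v x - ⟪faceNormal K F, slope p⟫ := by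
  obtain ⟨l, hl⟩ := isNormalDeriv_normalDeriv h
  have hsub := hK.isNormalDeriv_sub hv (hK.memH1 (contDiff_affine p)) hl
    (hK.isNormalDeriv_affine hdis p)
  obtain ⟨m, hm⟩ := isNormalDeriv_normalDeriv ⟨_, _, hsub⟩
  filter_upwards [hK.isNormalDeriv_unique hdis hm hsub hF, hK.normalField_ae_eq hdis hF]
    with x hx hn
  rw [hx, Pi.sub_apply, hn]

theorem sub_affine_mem_localSpace (hK : IsPolytope K Fs)
    (hdis : (Fs : Set (Set (E d))).PairwiseDisjoint id) (hv : v ∈ localSpace K Fs) (p : P1 d) :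
    v - ⇑p ∈ localSpace K Fs := by
  obtain ⟨hH1, ⟨g, hg⟩, k, hk, hkc⟩ := hv
  have hp : MemH1 K p := hK.memH1 (contDiff_affine p)
  refine ⟨hH1.sub hp, ⟨_, hK.isTrace_sub hH1 hp hg (hK.isTrace_self (contDiff_affine p))⟩,
    k - fun x => ⟪normalField K Fs x, slope p⟫, ?_, fun F hF => ?_⟩
  · simpa only [sub_zero] using hK.isNormalDeriv_sub hH1 hp hk (hK.isNormalDeriv_affine hdis p)
  · obtain ⟨c, hc⟩ := hkc F hF
    refine ⟨c - ⟪faceNormal K F, slope p⟫, fun x hx => ?_⟩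
    rw [Pi.sub_apply, hc x hx, normalField, glueFaces_apply hdis _ hF hx]

end IsPolytope

end NormalDeriv

/-! ### Traces of functions in `H¹₀` -/

section ZeroTrace

variable {K Ω : Set (E d)} {Fs : Finset (Set (E d))} {F : Set (E d)} {n : E d}

theorem isFiniteMeasureOnCompacts_surf_hyperplane (hn : ‖n‖ = 1) (x₀ : E d) :
    IsFiniteMeasureOnCompacts (surf {x : E d | ⟪n, x - x₀⟫ = 0}) :=
  ⟨fun _ h => surf_hyperplane_lt_top hn x₀ h.isBounded⟩

theorem fderiv_mul_self_apply_le {ψ : E d → ℝ} {x : E d} (hψ : DifferentiableAt ℝ ψ x)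
    (hn : ‖n‖ = 1) : fderiv ℝ (ψ * ψ) x n ≤ ψ x * ψ x + ⟪∇ ψ x, ∇ ψ x⟫ := by
  have hcs : ⟪∇ ψ x, n⟫ ^ 2 ≤ ⟪∇ ψ x, ∇ ψ x⟫ := by
    rw [real_inner_self_eq_norm_sq, sq_le_sq, abs_norm]
    simpa only [hn, mul_one] using abs_real_inner_le_norm (∇ ψ x) n
  rw [← inner_gradient_left (𝕜 := ℝ), gradient_mul hψ hψ, inner_add_left, inner_smul_left,
    conj_trivial]
  nlinarith [sq_nonneg (ψ x - ⟪∇ ψ x, n⟫)]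

theorem integral_sq_surf_le (hn : ‖n‖ = 1) (x₀ : E d) (hF : F ⊆ {x : E d | ⟪n, x - x₀⟫ = 0})
    {ψ : E d → ℝ} (hψ : ContDiff ℝ 1 ψ) (hc : HasCompactSupport ψ) :
    ∫ x, ψ x * ψ x ∂(surf F) ≤ (∫ x, ψ x * ψ x) + ∫ x, ⟪∇ ψ x, ∇ ψ x⟫ := by
  have := isFiniteMeasureOnCompacts_surf_hyperplane hn x₀
  have hsq : ContDiff ℝ 1 (ψ * ψ) := hψ.mul hψ
  have hsqc : HasCompactSupport (ψ * ψ) := hc.mul_left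
  have hgrad : MemLp (∇ ψ) 2 volume :=
    (continuous_gradient hψ).memLp_of_hasCompactSupport (hasCompactSupport_gradient hc)
  have hI : Integrable fun x => ψ x * ψ x := hsq.continuous.integrable_of_hasCompactSupport hsqc
  have hsum : Integrable fun x => ψ x * ψ x + ⟪∇ ψ x, ∇ ψ x⟫ :=
    hI.add (integrable_inner_of_memLp hgrad hgrad)
  calc ∫ x, ψ x * ψ x ∂(surf F) ≤ ∫ x, ψ x * ψ x ∂(surf {x : E d | ⟪n, x - x₀⟫ = 0}) := by
        rw [surf_eq_restrict hF]
        exact setIntegral_le_integral (hsq.continuous.integrable_of_hasCompactSupport hsqc)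
          (ae_of_all _ fun x => mul_self_nonneg _)
    _ = ∫ x in {x | ⟪n, x - x₀⟫ < 0}, fderiv ℝ (ψ * ψ) x n := by
        rw [integral_halfspace_fderiv hn x₀ hsq hsqc, real_inner_self_eq_norm_sq, hn, one_pow,
          one_mul]
        rfl
    _ ≤ ∫ x in {x | ⟪n, x - x₀⟫ < 0}, (ψ x * ψ x + ⟪∇ ψ x, ∇ ψ x⟫) :=
        integral_mono (integrable_fderiv_apply hsq hsqc n).integrableOn hsum.integrableOn
          fun x => fderiv_mul_self_apply_le (hψ.differentiable one_ne_zero x) hn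
    _ ≤ ∫ x, (ψ x * ψ x + ⟪∇ ψ x, ∇ ψ x⟫) := setIntegral_le_integral hsum
        (ae_of_all _ fun _ => add_nonneg (mul_self_nonneg _) real_inner_self_nonneg)
    _ = _ := integral_add hI (integrable_inner_of_memLp hgrad hgrad)

theorem IsTest.memLp {μ : Measure (E d)} [IsFiniteMeasureOnCompacts μ] {φ : E d → ℝ}
    (h : IsTest Ω φ) : MemLp φ 2 μ :=
  h.1.continuous.memLp_of_hasCompactSupport h.2.1

theorem IsTest.memLp_gradient {μ : Measure (E d)} [IsFiniteMeasureOnCompacts μ] {φ : E d → ℝ}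
    (h : IsTest Ω φ) : MemLp (∇ φ) 2 μ :=
  (continuous_gradient (h.1.of_le (by simp))).memLp_of_hasCompactSupport
    (hasCompactSupport_gradient h.2.1)

theorem IsTest.sub {φ η : E d → ℝ} (hφ : IsTest Ω φ) (hη : IsTest Ω η) : IsTest Ω (φ - η) :=
  ⟨hφ.1.sub hη.1, hφ.2.1.sub hη.2.1,
    (tsupport_sub φ η).trans (Set.union_subset hφ.2.2 hη.2.2)⟩

theorem norm_toLp_surf_le (hn : ‖n‖ = 1) (x₀ : E d) (hF : F ⊆ {x : E d | ⟪n, x - x₀⟫ = 0})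
    {ψ : E d → ℝ} (hψ : IsTest Ω ψ) (h₀ : MemLp ψ 2 (surf F))
    (h₁ : MemLp ψ 2 (volume.restrict Ω)) (h₂ : MemLp (∇ ψ) 2 (volume.restrict Ω)) :
    ‖h₀.toLp ψ‖ ≤ ‖h₁.toLp ψ‖ + ‖h₂.toLp (∇ ψ)‖ := by
  have hle := integral_sq_surf_le hn x₀ hF (hψ.1.of_le (by simp)) hψ.2.1
  have hsurf : ‖h₀.toLp ψ‖ ^ 2 = ∫ x, ψ x * ψ x ∂(surf F) := by
    rw [← real_inner_self_eq_norm_sq, inner_toLp]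
    rfl
  have hvol : ‖h₁.toLp ψ‖ ^ 2 = ∫ x, ψ x * ψ x := by
    rw [← real_inner_self_eq_norm_sq, inner_toLp]
    refine setIntegral_eq_integral_of_forall_compl_eq_zero fun x hx => ?_
    rw [image_eq_zero_of_notMem_tsupport fun h => hx (hψ.2.2 h), inner_zero_left]
  have hgrad : ‖h₂.toLp (∇ ψ)‖ ^ 2 = ∫ x, ⟪∇ ψ x, ∇ ψ x⟫ := by
    rw [← real_inner_self_eq_norm_sq, inner_toLp]
    refine setIntegral_eq_integral_of_forall_compl_eq_zero fun x hx => ?_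
    rw [gradient_eq_zero_of_notMem_tsupport fun h => hx (hψ.2.2 h), inner_zero_left]
  rw [← hsurf, ← hvol, ← hgrad] at hle
  refine le_of_sq_le_sq ?_ (by positivity)
  nlinarith [norm_nonneg (h₁.toLp ψ), norm_nonneg (h₂.toLp (∇ ψ))]

theorem exists_tendstoL2_surf (hF : IsFlatFace F) [IsFiniteMeasure (surf F)]
    {φ : ℕ → E d → ℝ} {v : E d → ℝ} {G : E d → E d} (hφ : ∀ k, IsTest Ω (φ k))
    (hv : MemLp v 2 (volume.restrict Ω)) (hG : MemLp G 2 (volume.restrict Ω))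
    (hφv : TendstoL2 (volume.restrict Ω) φ v)
    (hφG : TendstoL2 (volume.restrict Ω) (fun k => ∇ (φ k)) G) :
    ∃ g, MemLp g 2 (surf F) ∧ TendstoL2 (surf F) φ g := by
  obtain ⟨n, x₀, hn, hFH⟩ := hF.exists_hyperplane
  have hsurf (k) : MemLp (φ k) 2 (surf F) := (hφ k).memLp
  have hvol (k) : MemLp (φ k) 2 (volume.restrict Ω) := (hφ k).memLp
  have hgrad (k) : MemLp (∇ (φ k)) 2 (volume.restrict Ω) := (hφ k).memLp_gradient
  have hdist (k l) : dist ((hsurf k).toLp (φ k)) ((hsurf l).toLp (φ l)) ≤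
      dist ((hvol k).toLp (φ k)) ((hvol l).toLp (φ l)) +
        dist ((hgrad k).toLp (∇ (φ k))) ((hgrad l).toLp (∇ (φ l))) := by
    have ht : IsTest Ω (φ k - φ l) := (hφ k).sub (hφ l)
    have hgrad_sub : ∇ (φ k - φ l) = ∇ (φ k) - ∇ (φ l) := funext fun x =>
      gradient_sub ((hφ k).1.differentiable (by simp) x) ((hφ l).1.differentiable (by simp) x)
    simp only [dist_eq_norm, ← MemLp.toLp_sub, ← hgrad_sub]
    exact norm_toLp_surf_le hn x₀ hFH ht _ _ ht.memLp_gradient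
  have hcauchy_vol := ((Lp.tendsto_Lp_iff_tendsto_eLpNorm'' φ hvol v hv).2 hφv).cauchySeq
  have hcauchy_grad := ((Lp.tendsto_Lp_iff_tendsto_eLpNorm'' _ hgrad G hG).2 hφG).cauchySeq
  have hcauchy : CauchySeq fun k => (hsurf k).toLp (φ k) := by
    rw [cauchySeq_iff_tendsto_dist_atTop_0] at hcauchy_vol hcauchy_grad ⊢
    have hsum := hcauchy_vol.add hcauchy_grad
    rw [add_zero] at hsum
    exact squeeze_zero (fun _ => dist_nonneg) (fun kl => hdist kl.1 kl.2) hsum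
  obtain ⟨g, hg⟩ := cauchySeq_tendsto_of_complete hcauchy
  refine ⟨g, Lp.memLp g, ?_⟩
  rw [TendstoL2, ← Lp.tendsto_Lp_iff_tendsto_eLpNorm'' φ hsurf g (Lp.memLp g), Lp.toLp_coeFn]
  exact hg

theorem MemH1.mono {v : E d → ℝ} (h : MemH1 Ω v) (hΩ : MeasurableSet Ω) (hK : K ⊆ Ω) :
    MemH1 K v :=
  ⟨h.1.mono_measure (Measure.restrict_mono hK le_rfl), _, h.isWeakGrad_grad.mono hΩ hK⟩

theorem MemH1.grad_ae_eq_of_subset {v : E d → ℝ} (h : MemH1 Ω v) (hΩ : MeasurableSet Ω)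
    (hKo : IsOpen K) (hK : K ⊆ Ω) : grad K v =ᵐ[volume.restrict K] grad Ω v :=
  (h.isWeakGrad_grad.mono hΩ hK).grad_ae_eq hKo

theorem IsPolytope.exists_isTrace_of_memH10 (hK : IsPolytope K Fs)
    (hdis : (Fs : Set (Set (E d))).PairwiseDisjoint id) (hΩ : MeasurableSet Ω) (hKΩ : K ⊆ Ω)
    {u : E d → ℝ} (hu : MemH10 Ω u) : ∃ g, IsTrace K Fs u g := by
  obtain ⟨hu1, φ, hφ, hφu, hφG⟩ := hu
  have hex (F) (hF : F ∈ Fs) : ∃ g, MemLp g 2 (surf F) ∧ TendstoL2 (surf F) φ g := by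
    have := hK.isFiniteMeasure_surf hF
    exact exists_tendstoL2_surf (hK.face F hF) hφ hu1.1 hu1.memLp_grad hφu hφG
  choose! g hgL hg using hex
  have hres : volume.restrict K ≤ volume.restrict Ω := Measure.restrict_mono hKΩ le_rfl
  refine ⟨glueFaces Fs g, φ, fun k => (hφ k).1, hφu.mono_measure hres,
    (hφG.mono_measure hres).congr (hu1.grad_ae_eq_of_subset hΩ hK.isOpen hKΩ).symm,
    fun F hF => ?_⟩
  have hglue := hK.glueFaces_ae_eq hdis g hF
  exact ⟨(memLp_congr_ae hglue).2 (hgL F hF), (hg F hF).congr hglue.symm⟩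

theorem IsTest.memH10 (hΩ : IsOpen Ω) {φ : E d → ℝ} (h : IsTest Ω φ) : MemH10 Ω φ := by
  have hw := isWeakGrad_gradient (D := Ω) (h.1.of_le (by simp)) h.memLp_gradient
  exact ⟨⟨h.memLp, _, hw⟩, fun _ => φ, fun _ => h, tendstoL2_const _,
    (tendstoL2_const _).congr (hw.grad_ae_eq hΩ).symm⟩

theorem IsWeakSolution.integral_test (hΩ : IsOpen Ω) {f u φ : E d → ℝ}
    (hu : IsWeakSolution Ω f u) (h : IsTest Ω φ) :
    ∫ x in Ω, ⟪grad Ω u x, ∇ φ x⟫ = ∫ x in Ω, f x * φ x := by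
  rw [← hu.2 φ (h.memH10 hΩ)]
  have hw := isWeakGrad_gradient (D := Ω) (h.1.of_le (by simp)) h.memLp_gradient
  exact integral_congr_ae ((hw.grad_ae_eq hΩ).mono fun x hx => by simp only [hx])

theorem IsWeakSolution.laplacian_ae_eq (hΩ : IsOpen Ω) (hK : IsPolytope K Fs) (hKΩ : K ⊆ Ω)
    {f u l g : E d → ℝ} (hf : MemLp f 2 (volume.restrict Ω)) (hu : IsWeakSolution Ω f u)
    (h : IsNormalDeriv K Fs u l g) : l =ᵐ[volume.restrict K] -f := by
  have hfK : MemLp f 2 (volume.restrict K) := hf.mono_measure (Measure.restrict_mono hKΩ le_rfl)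
  refine ae_eq_of_forall_isTest hK.isOpen (ae_restrict_mem hK.isOpen.measurableSet)
    (h.1.locallyIntegrable one_le_two) (hfK.neg.locallyIntegrable one_le_two) fun φ hφ => ?_
  have hgreen := (h.2.2 φ hφ.1).trans (hK.sum_integral_mul_of_isTest hφ g)
  have hweak := hu.integral_test hΩ (hφ.mono hKΩ)
  rw [setIntegral_eq_of_subset_of_forall_sdiff_eq_zero hΩ.measurableSet hKΩ,
    setIntegral_eq_of_subset_of_forall_sdiff_eq_zero hΩ.measurableSet hKΩ] at hweak
  · have hgrad : ∫ x in K, ⟪grad K u x, ∇ φ x⟫ = ∫ x in K, ⟪grad Ω u x, ∇ φ x⟫ :=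
      integral_congr_ae ((hu.1.1.grad_ae_eq_of_subset hΩ.measurableSet hK.isOpen hKΩ).mono
        fun x hx => by simp only [hx])
    simp only [smul_eq_mul, mul_comm (φ _), Pi.neg_apply, neg_mul, integral_neg]
    linarith
  · rintro x ⟨-, hx⟩
    rw [image_eq_zero_of_notMem_tsupport fun hx' => hx (hφ.2.2 hx'), mul_zero]
  · rintro x ⟨-, hx⟩
    rw [gradient_eq_zero_of_notMem_tsupport fun hx' => hx (hφ.2.2 hx'), inner_zero_right]

end ZeroTrace

/-! ### Normals and adjacent elements of a mesh -/

section MeshGeometry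

variable {K K' F Ω : Set (E d)} {n m x v : E d}

theorem tendsto_add_smul_nhdsGT_zero (x v : E d) :
    Tendsto (fun t : ℝ => x + t • v) (𝓝[>] 0) (𝓝 x) := by
  have hcont : Continuous fun t : ℝ => x + t • v := by fun_prop
  simpa only [zero_smul, add_zero] using (hcont.tendsto 0).mono_left nhdsWithin_le_nhds

theorem eq_of_one_le_inner (hn : ‖n‖ = 1) (hm : ‖m‖ = 1) (h : 1 ≤ ⟪n, m⟫) : n = m := by
  have hle : ⟪n, m⟫ ≤ 1 := by simpa only [hn, hm, one_mul] using real_inner_le_norm n m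
  exact (inner_eq_one_iff_of_norm_eq_one hn hm).1 (hle.antisymm h)

namespace IsOutwardNormal

theorem eventually_mem (h : IsOutwardNormal K F n) (hx : x ∈ F) (hv : ⟪n, v⟫ < 0) :
    ∀ᶠ t : ℝ in 𝓝[>] 0, x + t • v ∈ K := by
  obtain ⟨r, hr, hball⟩ := h.2 x hx
  filter_upwards [tendsto_add_smul_nhdsGT_zero x v (Metric.ball_mem_nhds x hr),
    self_mem_nhdsWithin] with t ht ht0
  refine (hball.ge ⟨?_, ht⟩).1
  simp only [Set.mem_ofPred_eq, add_sub_cancel_left, inner_smul_right]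
  exact mul_neg_of_pos_of_neg ht0 hv

theorem eventually_notMem_closure (h : IsOutwardNormal K F n) (hx : x ∈ F) (hv : 0 < ⟪n, v⟫) :
    ∀ᶠ t : ℝ in 𝓝[>] 0, x + t • v ∉ closure K := by
  obtain ⟨r, hr, hball⟩ := h.2 x hx
  filter_upwards [tendsto_add_smul_nhdsGT_zero x v (Metric.ball_mem_nhds x hr),
    self_mem_nhdsWithin] with t ht ht0 hmem
  have hpos : 0 < ⟪n, x + t • v - x⟫ := by
    rw [add_sub_cancel_left, inner_smul_right]
    exact mul_pos ht0 hv
  have hopen : IsOpen ({y | 0 < ⟪n, y - x⟫} ∩ Metric.ball x r) :=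
    (isOpen_lt continuous_const (by fun_prop)).inter Metric.isOpen_ball
  obtain ⟨z, ⟨hz, hzr⟩, hzK⟩ := mem_closure_iff.1 hmem _ hopen ⟨hpos, ht⟩
  exact lt_asymm (a := ⟪n, z - x⟫) (hball.le ⟨hzK, hzr⟩).1 hz

-- If `m ≠ -n`, then the direction `-(n + m)` points into both `K` and `K'`.
theorem eq_neg_of_disjoint (hn : IsOutwardNormal K F n) (hm : IsOutwardNormal K' F m)
    (hF : F.Nonempty) (hd : Disjoint K K') : m = -n := by
  obtain ⟨x, hx⟩ := hF
  refine eq_of_one_le_inner hm.1 (by rw [norm_neg, hn.1]) ?_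
  by_contra hlt
  rw [inner_neg_right, not_le] at hlt
  have hdir_n : ⟪n, -(n + m)⟫ < 0 := by
    rw [inner_neg_right, inner_add_right, real_inner_self_eq_norm_sq, hn.1, real_inner_comm]
    linarith
  have hdir_m : ⟪m, -(n + m)⟫ < 0 := by
    rw [inner_neg_right, inner_add_right, real_inner_self_eq_norm_sq, hm.1]
    linarith
  obtain ⟨t, ht⟩ := ((hn.eventually_mem hx hdir_n).and (hm.eventually_mem hx hdir_m)).exists
  exact Set.disjoint_left.1 hd ht.1 ht.2

theorem eq_of_subset (hn : IsOutwardNormal K F n) (hm : IsOutwardNormal K' F m)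
    (hF : F.Nonempty) (hd : K ⊆ K') : m = n := by
  obtain ⟨x, hx⟩ := hF
  refine eq_of_one_le_inner hm.1 hn.1 ?_
  by_contra hlt
  rw [not_le] at hlt
  have hdir_n : ⟪n, m - n⟫ < 0 := by
    rw [inner_sub_right, real_inner_self_eq_norm_sq, hn.1, real_inner_comm]
    linarith
  have hdir_m : 0 < ⟪m, m - n⟫ := by
    rw [inner_sub_right, real_inner_self_eq_norm_sq, hm.1]
    linarith
  obtain ⟨t, ht⟩ :=
    ((hn.eventually_mem hx hdir_n).and (hm.eventually_notMem_closure hx hdir_m)).exists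
  exact ht.2 (subset_closure (hd ht.1))

-- Near `x`, the two sides of the hyperplane belong to `K` and `K'`, which leaves only a null set.
theorem notMem_closure_of_disjoint {K'' : Set (E d)} (hK : IsOutwardNormal K F n)
    (hK' : IsOutwardNormal K' F (-n)) (hx : x ∈ F) (ho : IsOpen K'') (hd : Disjoint K'' K)
    (hd' : Disjoint K'' K') : x ∉ closure K'' := by
  intro hcl
  obtain ⟨r, hr, hball⟩ := hK.2 x hx
  obtain ⟨r', hr', hball'⟩ := hK'.2 x hx
  have hflat : K'' ∩ Metric.ball x (min r r') ⊆ {y | ⟪n, y - x⟫ = 0} := by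
    rintro y ⟨hy, hyr⟩
    by_contra hne
    rcases lt_or_gt_of_ne (a := ⟪n, y - x⟫) hne with hlt | hgt
    · have hyK := hball.ge ⟨hlt, Metric.ball_subset_ball (min_le_left r r') hyr⟩
      exact Set.disjoint_left.1 hd hy hyK.1
    · have hneg : ⟪-n, y - x⟫ < 0 := by rwa [inner_neg_left, neg_lt_zero]
      have hyK := hball'.ge ⟨hneg, Metric.ball_subset_ball (min_le_right r r') hyr⟩
      exact Set.disjoint_left.1 hd' hy hyK.1
  obtain ⟨y, hyr, hy⟩ := mem_closure_iff.1 hcl _ Metric.isOpen_ball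
    (Metric.mem_ball_self (lt_min hr hr'))
  have hpos := (ho.inter Metric.isOpen_ball).measure_pos volume ⟨y, hy, hyr⟩
  exact hpos.ne' (measure_mono_null hflat (volume_hyperplane hK.1 x))

end IsOutwardNormal

namespace Mesh

variable (T : Mesh Ω)

theorem mem_facesOf : F ∈ T.facesOf K ↔ F ∈ T.faces ∧ F ⊆ frontier K := by
  simp only [facesOf, facesOn, Finset.mem_filter]

theorem facesOf_disjoint (K : Set (E d)) :
    (T.facesOf K : Set (Set (E d))).PairwiseDisjoint id :=
  T.faces_disjoint.subset fun _ hF => (T.mem_facesOf.1 hF).1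

open scoped Classical in
/-- The elements that have `F` as a face. -/
noncomputable def adjacent (F : Set (E d)) : Finset (Set (E d)) :=
  T.elems.filter fun K => F ⊆ frontier K

theorem mem_adjacent : K ∈ T.adjacent F ↔ K ∈ T.elems ∧ F ⊆ frontier K := by
  simp only [adjacent, Finset.mem_filter]

theorem mem_facesOf_of_mem_adjacent (hF : F ∈ T.faces) (hK : K ∈ T.adjacent F) :
    F ∈ T.facesOf K :=
  T.mem_facesOf.2 ⟨hF, (T.mem_adjacent.1 hK).2⟩

theorem sum_elems_faces (c : Set (E d) → Set (E d) → ℝ) :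
    ∑ K ∈ T.elems, ∑ F ∈ T.facesOf K, c K F = ∑ F ∈ T.faces, ∑ K ∈ T.adjacent F, c K F := by
  refine Finset.sum_comm' fun K F => ?_
  rw [mem_facesOf, mem_adjacent]
  tauto

theorem adjacent_nonempty (hF : F ∈ T.faces) : (T.adjacent F).Nonempty := by
  rw [← Finset.card_pos, adjacent]
  rcases T.face_cases F hF with h | h
  · rw [T.interior_face F hF h]; norm_num
  · rw [T.boundary_face F hF h]; norm_num

theorem exists_mem_facesOf (hF : F ∈ T.faces) : ∃ K ∈ T.elems, F ∈ T.facesOf K := by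
  obtain ⟨K, hK⟩ := T.adjacent_nonempty hF
  exact ⟨K, (T.mem_adjacent.1 hK).1, T.mem_facesOf_of_mem_adjacent hF hK⟩

theorem isFlatFace (hF : F ∈ T.faces) : IsFlatFace F := by
  obtain ⟨K, hK, hFK⟩ := T.exists_mem_facesOf hF
  exact (T.element K hK).face F hFK

theorem ae_surf_mem (hF : F ∈ T.faces) : ∀ᵐ x ∂(surf F), x ∈ F := by
  obtain ⟨K, hK, hFK⟩ := T.exists_mem_facesOf hF
  exact (T.element K hK).ae_surf_mem hFK

theorem isFiniteMeasure_surf (hF : F ∈ T.faces) : IsFiniteMeasure (surf F) := by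
  obtain ⟨K, hK, hFK⟩ := T.exists_mem_facesOf hF
  exact (T.element K hK).isFiniteMeasure_surf hFK

theorem isOutwardNormal_faceNormal (hF : F ∈ T.faces) (hK : K ∈ T.adjacent F) :
    IsOutwardNormal K F (faceNormal K F) :=
  (T.element K (T.mem_adjacent.1 hK).1).isOutwardNormal_faceNormal
    (T.mem_facesOf_of_mem_adjacent hF hK)

theorem faceNormal_eq_neg (hF : F ∈ T.faces) (hK : K ∈ T.adjacent F)
    (hK' : K' ∈ T.adjacent F) (hne : K ≠ K') : faceNormal K' F = -faceNormal K F :=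
  (T.isOutwardNormal_faceNormal hF hK).eq_neg_of_disjoint (T.isOutwardNormal_faceNormal hF hK')
    (T.isFlatFace hF).connected.nonempty
    (T.elems_disjoint (T.mem_adjacent.1 hK).1 (T.mem_adjacent.1 hK').1 hne)

theorem exists_adjacent_eq_pair (hF : F ∈ T.faces) (hFΩ : F ⊆ Ω) :
    ∃ K K', K ≠ K' ∧ T.adjacent F = {K, K'} :=
  Finset.card_eq_two.1 (T.interior_face F hF hFΩ)

theorem mem_adjacent_of_mem_closure (hF : F ∈ T.faces) (hFΩ : F ⊆ Ω) (hK : K ∈ T.elems)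
    (hx : x ∈ F) (hxK : x ∈ closure K) : K ∈ T.adjacent F := by
  by_contra hKF
  obtain ⟨K₁, K₂, hne, hadj⟩ := T.exists_adjacent_eq_pair hF hFΩ
  have hK₁ : K₁ ∈ T.adjacent F := by simp only [hadj, Finset.mem_insert, true_or]
  have hK₂ : K₂ ∈ T.adjacent F := by
    simp only [hadj, Finset.mem_insert, Finset.mem_singleton, or_true]
  have hn₂ := T.isOutwardNormal_faceNormal hF hK₂
  rw [T.faceNormal_eq_neg hF hK₁ hK₂ hne] at hn₂
  have hdisj (K') (hK' : K' ∈ T.adjacent F) : Disjoint K K' :=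
    T.elems_disjoint hK (T.mem_adjacent.1 hK').1 fun h => hKF (h ▸ hK')
  exact (T.isOutwardNormal_faceNormal hF hK₁).notMem_closure_of_disjoint hn₂ hx
    (T.element K hK).isOpen (hdisj K₁ hK₁) (hdisj K₂ hK₂) hxK

theorem subset_awayFrom (hF : F ∈ T.faces) (hFΩ : F ⊆ Ω) : F ⊆ awayFrom T.faces F := by
  refine fun x hx => mem_awayFrom.2 fun F' hF' hne hxF' => ?_
  obtain ⟨K, hK⟩ := T.adjacent_nonempty hF'
  obtain ⟨hKT, hF'K⟩ := T.mem_adjacent.1 hK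
  have hxK : x ∈ closure K :=
    frontier_subset_closure (closure_minimal hF'K isClosed_frontier hxF')
  have hFK := T.mem_adjacent_of_mem_closure hF hFΩ hKT hx hxK
  exact Set.disjoint_left.1 ((T.element K hKT).disjoint_closure (T.facesOf_disjoint K)
    (T.mem_facesOf_of_mem_adjacent hF hFK) (T.mem_facesOf_of_mem_adjacent hF' hK) hne.symm) hx hxF'

theorem iUnion_elems_ae_eq : (Ω : Set (E d)) =ᵐ[volume] ⋃ K ∈ T.elems, K := by
  refine ae_eq_set.2 ⟨?_, ?_⟩
  · have hnull : volume (⋃ K ∈ T.elems, frontier K) = 0 :=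
      (measure_biUnion_null_iff T.elems.countable_toSet).2 fun K hK =>
        (T.element K hK).volume_frontier
    refine measure_mono_null ?_ hnull
    rintro x ⟨hx, hx'⟩
    have hxc : x ∈ closure Ω := subset_closure hx
    rw [T.cover] at hxc
    obtain ⟨K, hK, hxK⟩ := Set.mem_iUnion₂.1 hxc
    refine Set.mem_iUnion₂.2 ⟨K, hK, ?_⟩
    rw [(T.element K hK).isOpen.frontier_eq]
    exact ⟨hxK, fun h => hx' (Set.mem_iUnion₂.2 ⟨K, hK, h⟩)⟩
  · rw [Set.sdiff_eq_empty.2 (Set.iUnion₂_subset T.elems_subset), measure_empty]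

theorem integral_eq_sum {h : E d → ℝ} (hh : Integrable h (volume.restrict Ω)) :
    ∫ x in Ω, h x = ∑ K ∈ T.elems, ∫ x in K, h x := by
  rw [← integral_biUnion_finset T.elems (fun K hK => (T.element K hK).isOpen.measurableSet)
    T.elems_disjoint (fun K hK => hh.mono_measure
      (Measure.restrict_mono (T.elems_subset K hK) le_rfl))]
  exact setIntegral_congr_set T.iUnion_elems_ae_eq

end Mesh

end MeshGeometry

/-! ### Continuity of the flux -/

namespace Mesh

variable {Ω : Set (E d)} (T : Mesh Ω) {f u v : E d → ℝ}

theorem sum_integral_normalDeriv_mul_test (hf : MemLp f 2 (volume.restrict Ω))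
    (hu : IsWeakSolution Ω f u) (hun : ∀ K ∈ T.elems, HasNormalDeriv K (T.facesOf K) u)
    {φ : E d → ℝ} (hφ : IsTest Ω φ) :
    ∑ K ∈ T.elems, ∑ F ∈ T.facesOf K,
      ∫ x, normalDeriv K (T.facesOf K) u x * φ x ∂(surf F) = 0 := by
  have hΩ := T.domain.isOpen
  have hweak := hu.integral_test hΩ hφ
  rw [T.integral_eq_sum (integrable_inner_of_memLp hu.1.1.memLp_grad hφ.memLp_gradient),
    T.integral_eq_sum (h := fun x => f x * φ x) (hf.integrable_mul hφ.memLp), ← sub_eq_zero,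
    ← Finset.sum_sub_distrib] at hweak
  rw [← hweak]
  refine Finset.sum_congr rfl fun K hK => ?_
  obtain ⟨l, hl⟩ := isNormalDeriv_normalDeriv (hun K hK)
  have hP := T.element K hK
  have hKΩ := T.elems_subset K hK
  rw [← hl.2.2 φ hφ.1, sub_eq_add_neg, ← integral_neg]
  congr 1
  · exact integral_congr_ae ((hu.1.1.grad_ae_eq_of_subset hΩ.measurableSet hP.isOpen hKΩ).mono
      fun x hx => by simp only [hx])
  · exact integral_congr_ae ((hu.laplacian_ae_eq hΩ hP hKΩ hf hl).mono
      fun x hx => by simp only [hx, Pi.neg_apply, neg_mul])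

theorem integrable_normalDeriv (hun : ∀ K ∈ T.elems, HasNormalDeriv K (T.facesOf K) u)
    {K F : Set (E d)} (hK : K ∈ T.elems) (hF : F ∈ T.facesOf K) :
    Integrable (normalDeriv K (T.facesOf K) u) (surf F) := by
  obtain ⟨l, hl⟩ := isNormalDeriv_normalDeriv (hun K hK)
  exact hl.2.1 F hF

theorem sum_normalDeriv_ae_eq_zero (hf : MemLp f 2 (volume.restrict Ω))
    (hu : IsWeakSolution Ω f u) (hun : ∀ K ∈ T.elems, HasNormalDeriv K (T.facesOf K) u)
    {F : Set (E d)} (hF : F ∈ T.faces) (hFΩ : F ⊆ Ω) :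
    (fun x => ∑ K ∈ T.adjacent F, normalDeriv K (T.facesOf K) u x) =ᵐ[surf F] 0 := by
  have hI (K) (hK : K ∈ T.adjacent F) : Integrable (normalDeriv K (T.facesOf K) u) (surf F) :=
    T.integrable_normalDeriv hun (T.mem_adjacent.1 hK).1 (T.mem_facesOf_of_mem_adjacent hF hK)
  refine ae_eq_of_forall_isTest (isOpen_awayFrom.inter T.domain.isOpen)
    ((T.ae_surf_mem hF).mono fun x hx => ⟨T.subset_awayFrom hF hFΩ hx, hFΩ hx⟩)
    (integrable_finsetSum _ hI).locallyIntegrable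
    (integrable_zero (E d) ℝ (surf F)).locallyIntegrable fun φ hφ => ?_
  have hmul (K) (hK : K ∈ T.adjacent F) :
      Integrable (fun x => φ x * normalDeriv K (T.facesOf K) u x) (surf F) :=
    (hI K hK).locallyIntegrable.integrable_smul_left_of_hasCompactSupport
      hφ.1.continuous hφ.2.1
  have hflux := T.sum_integral_normalDeriv_mul_test hf hu hun (hφ.mono Set.inter_subset_right)
  have hother (F') (hF' : F' ∈ T.faces) (hne : F' ≠ F) :
      ∑ K ∈ T.adjacent F', ∫ x, normalDeriv K (T.facesOf K) u x * φ x ∂(surf F') = 0 := by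
    refine Finset.sum_eq_zero fun K _ => integral_surf_eq_zero ?_
    exact (disjoint_awayFrom hF' hne).mono_right
      (tsupport_mul_subset_right.trans (hφ.2.2.trans Set.inter_subset_left))
  rw [T.sum_elems_faces (fun K F => ∫ x, normalDeriv K (T.facesOf K) u x * φ x ∂(surf F)),
    Finset.sum_eq_single F hother (fun h => absurd hF h)] at hflux
  simp only [Pi.zero_apply, smul_eq_mul, mul_zero, integral_zero, Finset.mul_sum]
  rw [integral_finsetSum _ hmul]
  simpa only [mul_comm (φ _)] using hflux

theorem sum_integral_normalDeriv (hf : MemLp f 2 (volume.restrict Ω))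
    (hu : IsWeakSolution Ω f u) (hun : ∀ K ∈ T.elems, HasNormalDeriv K (T.facesOf K) u)
    {F : Set (E d)} (hF : F ∈ T.faces) (hFΩ : F ⊆ Ω) :
    ∑ K ∈ T.adjacent F, ∫ x, normalDeriv K (T.facesOf K) u x ∂(surf F) = 0 := by
  rw [← integral_finsetSum _ fun K hK => T.integrable_normalDeriv hun (T.mem_adjacent.1 hK).1
    (T.mem_facesOf_of_mem_adjacent hF hK),
    integral_congr_ae (T.sum_normalDeriv_ae_eq_zero hf hu hun hF hFΩ)]
  exact integral_zero _ _

theorem chi_mul_measure {F : Set (E d)} (hF : F ∈ T.faces) (K : Set (E d)) (v : E d → ℝ) :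
    T.chi K F v * (surf F).real Set.univ = ∫ x, trace K (T.facesOf K) v x ∂(surf F) := by
  have := T.isFiniteMeasure_surf hF
  by_cases h : (surf F).real Set.univ = 0
  · have hzero : surf F = 0 := by
      rwa [measureReal_eq_zero_iff, Measure.measure_univ_eq_zero] at h
    simp only [hzero, measureReal_zero_apply, mul_zero, integral_zero_measure]
  · rw [chi, mul_comm, ← mul_assoc, mul_inv_cancel₀ h, one_mul]

theorem memH1_of_mem_space (hv : v ∈ T.space) {K : Set (E d)} (hK : K ∈ T.elems) :
    MemH1 K v := (hv.2.1 K hK).1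

theorem exists_isTrace_of_mem_space (hv : v ∈ T.space) {K : Set (E d)}
    (hK : K ∈ T.elems) : ∃ g, IsTrace K (T.facesOf K) v g := (hv.2.1 K hK).2.1

-- The means of `v` are single-valued on interior faces, where the fluxes cancel, and vanish on
-- boundary faces.
theorem sum_chi_mul_integral_normalDeriv (hf : MemLp f 2 (volume.restrict Ω))
    (hu : IsWeakSolution Ω f u) (hun : ∀ K ∈ T.elems, HasNormalDeriv K (T.facesOf K) u)
    (hv : v ∈ T.space) :
    ∑ K ∈ T.elems, ∑ F ∈ T.facesOf K,
      T.chi K F v * ∫ x, normalDeriv K (T.facesOf K) u x ∂(surf F) = 0 := by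
  rw [T.sum_elems_faces fun K F => T.chi K F v * ∫ x, normalDeriv K (T.facesOf K) u x ∂(surf F)]
  refine Finset.sum_eq_zero fun F hF => ?_
  rcases T.face_cases F hF with hFΩ | hFΩ
  · obtain ⟨K₀, hK₀⟩ := T.adjacent_nonempty hF
    have hchi (K) (hK : K ∈ T.adjacent F) : T.chi K F v = T.chi K₀ F v := by
      obtain ⟨hKT, hFK⟩ := T.mem_adjacent.1 hK
      obtain ⟨hK₀T, hFK₀⟩ := T.mem_adjacent.1 hK₀
      simp only [chi, hv.2.2.1 K hKT K₀ hK₀T F hF hFΩ hFK hFK₀]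
    rw [Finset.sum_congr rfl fun K hK => by rw [hchi K hK], ← Finset.mul_sum,
      T.sum_integral_normalDeriv hf hu hun hF hFΩ, mul_zero]
  · refine Finset.sum_eq_zero fun K hK => ?_
    obtain ⟨hKT, hFK⟩ := T.mem_adjacent.1 hK
    rw [chi, hv.2.2.2 K hKT F hF hFΩ hFK, mul_zero, zero_mul]

end Mesh

/-! ### The boundary of a patch -/

namespace IsPolytope

variable {K : Set (E d)} {Fs : Finset (Set (E d))} {v w : E d → ℝ}

theorem volume_real_pos (hK : IsPolytope K Fs) : 0 < volume.real K :=
  ENNReal.toReal_pos (hK.isOpen.measure_pos volume hK.connected.nonempty).ne'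
    hK.bounded.measure_lt_top.ne

theorem integral_inner_grad_gradient_affine (hK : IsPolytope K Fs) (hv : MemH1 K v) (q : P1 d) :
    ∫ x in K, ⟪grad K v x, ∇ q x⟫ = ⟪∫ x in K, grad K v x, slope q⟫ := by
  have := hK.isFiniteMeasure_restrict
  simp only [gradient_affine]
  rw [real_inner_comm, ← integral_inner (hv.memLp_grad.integrable one_le_two)]
  simp only [real_inner_comm]

theorem integral_grad_sub (hK : IsPolytope K Fs) (hv : MemH1 K v) (hw : MemH1 K w) :
    ∫ x in K, grad K (v - w) x = (∫ x in K, grad K v x) - ∫ x in K, grad K w x := by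
  have := hK.isFiniteMeasure_restrict
  rw [integral_congr_ae (grad_sub_ae_eq hK.isOpen hv hw)]
  exact integral_sub (hv.memLp_grad.integrable one_le_two) (hw.memLp_grad.integrable one_le_two)

end IsPolytope

theorem Mesh.card_adjacent_le_two {Ω : Set (E d)} (T : Mesh Ω) {F : Set (E d)}
    (hF : F ∈ T.faces) : (T.adjacent F).card ≤ 2 := by
  rcases T.face_cases F hF with hFΩ | hFΩ
  · exact (T.interior_face F hF hFΩ).le
  · exact (T.boundary_face F hF hFΩ).le.trans one_le_two

theorem Mesh.integrable_surf {Ω : Set (E d)} (T : Mesh Ω) {F : Set (E d)} (hF : F ∈ T.faces)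
    {g : E d → ℝ} (hg : Continuous g) : Integrable g (surf F) := by
  obtain ⟨K, hK, hFK⟩ := T.exists_mem_facesOf hF
  exact (T.element K hK).integrable_surf hFK hg

namespace Patches

variable {Ω : Set (E d)} {T : Mesh Ω} (W : Patches T) {K K' F : Set (E d)} {x : E d}

open scoped Classical in
/-- The elements of the patch of `K` that have `F` as a face. -/
noncomputable def adjacent (K F : Set (E d)) : Finset (Set (E d)) :=
  (W.elems K).filter fun K' => F ⊆ frontier K'

theorem mem_adjacent : K' ∈ W.adjacent K F ↔ K' ∈ W.elems K ∧ F ⊆ frontier K' := by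
  simp only [adjacent, Finset.mem_filter]

theorem adjacent_subset (hK : K ∈ T.elems) : W.adjacent K F ⊆ T.adjacent F := fun _ hK' =>
  T.mem_adjacent.2 ⟨W.subset K hK (W.mem_adjacent.1 hK').1, (W.mem_adjacent.1 hK').2⟩

theorem sum_elems_faces (K : Set (E d)) (c : Set (E d) → Set (E d) → ℝ) :
    ∑ K' ∈ W.elems K, ∑ F ∈ T.facesOf K', c K' F =
      ∑ F ∈ T.faces, ∑ K' ∈ W.adjacent K F, c K' F := by
  refine Finset.sum_comm' fun K' F => ?_
  rw [T.mem_facesOf, mem_adjacent]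
  tauto

theorem mem_bdryFaces : F ∈ W.bdryFaces K ↔ F ∈ T.faces ∧ F ⊆ frontier (W.region K) := by
  simp only [bdryFaces, facesOn, Finset.mem_filter]

theorem region_subset_closure (hK : K ∈ T.elems) : W.region K ⊆ closure Ω :=
  Set.iUnion₂_subset fun K' hK' => closure_mono (T.elems_subset K' (W.subset K hK hK'))

theorem notMem_region_of_mem (hK : K ∈ T.elems) (hK' : K' ∈ T.elems) (hKK' : K' ∉ W.elems K)
    (hx : x ∈ K') : x ∉ W.region K := by
  intro hmem
  obtain ⟨L, hL, hxL⟩ := Set.mem_iUnion₂.1 hmem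
  have hdisj : Disjoint K' L :=
    T.elems_disjoint hK' (W.subset K hK hL) fun h => hKK' (h ▸ hL)
  exact Set.disjoint_left.1 (hdisj.closure_right (T.element K' hK').isOpen) hx hxL

-- On the far side of `F` lies either an element outside the patch or the exterior of `Ω`.
theorem eventually_notMem_region (hK : K ∈ T.elems) (hF : F ∈ T.faces)
    (hadj : W.adjacent K F = {K'}) (hx : x ∈ F) :
    ∀ᶠ t : ℝ in 𝓝[>] 0, x + t • faceNormal K' F ∉ W.region K := by
  have hK' : K' ∈ T.adjacent F := W.adjacent_subset hK (hadj ▸ Finset.mem_singleton_self K')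
  have hn := T.isOutwardNormal_faceNormal hF hK'
  have hnn : ⟪faceNormal K' F, faceNormal K' F⟫ = 1 := by
    rw [real_inner_self_eq_norm_sq, hn.1, one_pow]
  rcases T.face_cases F hF with hFΩ | hFΩ
  · obtain ⟨L, hL, hne⟩ : ∃ L ∈ T.adjacent F, L ≠ K' :=
      Finset.exists_mem_ne (by rw [Mesh.adjacent, T.interior_face F hF hFΩ]; exact one_lt_two) K'
    have hLW : L ∉ W.elems K := fun h => hne <| Finset.mem_singleton.1 <|
      hadj ▸ W.mem_adjacent.2 ⟨h, (T.mem_adjacent.1 hL).2⟩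
    have hnL := T.isOutwardNormal_faceNormal hF hL
    rw [T.faceNormal_eq_neg hF hK' hL hne.symm] at hnL
    have hneg : ⟪-faceNormal K' F, faceNormal K' F⟫ < 0 := by
      rw [inner_neg_left, hnn]
      norm_num
    exact (hnL.eventually_mem hx hneg).mono fun t ht =>
      W.notMem_region_of_mem hK (T.mem_adjacent.1 hL).1 hLW ht
  · obtain ⟨m, hm⟩ := T.domain.normal F (T.mem_facesOf.2 ⟨hF, hFΩ⟩)
    rw [hn.eq_of_subset hm ⟨x, hx⟩ (T.elems_subset K' (T.mem_adjacent.1 hK').1)] at hm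
    exact (hm.eventually_notMem_closure hx (hnn ▸ one_pos)).mono fun t ht hmem =>
      ht (W.region_subset_closure hK hmem)

theorem mem_bdryFaces_of_adjacent_eq_singleton (hK : K ∈ T.elems) (hF : F ∈ T.faces)
    (hadj : W.adjacent K F = {K'}) : F ∈ W.bdryFaces K := by
  have hK' := W.mem_adjacent.1 (hadj ▸ Finset.mem_singleton_self K')
  refine W.mem_bdryFaces.2 ⟨hF, fun x hx => ?_⟩
  rw [frontier_eq_closure_inter_closure]
  exact ⟨subset_closure (Set.mem_iUnion₂.2 ⟨K', hK'.1, frontier_subset_closure (hK'.2 hx)⟩),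
    mem_closure_of_tendsto (tendsto_add_smul_nhdsGT_zero x _)
      (W.eventually_notMem_region hK hF hadj hx)⟩

theorem sum_faceNormal_eq_zero (hK : K ∈ T.elems) (hF : F ∈ T.faces)
    (hb : F ∉ W.bdryFaces K) : ∑ K' ∈ W.adjacent K F, faceNormal K' F = 0 := by
  have hcard : (W.adjacent K F).card ≤ 2 :=
    (Finset.card_le_card (W.adjacent_subset hK)).trans (T.card_adjacent_le_two hF)
  interval_cases h : (W.adjacent K F).card
  · rw [Finset.card_eq_zero.1 h, Finset.sum_empty]
  · obtain ⟨K', hK'⟩ := Finset.card_eq_one.1 h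
    exact absurd (W.mem_bdryFaces_of_adjacent_eq_singleton hK hF hK') hb
  · obtain ⟨K₁, K₂, hne, hpair⟩ := Finset.card_eq_two.1 h
    have hsub := W.adjacent_subset hK (F := F)
    rw [hpair] at hsub
    rw [hpair, Finset.sum_pair hne, T.faceNormal_eq_neg hF (hsub (Finset.mem_insert_self _ _))
      (hsub (Finset.mem_insert_of_mem (Finset.mem_singleton_self _))) hne, add_neg_cancel]

/-- The `(d-1)`-dimensional measure `|∂ω_K|` of the boundary of the patch of `K`. -/
noncomputable def bdryMeasure (K : Set (E d)) : ℝ := ∑ F ∈ W.bdryFaces K, (surf F).real Set.univ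

theorem mem_faces_of_mem_bdryFaces (hF : F ∈ W.bdryFaces K) : F ∈ T.faces :=
  (W.mem_bdryFaces.1 hF).1

theorem sum_integral_fderiv (hK : K ∈ T.elems) (a : E d) {φ : E d → ℝ} (hφ : ContDiff ℝ 1 φ) :
    ∑ K' ∈ W.elems K, ∫ x in K', fderiv ℝ φ x a =
      ∑ F ∈ W.bdryFaces K, ⟪∑ K' ∈ W.adjacent K F, faceNormal K' F, a⟫ * ∫ x, φ x ∂(surf F) := by
  have hgreen (K') (hK' : K' ∈ W.elems K) : ∫ x in K', fderiv ℝ φ x a =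
      ∑ F ∈ T.facesOf K', ⟪faceNormal K' F, a⟫ * ∫ x, φ x ∂(surf F) :=
    (T.element K' (W.subset K hK hK')).integral_fderiv (T.facesOf_disjoint K') a hφ
  rw [Finset.sum_congr rfl hgreen,
    W.sum_elems_faces K fun K' F => ⟪faceNormal K' F, a⟫ * ∫ x, φ x ∂(surf F)]
  simp only [← Finset.sum_mul, ← sum_inner]
  refine (Finset.sum_subset (fun F hF => W.mem_faces_of_mem_bdryFaces hF)
    fun F hF hb => ?_).symm
  rw [W.sum_faceNormal_eq_zero hK hF hb, inner_zero_left, zero_mul]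

-- If the boundary were a null set, Green's formula for `x ↦ ⟪a, x⟫` with `‖a‖ = 1` would give the
-- patch volume zero.
theorem bdryMeasure_pos (hd : 0 < d) (hK : K ∈ T.elems) : 0 < W.bdryMeasure K := by
  refine (Finset.sum_nonneg fun F _ => measureReal_nonneg).lt_of_ne fun hzero => ?_
  have hsurf (F) (hF : F ∈ W.bdryFaces K) : surf F = 0 := by
    have := T.isFiniteMeasure_surf (W.mem_faces_of_mem_bdryFaces hF)
    rw [← Measure.measure_univ_eq_zero, ← measureReal_eq_zero_iff]
    exact (Finset.sum_eq_zero_iff_of_nonneg fun F _ => measureReal_nonneg).1 hzero.symm F hF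
  obtain ⟨a, ha⟩ : ∃ a : E d, ⟪a, a⟫ = 1 :=
    ⟨EuclideanSpace.single ⟨0, hd⟩ 1, by rw [real_inner_self_eq_norm_sq]; simp⟩
  have hgreen := W.sum_integral_fderiv hK a (contDiff_affine (affineOf a 0))
  have hbdry : ∑ F ∈ W.bdryFaces K,
      ⟪∑ K' ∈ W.adjacent K F, faceNormal K' F, a⟫ * ∫ x, affineOf a 0 x ∂(surf F) = 0 :=
    Finset.sum_eq_zero fun F hF => by rw [hsurf F hF, integral_zero_measure, mul_zero]
  rw [hbdry] at hgreen
  simp only [← inner_gradient_left (𝕜 := ℝ), gradient_affine, slope_affineOf, ha,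
    setIntegral_const, smul_eq_mul, mul_one] at hgreen
  have hpos : 0 < ∑ K' ∈ W.elems K, volume.real K' := Finset.sum_pos
    (fun K' hK' => (T.element K' (W.subset K hK hK')).volume_real_pos) ⟨K, W.self_mem K hK⟩
  exact hpos.ne' hgreen

/-! ### The elliptic projections -/

theorem bdryIntegralP1_eq (K : Set (E d)) (p : P1 d) : W.bdryIntegralP1 K p =
    ∑ F ∈ W.bdryFaces K, (∫ x, ⟪slope p, x⟫ ∂(surf F)) + p 0 * W.bdryMeasure K := by
  rw [bdryIntegralP1, bdryMeasure, Finset.mul_sum, ← Finset.sum_add_distrib]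
  refine Finset.sum_congr rfl fun F hF => ?_
  have hFT := W.mem_faces_of_mem_bdryFaces hF
  have := T.isFiniteMeasure_surf hFT
  rw [integral_congr_ae (ae_of_all _ (affine_apply p))]
  rw [integral_add (T.integrable_surf hFT (by fun_prop)) (integrable_const _), integral_const,
    smul_eq_mul, mul_comm (p 0)]

theorem exists_slope_eq (hd : 0 < d) (hK : K ∈ T.elems) (g : E d) (b : ℝ) :
    ∃ p : P1 d, slope p = g ∧ W.bdryIntegralP1 K p = b := by
  refine ⟨affineOf g ((b - ∑ F ∈ W.bdryFaces K, ∫ x, ⟪g, x⟫ ∂(surf F)) / W.bdryMeasure K),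
    slope_affineOf _ _, ?_⟩
  rw [bdryIntegralP1_eq, slope_affineOf, affineOf_apply, inner_zero_right, zero_add,
    div_mul_cancel₀ _ (W.bdryMeasure_pos hd hK).ne', add_sub_cancel]

theorem eq_of_slope_eq (hd : 0 < d) (hK : K ∈ T.elems) {p q : P1 d} (h : slope p = slope q)
    (hb : W.bdryIntegralP1 K p = W.bdryIntegralP1 K q) : p = q := by
  refine affine_ext h ?_
  rw [bdryIntegralP1_eq, bdryIntegralP1_eq, h] at hb
  exact mul_right_cancel₀ (W.bdryMeasure_pos hd hK).ne' (add_left_cancel hb)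

theorem bdryIntegralP1_sub (p q : P1 d) :
    W.bdryIntegralP1 K (p - q) = W.bdryIntegralP1 K p - W.bdryIntegralP1 K q := by
  rw [bdryIntegralP1, bdryIntegralP1, bdryIntegralP1, ← Finset.sum_sub_distrib]
  refine Finset.sum_congr rfl fun F hF => ?_
  have hFT := W.mem_faces_of_mem_bdryFaces hF
  exact integral_sub (T.integrable_surf hFT (contDiff_affine p (k := 1)).continuous)
    (T.integrable_surf hFT (contDiff_affine q (k := 1)).continuous)

theorem bdryIntegral_sub (hK : K ∈ T.elems) {v w : E d → ℝ} (hv : v ∈ T.space)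
    (hw : w ∈ T.space) :
    W.bdryIntegral K (v - w) = W.bdryIntegral K v - W.bdryIntegral K w := by
  rw [bdryIntegral, bdryIntegral, bdryIntegral, ← Finset.sum_sub_distrib]
  refine Finset.sum_congr rfl fun F hF => ?_
  rw [← Finset.sum_sub_distrib]
  refine Finset.sum_congr rfl fun K' hK' => ?_
  obtain ⟨hK'W, hFK'⟩ := W.mem_adjacent.1 hK'
  have hK'T := W.subset K hK hK'W
  exact (T.element K' hK'T).integral_trace_sub (T.facesOf_disjoint K')
    (T.memH1_of_mem_space hv hK'T) (T.memH1_of_mem_space hw hK'T)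
    (T.exists_isTrace_of_mem_space hv hK'T) (T.exists_isTrace_of_mem_space hw hK'T)
    (T.mem_facesOf.2 ⟨W.mem_faces_of_mem_bdryFaces hF, hFK'⟩)

theorem forall_integral_gradient_eq_iff {D : Set (E d)} (h0 : volume.real D ≠ 0) (p : P1 d)
    (m : E d) : (∀ q : P1 d, ∫ x in D, ⟪∇ p x, ∇ q x⟫ = ⟪m, slope q⟫) ↔
      slope p = (volume.real D)⁻¹ • m := by
  have henergy (q : P1 d) : ∫ x in D, ⟪∇ p x, ∇ q x⟫ = ⟪volume.real D • slope p, slope q⟫ := by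
    simp only [gradient_affine, setIntegral_const, real_inner_smul_left, smul_eq_mul]
  simp only [henergy, eq_inv_smul_iff₀ h0]
  refine ⟨fun h => ext_inner_right ℝ fun b => ?_, fun h q => by rw [h]⟩
  simpa only [slope_affineOf] using h (affineOf b 0)

theorem volume_real_region_pos (hK : K ∈ T.elems) : 0 < volume.real (W.region K) := by
  have hsub : K ⊆ W.region K := fun x hx =>
    Set.mem_iUnion₂.2 ⟨K, W.self_mem K hK, subset_closure hx⟩
  have hbdd : Bornology.IsBounded (W.region K) :=
    T.domain.bounded.closure.subset (W.region_subset_closure hK)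
  exact (T.element K hK).volume_real_pos.trans_le
    (measureReal_mono hsub hbdd.measure_lt_top.ne)

section Projections

variable {v w : E d → ℝ}

theorem isProjK_iff (hK : K ∈ T.elems) (hv : MemH1 K v) (p : P1 d) :
    W.IsProjK K v p ↔ slope p = (volume.real K)⁻¹ • (∫ x in K, grad K v x) ∧
      W.bdryIntegralP1 K p = W.bdryIntegral K v := by
  have hP := T.element K hK
  rw [IsProjK, ← forall_integral_gradient_eq_iff hP.volume_real_pos.ne']
  simp only [hP.integral_inner_grad_gradient_affine hv]

theorem isProjPatch_iff (hK : K ∈ T.elems) (hv : ∀ K' ∈ T.elems, MemH1 K' v) (p : P1 d) :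
    W.IsProjPatch K v p ↔
      slope p = (volume.real (W.region K))⁻¹ • (∑ K' ∈ W.elems K, ∫ x in K', grad K' v x) ∧
      W.bdryIntegralP1 K p = W.bdryIntegral K v := by
  have henergy (q : P1 d) : ∑ K' ∈ W.elems K, ∫ x in K', ⟪grad K' v x, ∇ q x⟫ =
      ⟪∑ K' ∈ W.elems K, ∫ x in K', grad K' v x, slope q⟫ := by
    rw [sum_inner]
    refine Finset.sum_congr rfl fun K' hK' => ?_
    have hK'T := W.subset K hK hK'
    exact (T.element K' hK'T).integral_inner_grad_gradient_affine (hv K' hK'T) q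
  rw [IsProjPatch, ← forall_integral_gradient_eq_iff (W.volume_real_region_pos hK).ne']
  simp only [henergy]

theorem isProjK_projK (hd : 0 < d) (hK : K ∈ T.elems) (hv : MemH1 K v) :
    W.IsProjK K v (W.projK K v) := by
  obtain ⟨p, hp⟩ := W.exists_slope_eq hd hK
    ((volume.real K)⁻¹ • (∫ x in K, grad K v x)) (W.bdryIntegral K v)
  exact Classical.epsilon_spec ⟨p, (W.isProjK_iff hK hv p).2 hp⟩

theorem isProjPatch_projPatch (hd : 0 < d) (hK : K ∈ T.elems)
    (hv : ∀ K' ∈ T.elems, MemH1 K' v) : W.IsProjPatch K v (W.projPatch K v) := by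
  obtain ⟨p, hp⟩ := W.exists_slope_eq hd hK
    ((volume.real (W.region K))⁻¹ • (∑ K' ∈ W.elems K, ∫ x in K', grad K' v x))
    (W.bdryIntegral K v)
  exact Classical.epsilon_spec ⟨p, (W.isProjPatch_iff hK hv p).2 hp⟩

theorem projK_sub (hd : 0 < d) (hK : K ∈ T.elems) (hv : v ∈ T.space) (hw : w ∈ T.space) :
    W.projK K (v - w) = W.projK K v - W.projK K w := by
  have hvK := T.memH1_of_mem_space hv hK
  have hwK := T.memH1_of_mem_space hw hK
  have hsub := hvK.sub hwK
  obtain ⟨slope_v, bdry_v⟩ := (W.isProjK_iff hK hvK _).1 (W.isProjK_projK hd hK hvK)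
  obtain ⟨slope_w, bdry_w⟩ := (W.isProjK_iff hK hwK _).1 (W.isProjK_projK hd hK hwK)
  obtain ⟨slope_diff, bdry_diff⟩ := (W.isProjK_iff hK hsub _).1 (W.isProjK_projK hd hK hsub)
  refine W.eq_of_slope_eq hd hK ?_ ?_
  · rw [slope_sub, slope_v, slope_w, slope_diff, (T.element K hK).integral_grad_sub hvK hwK,
      smul_sub]
  · rw [bdryIntegralP1_sub, bdry_v, bdry_w, bdry_diff, W.bdryIntegral_sub hK hv hw]

theorem projPatch_sub (hd : 0 < d) (hK : K ∈ T.elems) (hv : v ∈ T.space) (hw : w ∈ T.space) :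
    W.projPatch K (v - w) = W.projPatch K v - W.projPatch K w := by
  have hvT (K') (hK' : K' ∈ T.elems) : MemH1 K' v := T.memH1_of_mem_space hv hK'
  have hwT (K') (hK' : K' ∈ T.elems) : MemH1 K' w := T.memH1_of_mem_space hw hK'
  have hsub (K') (hK' : K' ∈ T.elems) : MemH1 K' (v - w) := (hvT K' hK').sub (hwT K' hK')
  obtain ⟨slope_v, bdry_v⟩ := (W.isProjPatch_iff hK hvT _).1 (W.isProjPatch_projPatch hd hK hvT)
  obtain ⟨slope_w, bdry_w⟩ := (W.isProjPatch_iff hK hwT _).1 (W.isProjPatch_projPatch hd hK hwT)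
  obtain ⟨slope_diff, bdry_diff⟩ :=
    (W.isProjPatch_iff hK hsub _).1 (W.isProjPatch_projPatch hd hK hsub)
  refine W.eq_of_slope_eq hd hK ?_ ?_
  · rw [slope_sub, slope_v, slope_w, slope_diff, ← smul_sub, ← Finset.sum_sub_distrib]
    refine congrArg _ (Finset.sum_congr rfl fun K' hK' => ?_)
    have hK'T := W.subset K hK hK'
    exact (T.element K' hK'T).integral_grad_sub (hvT K' hK'T) (hwT K' hK'T)
  · rw [bdryIntegralP1_sub, bdry_v, bdry_w, bdry_diff, W.bdryIntegral_sub hK hv hw]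

end Projections

end Patches

/-! ### The error equation -/

namespace Patches

variable {Ω : Set (E d)} {T : Mesh Ω} (W : Patches T) {K : Set (E d)} {f u uI v w z : E d → ℝ}

theorem ah_sub (hd : 0 < d) {S : Set (E d) → (E d → ℝ) → (E d → ℝ) → ℝ}
    (hS : ∀ K ∈ T.elems, ∀ w₁ ∈ localSpace K (T.facesOf K), ∀ w₂ ∈ localSpace K (T.facesOf K),
      ∀ z ∈ localSpace K (T.facesOf K), S K (w₁ - w₂) z = S K w₁ z - S K w₂ z)
    (hv : v ∈ T.space) (hw : w ∈ T.space) (hz : z ∈ T.space) :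
    W.ah S (v - w) z = W.ah S v z - W.ah S w z := by
  rw [ah, ah, ah, ← Finset.sum_sub_distrib]
  refine Finset.sum_congr rfl fun K hK => ?_
  have hloc (y) (hy : y ∈ T.space) : y - ⇑(W.projPatch K y) ∈ localSpace K (T.facesOf K) :=
    (T.element K hK).sub_affine_mem_localSpace (T.facesOf_disjoint K) (hy.2.1 K hK) _
  have hsplit : v - w - ⇑(W.projPatch K (v - w)) =
      (v - ⇑(W.projPatch K v)) - (w - ⇑(W.projPatch K w)) := by
    rw [W.projPatch_sub hd hK hv hw, AffineMap.coe_sub, sub_sub_sub_comm]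
  have hgrad : ∫ x in K, ⟪∇ (W.projK K (v - w)) x, ∇ (W.projK K z) x⟫ =
      (∫ x in K, ⟪∇ (W.projK K v) x, ∇ (W.projK K z) x⟫) -
        ∫ x in K, ⟪∇ (W.projK K w) x, ∇ (W.projK K z) x⟫ := by
    simp only [W.projK_sub hd hK hv hw, gradient_affine, slope_sub, inner_sub_left,
      setIntegral_const, smul_sub]
  rw [hsplit, hS K hK _ (hloc v hv) _ (hloc w hw) _ (hloc z hz), hgrad, add_sub_add_comm]

-- Both energies are determined by the face means, which `u` and its interpolant share.
theorem integral_gradient_projK_interpolant (hd : 0 < d) (hK : K ∈ T.elems)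
    (hu : MemH10 Ω u) (huI : T.IsInterpolant u uI) (q : P1 d) :
    ∫ x in K, ⟪∇ (W.projK K uI) x, ∇ q x⟫ = ∫ x in K, ⟪grad K u x, ∇ q x⟫ := by
  have hP := T.element K hK
  have hdis := T.facesOf_disjoint K
  have hΩ := T.domain.isOpen.measurableSet
  have hKΩ := T.elems_subset K hK
  have huIK := T.memH1_of_mem_space huI.1 hK
  rw [(W.isProjK_projK hd hK huIK).1 q]
  simp only [gradient_affine]
  rw [hP.integral_inner_grad_const hdis huIK (T.exists_isTrace_of_mem_space huI.1 hK),
    hP.integral_inner_grad_const hdis (hu.1.mono hΩ hKΩ)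
      (hP.exists_isTrace_of_memH10 hdis hΩ hKΩ hu)]
  refine Finset.sum_congr rfl fun F hF => ?_
  have hFT := (T.mem_facesOf.1 hF).1
  rw [← T.chi_mul_measure hFT, ← T.chi_mul_measure hFT, huI.2 K hK F hF]

-- The flux of an affine function is constant on each face, and `Π_K` preserves gradient means.
theorem sum_inner_faceNormal_mul_sub_projK (hd : 0 < d) (hK : K ∈ T.elems) (hv : v ∈ T.space)
    (a : E d) :
    ∑ F ∈ T.facesOf K, ⟪faceNormal K F, a⟫ *
      ((∫ x, trace K (T.facesOf K) v x ∂(surf F)) - ∫ x, W.projK K v x ∂(surf F)) = 0 := by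
  have hP := T.element K hK
  have hdis := T.facesOf_disjoint K
  have hvK := T.memH1_of_mem_space hv hK
  have henergy := (W.isProjK_projK hd hK hvK).1 (affineOf a 0)
  simp only [gradient_affine (affineOf a 0), slope_affineOf] at henergy
  simp only [mul_sub, Finset.sum_sub_distrib]
  rw [← hP.integral_inner_grad_const hdis hvK (T.exists_isTrace_of_mem_space hv hK),
    ← hP.integral_fderiv hdis a (contDiff_affine (W.projK K v)), ← henergy, sub_eq_zero]
  simp only [inner_gradient_left]

end Patches

namespace Mesh

variable {Ω : Set (E d)} (T : Mesh Ω) {K F : Set (E d)} {f u v : E d → ℝ}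

theorem integral_mul_affine_sub_energy (hK : K ∈ T.elems) (hf : MemLp f 2 (volume.restrict Ω))
    (hu : IsWeakSolution Ω f u) (hun : HasNormalDeriv K (T.facesOf K) u) (q : P1 d) :
    (∫ x in K, f x * q x) - ∫ x in K, ⟪grad K u x, ∇ q x⟫ =
      -∑ F ∈ T.facesOf K, ∫ x, normalDeriv K (T.facesOf K) u x * q x ∂(surf F) := by
  obtain ⟨l, hl⟩ := isNormalDeriv_normalDeriv hun
  have hload : ∫ x in K, l x * q x = -∫ x in K, f x * q x := by
    rw [← integral_neg]
    exact integral_congr_ae ((hu.laplacian_ae_eq T.domain.isOpen (T.element K hK)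
      (T.elems_subset K hK) hf hl).mono fun x hx => by simp only [hx, Pi.neg_apply, neg_mul])
  rw [← hl.2.2 q (contDiff_affine q), hload, neg_add, neg_neg, neg_add_eq_sub]

theorem integral_normalDeriv_sub_affine_mul (hK : K ∈ T.elems) (hu : MemH1 K u)
    (hun : HasNormalDeriv K (T.facesOf K) u) (p q : P1 d) (hF : F ∈ T.facesOf K) :
    ∫ x, normalDeriv K (T.facesOf K) (u - ⇑p) x * (T.chi K F v - q x) ∂(surf F) =
      T.chi K F v * (∫ x, normalDeriv K (T.facesOf K) u x ∂(surf F)) -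
      (∫ x, normalDeriv K (T.facesOf K) u x * q x ∂(surf F)) -
      ⟪faceNormal K F, slope p⟫ *
        ((∫ x, trace K (T.facesOf K) v x ∂(surf F)) - ∫ x, q x ∂(surf F)) := by
  have hP := T.element K hK
  have hFT := (T.mem_facesOf.1 hF).1
  have := T.isFiniteMeasure_surf hFT
  have hqc : Continuous q := (contDiff_affine q (k := 1)).continuous
  obtain ⟨l, hl⟩ := isNormalDeriv_normalDeriv hun
  have hg := hl.2.1 F hF
  have hgq := hP.integrable_mul_surf hF hg hqc
  have hq := T.integrable_surf hFT hqc
  set g := normalDeriv K (T.facesOf K) u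
  set c := ⟪faceNormal K F, slope p⟫
  have hexpand : ∫ x, normalDeriv K (T.facesOf K) (u - ⇑p) x * (T.chi K F v - q x) ∂(surf F) =
      ∫ x, (T.chi K F v * g x - g x * q x - c * (T.chi K F v - q x)) ∂(surf F) := by
    refine integral_congr_ae ?_
    filter_upwards [hP.normalDeriv_sub_affine (T.facesOf_disjoint K) hu hun p hF] with x hx
    rw [hx]
    ring
  have hflux : Integrable (fun x => T.chi K F v * g x - g x * q x) (surf F) :=
    (hg.const_mul _).sub hgq
  have hmean : Integrable (fun x => T.chi K F v - q x) (surf F) := (integrable_const _).sub hq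
  rw [hexpand, integral_sub hflux (hmean.const_mul c), integral_sub (hg.const_mul _) hgq,
    integral_const_mul, integral_const_mul, integral_sub (integrable_const _) hq, integral_const,
    smul_eq_mul, mul_comm ((surf F).real Set.univ), T.chi_mul_measure hFT]

end Mesh

namespace Patches

variable {Ω : Set (E d)} {T : Mesh Ω} (W : Patches T) {f u uh uI v : E d → ℝ}

theorem ah_sub_interpolant (hd : 0 < d) {S : Set (E d) → (E d → ℝ) → (E d → ℝ) → ℝ}
    (hS : ∀ K ∈ T.elems, ∀ w₁ ∈ localSpace K (T.facesOf K), ∀ w₂ ∈ localSpace K (T.facesOf K),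
      ∀ z ∈ localSpace K (T.facesOf K), S K (w₁ - w₂) z = S K w₁ z - S K w₂ z)
    (hf : MemLp f 2 (volume.restrict Ω)) (hu : IsWeakSolution Ω f u)
    (hun : ∀ K ∈ T.elems, HasNormalDeriv K (T.facesOf K) u) (huh : W.IsVEMSolution S f uh)
    (huI : T.IsInterpolant u uI) (hv : v ∈ T.space) :
    W.ah S (uh - uI) v =
      (-∑ K ∈ T.elems, ∑ F ∈ T.facesOf K,
        ∫ x, normalDeriv K (T.facesOf K) u x * W.projK K v x ∂(surf F)) -
      ∑ K ∈ T.elems, S K (uI - ⇑(W.projPatch K uI)) (v - ⇑(W.projPatch K v)) := by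
  rw [W.ah_sub hd hS huh.1 huI.1 hv, huh.2 v hv, ah, Finset.sum_add_distrib, ← sub_sub,
    ← Finset.sum_sub_distrib, ← Finset.sum_neg_distrib]
  refine congrArg (· - _) (Finset.sum_congr rfl fun K hK => ?_)
  rw [W.integral_gradient_projK_interpolant hd hK hu.1 huI,
    T.integral_mul_affine_sub_energy hK hf hu (hun K hK)]

theorem sum_integral_normalDeriv_sub_affine_mul (hd : 0 < d)
    (hf : MemLp f 2 (volume.restrict Ω)) (hu : IsWeakSolution Ω f u)
    (hun : ∀ K ∈ T.elems, HasNormalDeriv K (T.facesOf K) u) (hv : v ∈ T.space)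
    (uπ : Set (E d) → P1 d) :
    ∑ K ∈ T.elems, ∑ F ∈ T.facesOf K,
      ∫ x, normalDeriv K (T.facesOf K) (u - ⇑(uπ K)) x *
        (T.chi K F v - W.projK K v x) ∂(surf F) =
      -∑ K ∈ T.elems, ∑ F ∈ T.facesOf K,
        ∫ x, normalDeriv K (T.facesOf K) u x * W.projK K v x ∂(surf F) := by
  rw [← zero_sub, ← T.sum_chi_mul_integral_normalDeriv hf hu hun hv, ← Finset.sum_sub_distrib]
  refine Finset.sum_congr rfl fun K hK => ?_
  have huK : MemH1 K u := hu.1.1.mono T.domain.isOpen.measurableSet (T.elems_subset K hK)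
  rw [Finset.sum_congr rfl fun F hF => T.integral_normalDeriv_sub_affine_mul hK huK (hun K hK)
      (uπ K) (W.projK K v) hF,
    Finset.sum_sub_distrib, W.sum_inner_faceNormal_mul_sub_projK hd hK hv, sub_zero,
    Finset.sum_sub_distrib]

end Patches

end NCVEM

theorem lemma4p3_general {d : ℕ} (hd : 0 < d) {Ω : Set (NCVEM.E d)}
    (T : NCVEM.Mesh Ω) (W : NCVEM.Patches T)
    (S : Set (NCVEM.E d) → (NCVEM.E d → ℝ) → (NCVEM.E d → ℝ) → ℝ)
    (hS : ∀ K ∈ T.elems, ∀ w₁ ∈ NCVEM.localSpace K (T.facesOf K),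
      ∀ w₂ ∈ NCVEM.localSpace K (T.facesOf K), ∀ z ∈ NCVEM.localSpace K (T.facesOf K),
      S K (w₁ - w₂) z = S K w₁ z - S K w₂ z)
    (f u uh uI : NCVEM.E d → ℝ)
    (hf : MemLp f 2 (volume.restrict Ω))
    (hu : NCVEM.IsWeakSolution Ω f u)
    (hun : ∀ K ∈ T.elems, NCVEM.HasNormalDeriv K (T.facesOf K) u)
    (huh : W.IsVEMSolution S f uh)
    (huI : T.IsInterpolant u uI)
    (uπ : Set (NCVEM.E d) → NCVEM.P1 d)
    (vh : NCVEM.E d → ℝ) (hvh : vh ∈ T.space) :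
    W.ah S (uh - uI) vh =
      (∑ K ∈ T.elems, ∑ F ∈ T.facesOf K,
        ∫ x, NCVEM.normalDeriv K (T.facesOf K) (u - ⇑(uπ K)) x *
          (T.chi K F vh - W.projK K vh x) ∂(NCVEM.surf F)) -
      ∑ K ∈ T.elems, S K (uI - ⇑(W.projPatch K uI)) (vh - ⇑(W.projPatch K vh)) := by
  rw [W.ah_sub_interpolant hd hS hf hu hun huh huI hvh,
    W.sum_integral_normalDeriv_sub_affine_mul hd hf hu hun hvh uπ]

theorem lemma4p3 {d : ℕ} (hd : d = 2 ∨ d = 3) {Ω : Set (NCVEM.E d)}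
    (T : NCVEM.Mesh Ω) (W : NCVEM.Patches T)
    (S : Set (NCVEM.E d) → (NCVEM.E d → ℝ) → (NCVEM.E d → ℝ) → ℝ)
    (hS : ∀ K ∈ T.elems, NCVEM.IsBilinearOn (NCVEM.localSpace K (T.facesOf K)) (S K))
    (f u uh uI : NCVEM.E d → ℝ)
    (hf : MemLp f 2 (volume.restrict Ω))
    (hu : NCVEM.IsWeakSolution Ω f u)
    (hun : ∀ K ∈ T.elems, NCVEM.HasNormalDeriv K (T.facesOf K) u)
    (huh : W.IsVEMSolution S f uh)
    (huI : T.IsInterpolant u uI)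
    (uπ : Set (NCVEM.E d) → NCVEM.P1 d)
    (vh : NCVEM.E d → ℝ) (hvh : vh ∈ T.space) :
    W.ah S (uh - uI) vh =
      (∑ K ∈ T.elems, ∑ F ∈ T.facesOf K,
        ∫ x, NCVEM.normalDeriv K (T.facesOf K) (u - ⇑(uπ K)) x *
          (T.chi K F vh - W.projK K vh x) ∂(NCVEM.surf F)) -
      ∑ K ∈ T.elems, S K (uI - ⇑(W.projPatch K uI)) (vh - ⇑(W.projPatch K vh)) := by
  refine lemma4p3_general (by omega) T W S (fun K hK w₁ h₁ w₂ h₂ z hz => ?_) f u uh uI hf hu hun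
    huh huI uπ vh hvh
  simpa [add_comm, sub_eq_add_neg] using (hS K hK).1 (-1) w₂ h₂ w₁ h₁ z hz
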